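/- Let $G$ be a (Hausdorff) finite-dimensional real Lie group with Lie algebra $\mathfrak g$, and let $L:G\times\mathfrak g\times\mathbb R\to\mathbb R$, $(g,\xi,z)\mapsto L(g,\xi,z)$, be a smooth left-trivialized contact Lagrangian on $TG\times\mathbb R\simeq G\times\mathfrak g\times\mathbb R$ that is hyperregular: the contact Legendre transform $\mathbb FL(g,\xi,z)=(g,\mu,z)$, $\mu=\frac{\delta L}{\delta\xi}(g,\xi,z)$, is a diffeomorphism onto $T^*G\times\mathbb R\simeq G\times\mathfrak g^*\times\mathbb R$. Let $H(g,\mu,z)=\langle\mu,\xi\rangle-L(g,\xi,z)$ with $(g,\mu,z)=\mathbb FL(g,\xi,z)$, let $\theta=dz-\langle\mu,g^{-1}dg\rangle$, let $X_H$ be the vector field with $\iota_{X_H}\theta=-H$ and $\iota_{X_H}d\theta=dH-(\partial_zH)\theta$, and let $\Phi_H^t$ be its (maximal, possibly only partially defined) flow. The Euler–Poincaré–Herglotz (EPH) equations are $$\dot g=T_eL_g\xi,\qquad \dot z=L,\qquad \tfrac{d}{dt}\tfrac{\delta L}{\delta\xi}=\mathrm{ad}^*_\xi\tfrac{\delta L}{\delta\xi}+T_e^*L_g\tfrac{\delta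 L}{\delta g}+\tfrac{\partial L}{\partial z}\tfrac{\delta L}{\delta\xi}.$$ For $h>0$ call an open set $U\subset G\times\mathfrak g\times\mathbb R$ of initial states a *regular region* if every state in $U$ is the initial state of an EPH solution on $[0,h]$, an EPH solution on $[0,h]$ starting in $U$ is determined by its boundary data $(g(0),g(h),z(0))$, the set $D_U$ of these boundary data is open in $G\times G\times\mathbb R$, and the initial velocity $\xi(0)$ is a $C^1$ function on $D_U$. For $(g_0,g_1,z_0)\in D_U$ the exact discrete contact Lagrangian is $$L_h^{\mathrm e}(g_0,g_1,z_0)=\int_0^hL(g(t),\xi(t),z(t))\,dt$$ along the EPH solution starting in $U$ with $g(0)=g_0$, $g(h)=g_1$, $z(0)=z_0$. Then: 1. For every compact $K\subset G\times\mathfrak g\times\mathbb R$ there is $h_0>0$ such that for every $0<h<h_0$ some regular region contains $K$. 2. Let $h>0$, let $U$ be a regular region and $N\ge1$. Given $z_0$ and $g_0,\dots,g_N\in G$, put $z_{k+1}=z_k+L_h^{\mathrm e}(g_k,g_{k+1},z_k)$, and suppose that $(g_k,g_{k+1},z_k)\in D_U$ for all $k<N$. For $k<N$ let $x_k=(g_k,\xi_k,z_k)$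 be the initial state of the EPH solution with boundary data $(g_k,g_{k+1},z_k)$, and let $x_N$ be the final state of the last of these solutions, so that $x_N=(g_N,\xi_N,z_N)$ as well. Then the discrete Herglotz principle $\delta\mathcal S_d=0$, for $\mathcal S_d=\sum_{k=0}^{N-1}L_h^{\mathrm e}(g_k,g_{k+1},z_k)$ and all variations of $(g_k)$ with $g_0$ and $g_N$ fixed ($z_0$ being given), holds if and only if $\mathbb FL(x_{k+1})=\Phi_H^h(\mathbb FL(x_k))$ for all $k<N$. Conversely, all $y_0,\dots,y_N\in G\times\mathfrak g^*\times\mathbb R$ with $y_k\in\mathbb FL(U)$ and $y_{k+1}=\Phi_H^h(y_k)$ for $k<N$ arise as $y_k=\mathbb FL(x_k)$ from such a critical sequence $(g_k)$. 3. For every $h>0$ the domain of $\Phi_H^h$ is open, $\Phi_H^h$ is differentiable on it, and there $$(\Phi_H^h)^*\theta=\exp\Bigl(-\int_0^h(\partial_zH)\circ\Phi_H^t\,dt\Bigr)\,\theta .$$ 4. At each point $(g,\mu,z)$, which lies in the domain of $\Phi_H^h$ for all small $h>0$, $$(\Phi_H^h)^*\theta=\bigl(1-h\,\partial_zH(g,\mu,z)+O(h^2)\bigr)\,\theta\qquad(h\to0^+).$$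 -/

import Mathlib

open scoped Manifold ContDiff Topology
open Set Filter

/-! Contact Lagrangian systems on a Lie group `G` modelled on the finite-dimensional space `E`.
In Mathlib every tangent space of `G` is, as a vector space, the model space `E`; in particular
`E` is the Lie algebra `𝔤 = T_e G` (with the norm of `E`), and `E →L[ℝ] ℝ` is `𝔤*`. -/

set_option linter.unusedSectionVars false

noncomputable section

namespace ContactLie

section Trivialization

variable {E G : Type*} [NormedAddCommGroup E] [NormedSpace ℝ E]
  [TopologicalSpace G] [ChartedSpace E G] [Group G]

/-- `T_e L_g : 𝔤 → T_g G`, the derivative of left translation at the identity. -/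
def leftMap (g : G) : E →L[ℝ] E := mfderiv 𝓘(ℝ, E) 𝓘(ℝ, E) (fun a : G => g * a) 1

/-- `T_g L_{g⁻¹} : T_g G → 𝔤`, that is, the Maurer-Cartan form `v ↦ g⁻¹ v`. -/
def leftInv (g : G) : E →L[ℝ] E := mfderiv 𝓘(ℝ, E) 𝓘(ℝ, E) (fun a : G => g⁻¹ * a) g

variable (E G) in
/-- The left-trivialized velocity phase space `TG × ℝ ≃ G × 𝔤 × ℝ`. -/
abbrev VelSpace := G × E × ℝ

variable (E G) in
/-- The left-trivialized contact phase space `T*G × ℝ ≃ G × 𝔤* × ℝ`. -/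
abbrev PhaseSpace := G × (E →L[ℝ] ℝ) × ℝ

variable (E) in
/-- The manifold model of `G × 𝔤 × ℝ`. -/
abbrev velModel := (𝓘(ℝ, E)).prod ((𝓘(ℝ, E)).prod 𝓘(ℝ, ℝ))

variable (E) in
/-- The manifold model of `G × 𝔤* × ℝ`. -/
abbrev phaseModel := (𝓘(ℝ, E)).prod ((𝓘(ℝ, E →L[ℝ] ℝ)).prod 𝓘(ℝ, ℝ))

/-- The canonical contact form `θ = dz - ⟨μ, g⁻¹ dg⟩` on `G × 𝔤* × ℝ`. A tangent vector at
`y = (g, μ, z)` is a triple in `T_g G × 𝔤* × ℝ`. -/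
def contactForm (y : PhaseSpace E G) (v : E × (E →L[ℝ] ℝ) × ℝ) : ℝ :=
  v.2.2 - y.2.1 (leftInv y.1 v.1)

end Trivialization

section Bracket

variable {E G : Type*} [NormedAddCommGroup E] [NormedSpace ℝ E] [FiniteDimensional ℝ E]
  [TopologicalSpace G] [ChartedSpace E G] [Group G] [LieGroup 𝓘(ℝ, E) ∞ G]

variable (E G) in
/-- The adjoint action `ad_ξ η = [ξ, η]` on `𝔤`, for the Lie bracket of left-invariant vector
fields on `G`. -/
def adjoint (ξ : E) : E →L[ℝ] E :=
  haveI : LieGroup 𝓘(ℝ, E) (minSmoothness ℝ 3) G :=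
    LieGroup.of_le (n := ∞) (by
      rw [minSmoothness_of_isRCLikeNormedField]
      exact WithTop.coe_le_coe.2 (le_top : (3 : ℕ∞) ≤ ⊤))
  haveI : CompleteSpace E := FiniteDimensional.complete ℝ E
  LinearMap.toContinuousLinearMap
    (show E →ₗ[ℝ] E from
      (LieAlgebra.ad ℝ (GroupLieAlgebra 𝓘(ℝ, E) G) (show GroupLieAlgebra 𝓘(ℝ, E) G from ξ)))

theorem adjoint_apply (ξ η : E) :
    adjoint E G ξ η = (⁅(show GroupLieAlgebra 𝓘(ℝ, E) G from ξ),
      (show GroupLieAlgebra 𝓘(ℝ, E) G from η)⁆ : GroupLieAlgebra 𝓘(ℝ, E) G) := rfl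

variable (G) in
/-- The coadjoint action `⟨ad*_ξ μ, η⟩ = ⟨μ, [ξ, η]⟩`. -/
def coadjoint (ξ : E) (μ : E →L[ℝ] ℝ) : E →L[ℝ] ℝ := μ.comp (adjoint E G ξ)

end Bracket

/-! ### The Lagrangian side -/

section Lagrangian

variable {E G : Type*} [NormedAddCommGroup E] [NormedSpace ℝ E]
  [TopologicalSpace G] [ChartedSpace E G] [Group G]

/-- `δL/δξ ∈ 𝔤*`. -/
def dVel (L : VelSpace E G → ℝ) (x : VelSpace E G) : E →L[ℝ] ℝ :=
  fderiv ℝ (fun ξ => L (x.1, ξ, x.2.2)) x.2.1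

/-- `∂L/∂z`. -/
def dCost (L : VelSpace E G → ℝ) (x : VelSpace E G) : ℝ :=
  deriv (fun s => L (x.1, x.2.1, s)) x.2.2

/-- `T_e^* L_g (δL/δg) ∈ 𝔤*`. -/
def dBase (L : VelSpace E G → ℝ) (x : VelSpace E G) : E →L[ℝ] ℝ :=
  ContinuousLinearMap.comp
    (show E →L[ℝ] ℝ from mfderiv 𝓘(ℝ, E) 𝓘(ℝ, ℝ) (fun g => L (g, x.2)) x.1) (leftMap x.1)

/-- The contact Legendre transform `𝔽L (g, ξ, z) = (g, δL/δξ, z)`. -/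
def legendre (L : VelSpace E G → ℝ) (x : VelSpace E G) : PhaseSpace E G :=
  (x.1, dVel L x, x.2.2)

/-- `L` is hyperregular: `𝔽L` is a global diffeomorphism. -/
def IsHyperregular (L : VelSpace E G → ℝ) : Prop :=
  ∃ D : Diffeomorph (velModel E) (phaseModel E) (VelSpace E G) (PhaseSpace E G) ∞,
    ∀ x, D x = legendre L x

/-- The contact Hamiltonian `H (g, μ, z) = ⟨μ, ξ⟩ - L (g, ξ, z)` with `μ = δL/δξ (g, ξ, z)`. -/
def hamiltonian (L : VelSpace E G → ℝ) (y : PhaseSpace E G) : ℝ :=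
  y.2.1 (Function.invFun (legendre L) y).2.1 - L (Function.invFun (legendre L) y)

/-- `c = (g, ξ, z)` solves the Euler-Poincare-Herglotz equations of `L` on the time set `s`. -/
def IsEPHSolution [FiniteDimensional ℝ E] [LieGroup 𝓘(ℝ, E) ∞ G]
    (L : VelSpace E G → ℝ) (s : Set ℝ) (c : ℝ → VelSpace E G) : Prop :=
  ∀ t ∈ s,
    HasMFDerivWithinAt 𝓘(ℝ, ℝ) 𝓘(ℝ, E) (fun τ => (c τ).1) s t
      ((1 : ℝ →L[ℝ] ℝ).smulRight (leftMap (E := E) (c t).1 (c t).2.1)) ∧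
    HasDerivWithinAt (fun τ => (c τ).2.2) (L (c t)) s t ∧
    HasDerivWithinAt (fun τ => dVel L (c τ))
      (coadjoint G (c t).2.1 (dVel L (c t)) + dBase L (c t) + dCost L (c t) • dVel L (c t)) s t

end Lagrangian

/-! ### The Hamiltonian side -/

section Hamiltonian

variable {E G : Type*} [NormedAddCommGroup E] [NormedSpace ℝ E] [FiniteDimensional ℝ E]
  [TopologicalSpace G] [ChartedSpace E G] [Group G]

/-- `∂H/∂μ`, as an element of `𝔤 = 𝔤**`. -/
def dMomentum (H : PhaseSpace E G → ℝ) (y : PhaseSpace E G) : E :=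
  (Module.evalEquiv ℝ E).symm
    ((fderiv ℝ (fun μ => H (y.1, μ, y.2.2)) y.2.1 : (E →L[ℝ] ℝ) →ₗ[ℝ] ℝ) ∘ₗ
      (LinearMap.toContinuousLinearMap : (E →ₗ[ℝ] ℝ) ≃ₗ[ℝ] (E →L[ℝ] ℝ)).toLinearMap)

/-- `∂H/∂z`. -/
def hamCost (H : PhaseSpace E G → ℝ) (y : PhaseSpace E G) : ℝ :=
  deriv (fun s => H (y.1, y.2.1, s)) y.2.2

theorem apply_dMomentum (H : PhaseSpace E G → ℝ) (y : PhaseSpace E G) (ν : E →L[ℝ] ℝ) :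
    ν (dMomentum H y) = fderiv ℝ (fun μ => H (y.1, μ, y.2.2)) y.2.1 ν := by
  have := Module.apply_evalEquiv_symm_apply (R := ℝ) (M := E) (ν : E →ₗ[ℝ] ℝ)
    ((fderiv ℝ (fun μ => H (y.1, μ, y.2.2)) y.2.1 : (E →L[ℝ] ℝ) →ₗ[ℝ] ℝ) ∘ₗ
      (LinearMap.toContinuousLinearMap : (E →ₗ[ℝ] ℝ) ≃ₗ[ℝ] (E →L[ℝ] ℝ)).toLinearMap)
  exact this

/-- `T_e^* L_g (δH/δg) ∈ 𝔤*`. -/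
def hamBase (H : PhaseSpace E G → ℝ) (y : PhaseSpace E G) : E →L[ℝ] ℝ :=
  ContinuousLinearMap.comp
    (show E →L[ℝ] ℝ from mfderiv 𝓘(ℝ, E) 𝓘(ℝ, ℝ) (fun g => H (g, y.2)) y.1) (leftMap y.1)

variable [LieGroup 𝓘(ℝ, E) ∞ G]

/-- The exterior derivative `dθ` of the contact form. Write `ω = g⁻¹ dg`, so `θ = dz - ⟨μ, ω⟩`
and `dθ = - dμ ∧ ω - ⟨μ, dω⟩`; the Maurer-Cartan equation is `dω (v, w) = - [ω v, ω w]`. -/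
def contactFormD (y : PhaseSpace E G) (v w : E × (E →L[ℝ] ℝ) × ℝ) : ℝ :=
  -(v.2.1 (leftInv y.1 w.1) - w.2.1 (leftInv y.1 v.1))
    + y.2.1 (adjoint E G (leftInv y.1 v.1) (leftInv y.1 w.1))

/-- The contact Hamiltonian vector field `X_H` of `H`, in the left trivialization:
`g⁻¹ ġ = ∂H/∂μ`, `μ̇ = ad*_{∂H/∂μ} μ - T_e^* L_g (δH/δg) - (∂H/∂z) μ`,
`ż = ⟨μ, ∂H/∂μ⟩ - H`. -/
def contactField (H : PhaseSpace E G → ℝ) (y : PhaseSpace E G) : TangentSpace (phaseModel E) y :=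
  show E × (E →L[ℝ] ℝ) × ℝ from
    (leftMap y.1 (dMomentum H y),
      coadjoint G (dMomentum H y) y.2.1 - hamBase H y - hamCost H y • y.2.1,
      y.2.1 (dMomentum H y) - H y)

theorem leftInv_leftMap (g : G) (ξ : E) : leftInv g (leftMap g ξ) = ξ := by
  have h1 : (fun a : G => g⁻¹ * a) ∘ (fun a : G => g * a) = id := by
    funext a; simp
  have hd : ∀ (b c : G), MDifferentiableAt 𝓘(ℝ, E) 𝓘(ℝ, E) (fun a : G => b * a) c := fun b c =>
    (contMDiff_mul_left (I := 𝓘(ℝ, E)) (n := ∞)).mdifferentiableAt (by simp)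
  have h2 := mfderiv_comp_of_eq (I := 𝓘(ℝ, E)) (I' := 𝓘(ℝ, E)) (I'' := 𝓘(ℝ, E))
    (f := fun a : G => g * a) (g := fun a : G => g⁻¹ * a) (x := 1) (y := g)
    (hd _ _) (hd _ _) (mul_one g)
  rw [h1, mfderiv_id] at h2
  have h3 := congrArg (fun b : G => (show E →L[ℝ] E from
    mfderiv 𝓘(ℝ, E) 𝓘(ℝ, E) (fun a : G => g⁻¹ * a) b) (leftMap g ξ)) (mul_one g)
  exact h3.symm.trans (congrArg (fun f : E →L[ℝ] E => f ξ) h2).symm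

theorem leftMap_leftInv (g : G) (v : E) : leftMap g (leftInv g v) = v := by
  have h1 : (fun a : G => g * a) ∘ (fun a : G => g⁻¹ * a) = id := by
    funext a; simp
  have hd : ∀ (b c : G), MDifferentiableAt 𝓘(ℝ, E) 𝓘(ℝ, E) (fun a : G => b * a) c := fun b c =>
    (contMDiff_mul_left (I := 𝓘(ℝ, E)) (n := ∞)).mdifferentiableAt (by simp)
  have h2 := mfderiv_comp_of_eq (I := 𝓘(ℝ, E)) (I' := 𝓘(ℝ, E)) (I'' := 𝓘(ℝ, E))
    (f := fun a : G => g⁻¹ * a) (g := fun a : G => g * a) (x := g) (y := 1)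
    (hd _ _) (hd _ _) (inv_mul_cancel g)
  rw [h1, mfderiv_id] at h2
  have h3 := congrArg (fun b : G => (show E →L[ℝ] E from
    mfderiv 𝓘(ℝ, E) 𝓘(ℝ, E) (fun a : G => g * a) b) (leftInv g v)) (inv_mul_cancel g)
  exact h3.symm.trans (congrArg (fun f : E →L[ℝ] E => f v) h2).symm

theorem mfderiv_eq_partials (H : PhaseSpace E G → ℝ) (y : PhaseSpace E G)
    (hH : MDifferentiableAt (phaseModel E) 𝓘(ℝ, ℝ) H y) (w : E × (E →L[ℝ] ℝ) × ℝ) :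
    (show ℝ from mfderiv (phaseModel E) 𝓘(ℝ, ℝ) H y w) =
      hamBase H y (leftInv y.1 w.1) + w.2.1 (dMomentum H y) + hamCost H y * w.2.2 := by
  have h1 : MDifferentiableAt ((𝓘(ℝ, E →L[ℝ] ℝ)).prod 𝓘(ℝ, ℝ)) 𝓘(ℝ, ℝ)
      (fun m : (E →L[ℝ] ℝ) × ℝ => H (y.1, m)) y.2 :=
    MDifferentiableAt.comp (I' := phaseModel E) y.2 (g := H) (f := fun m => (y.1, m)) hH
      (mdifferentiableAt_const.prodMk mdifferentiableAt_id)
  have e1 := mfderiv_prod_eq_add_apply (v := w) hH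
  have e2 := mfderiv_prod_eq_add_apply (v := w.2) h1
  have e3 : hamBase H y (leftInv y.1 w.1) =
      (show E →L[ℝ] ℝ from mfderiv 𝓘(ℝ, E) 𝓘(ℝ, ℝ) (fun g => H (g, y.2)) y.1) w.1 := by
    show (show E →L[ℝ] ℝ from mfderiv 𝓘(ℝ, E) 𝓘(ℝ, ℝ) (fun g => H (g, y.2)) y.1)
      (leftMap y.1 (leftInv y.1 w.1)) = _
    rw [leftMap_leftInv]
  have e4 : (show (E →L[ℝ] ℝ) →L[ℝ] ℝ from mfderiv 𝓘(ℝ, E →L[ℝ] ℝ) 𝓘(ℝ, ℝ)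
      (fun μ : E →L[ℝ] ℝ => H (y.1, μ, y.2.2)) y.2.1) w.2.1 = w.2.1 (dMomentum H y) := by
    rw [apply_dMomentum, mfderiv_eq_fderiv]
  have e5 : (show ℝ →L[ℝ] ℝ from mfderiv 𝓘(ℝ, ℝ) 𝓘(ℝ, ℝ)
      (fun s : ℝ => H (y.1, y.2.1, s)) y.2.2) w.2.2 = hamCost H y * w.2.2 := by
    rw [mfderiv_eq_fderiv]
    show fderiv ℝ (fun s : ℝ => H (y.1, y.2.1, s)) y.2.2 w.2.2 = _
    rw [fderiv_eq_smul_deriv, smul_eq_mul, mul_comm, hamCost]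
  rw [e3, ← e4, ← e5, add_assoc]
  exact e1.trans (congrArg _ e2)

/-- `X_H` is characterized by `ι_{X_H} θ = -H` and `ι_{X_H} dθ = dH - (∂H/∂z) θ`. -/
theorem eq_contactField_iff (H : PhaseSpace E G → ℝ) (y : PhaseSpace E G)
    (hH : MDifferentiableAt (phaseModel E) 𝓘(ℝ, ℝ) H y) (v : E × (E →L[ℝ] ℝ) × ℝ) :
    v = contactField H y ↔
      contactForm y v = - H y ∧
      ∀ w : E × (E →L[ℝ] ℝ) × ℝ, contactFormD y v w =
        (show ℝ from mfderiv (phaseModel E) 𝓘(ℝ, ℝ) H y w) - hamCost H y * contactForm y w := by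
  constructor
  · rintro rfl
    refine ⟨?_, fun w => ?_⟩
    · show y.2.1 (dMomentum H y) - H y - y.2.1 (leftInv y.1 (leftMap y.1 (dMomentum H y))) = _
      rw [leftInv_leftMap]; ring
    · rw [mfderiv_eq_partials H y hH]
      show -((coadjoint G (dMomentum H y) y.2.1 - hamBase H y - hamCost H y • y.2.1)
          (leftInv y.1 w.1) - w.2.1 (leftInv y.1 (leftMap y.1 (dMomentum H y)))) +
        y.2.1 (adjoint E G (leftInv y.1 (leftMap y.1 (dMomentum H y))) (leftInv y.1 w.1)) =
        _ - hamCost H y * (w.2.2 - y.2.1 (leftInv y.1 w.1))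
      rw [leftInv_leftMap]
      simp only [coadjoint, sub_apply, ContinuousLinearMap.comp_apply,
        smul_apply, smul_eq_mul]
      ring
  · rintro ⟨h1, h2⟩
    obtain ⟨a, ν, s⟩ := v
    have key : ∀ w : E × (E →L[ℝ] ℝ) × ℝ,
        -(ν (leftInv y.1 w.1) - w.2.1 (leftInv y.1 a))
          + y.2.1 (adjoint E G (leftInv y.1 a) (leftInv y.1 w.1)) =
        hamBase H y (leftInv y.1 w.1) + w.2.1 (dMomentum H y) + hamCost H y * w.2.2
          - hamCost H y * (w.2.2 - y.2.1 (leftInv y.1 w.1)) := fun w => by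
      rw [← mfderiv_eq_partials H y hH]; exact h2 w
    have ha : leftInv y.1 a = dMomentum H y := by
      have : ∀ ρ : E →L[ℝ] ℝ, ρ (leftInv y.1 a) = ρ (dMomentum H y) := fun ρ => by
        simpa using key (0, ρ, 0)
      by_contra hne
      obtain ⟨f, hf⟩ := SeparatingDual.exists_separating_of_ne (R := ℝ) hne
      exact hf (this f)
    have ha' : a = leftMap y.1 (dMomentum H y) := by rw [← ha, leftMap_leftInv]
    have hν : ν = coadjoint G (dMomentum H y) y.2.1 - hamBase H y - hamCost H y • y.2.1 := by
      ext η
      have := key (leftMap y.1 η, 0, 0)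
      simp only [leftInv_leftMap, ha, zero_apply] at this
      simp only [coadjoint, sub_apply, ContinuousLinearMap.comp_apply,
        smul_apply, smul_eq_mul]
      linarith
    have hs : s = y.2.1 (dMomentum H y) - H y := by
      have : s - y.2.1 (leftInv y.1 a) = - H y := h1
      rw [ha] at this
      linarith
    show (a, ν, s) = (leftMap y.1 (dMomentum H y), coadjoint G (dMomentum H y) y.2.1
      - hamBase H y - hamCost H y • y.2.1, y.2.1 (dMomentum H y) - H y)
    rw [← ha', ← hν, ← hs]

end Hamiltonian

/-! ### The flow of the contact Hamiltonian vector field -/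

section Flow

variable {E G : Type*} [NormedAddCommGroup E] [NormedSpace ℝ E] [FiniteDimensional ℝ E]
  [TopologicalSpace G] [ChartedSpace E G] [Group G] [LieGroup 𝓘(ℝ, E) ∞ G]

/-- `γ` is an integral curve of `X_H` on `[0, t]` starting at `y`. -/
def IsFlowLine (H : PhaseSpace E G → ℝ) (t : ℝ) (y : PhaseSpace E G)
    (γ : ℝ → PhaseSpace E G) : Prop :=
  γ 0 = y ∧ IsMIntegralCurveOn (I := phaseModel E) γ (contactField H) (Icc 0 t)

/-- The (maximal) domain of the time-`t` flow `Φ_H^t`, for `t ≥ 0`. -/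
def flowDomain (H : PhaseSpace E G → ℝ) (t : ℝ) : Set (PhaseSpace E G) :=
  {y | ∃ γ, IsFlowLine H t y γ}

open Classical in
/-- The time-`t` flow map `Φ_H^t`, for `t ≥ 0` (the identity outside of its domain). -/
def flow (H : PhaseSpace E G → ℝ) (t : ℝ) (y : PhaseSpace E G) : PhaseSpace E G :=
  if h : ∃ γ, IsFlowLine H t y γ then h.choose t else y

end Flow

/-! ### The boundary value problem and the exact discrete contact Lagrangian

Boundary data are triples `d = (g₀, g₁, z₀)`. The set `U` of initial states `(g, ξ, z)` singles out
the branch of solutions (on a compact group the boundary value problem has several solutions, for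
instance geodesics with different winding numbers). `U = univ` is the case without selection. -/

section Exact

variable {E G : Type*} [NormedAddCommGroup E] [NormedSpace ℝ E] [FiniteDimensional ℝ E]
  [TopologicalSpace G] [ChartedSpace E G] [Group G] [LieGroup 𝓘(ℝ, E) ∞ G]

/-- `c` solves the Euler-Poincare-Herglotz boundary value problem
`g(0) = g₀`, `z(0) = z₀`, `g(h) = g₁` on `[0, h]`, with initial state in `U`. -/
def IsBVPSolution (L : VelSpace E G → ℝ) (h : ℝ) (U : Set (VelSpace E G)) (d : G × G × ℝ)
    (c : ℝ → VelSpace E G) : Prop :=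
  IsEPHSolution L (Icc 0 h) c ∧ c 0 ∈ U ∧ (c 0).1 = d.1 ∧ (c 0).2.2 = d.2.2 ∧ (c h).1 = d.2.1

/-- The boundary data for which the boundary value problem is solvable. -/
def bvpDomain (L : VelSpace E G → ℝ) (h : ℝ) (U : Set (VelSpace E G)) : Set (G × G × ℝ) :=
  {d | ∃ c, IsBVPSolution L h U d c}

open Classical in
/-- The solution of the boundary value problem (a constant curve where there is none). -/
def bvpSolution (L : VelSpace E G → ℝ) (h : ℝ) (U : Set (VelSpace E G)) (d : G × G × ℝ) :
    ℝ → VelSpace E G :=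
  if hd : ∃ c, IsBVPSolution L h U d c then hd.choose else fun _ => (1, 0, 0)

/-- The boundary value problem is well posed on the open set `U` of initial states: each initial
state in `U` has a solution on `[0, h]`, boundary data determine the solution that starts in `U`,
and these data form an open set, on which the initial velocity is a `C¹` function of them. -/
def IsBVPRegion (L : VelSpace E G → ℝ) (h : ℝ) (U : Set (VelSpace E G)) : Prop :=
  IsOpen U ∧
  (∀ x ∈ U, ∃ c, IsEPHSolution L (Icc 0 h) c ∧ c 0 = x) ∧
  (∀ d c c', IsBVPSolution L h U d c → IsBVPSolution L h U d c' → EqOn c c' (Icc 0 h)) ∧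
  IsOpen (bvpDomain L h U) ∧
  ContMDiffOn ((𝓘(ℝ, E)).prod ((𝓘(ℝ, E)).prod 𝓘(ℝ, ℝ))) 𝓘(ℝ, E) 1
    (fun d => (bvpSolution L h U d 0).2.1) (bvpDomain L h U)

/-- The exact discrete contact Lagrangian
`L_h^e (g₀, g₁, z₀) = ∫₀ʰ L (g(t), ξ(t), z(t)) dt`. -/
def exactLagrangian (L : VelSpace E G → ℝ) (h : ℝ) (U : Set (VelSpace E G)) (d : G × G × ℝ) : ℝ :=
  ∫ t in (0 : ℝ)..h, L (bvpSolution L h U d t)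

end Exact

/-! ### The discrete Herglotz principle -/

section Discrete

variable {E G : Type*} [NormedAddCommGroup E] [NormedSpace ℝ E]

/-- The recursion `z_{k+1} = z_k + L_d (g_k, g_{k+1}, z_k)`. -/
def discreteCost (Ld : G × G × ℝ → ℝ) (g : ℕ → G) (z₀ : ℝ) : ℕ → ℝ
  | 0 => z₀
  | k + 1 => discreteCost Ld g z₀ k + Ld (g k, g (k + 1), discreteCost Ld g z₀ k)

/-- The discrete action sum `S_d = ∑_{k < N} L_d (g_k, g_{k+1}, z_k)`. -/
def discreteAction (Ld : G × G × ℝ → ℝ) (N : ℕ) (z₀ : ℝ) (g : ℕ → G) : ℝ :=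
  ∑ k ∈ Finset.range N, Ld (g k, g (k + 1), discreteCost Ld g z₀ k)

variable (E) in
/-- The discrete Herglotz principle `δS_d = 0`: the derivative of `S_d` vanishes along every smooth
variation `ε ↦ (g_k^ε)` of the sequence `g` with `g_0` and `g_N` fixed. -/
def IsDiscreteHerglotz [TopologicalSpace G] [ChartedSpace E G]
    (Ld : G × G × ℝ → ℝ) (N : ℕ) (z₀ : ℝ) (g : ℕ → G) : Prop :=
  ∀ γ : ℝ → ℕ → G, γ 0 = g → (∀ ε, γ ε 0 = g 0) → (∀ ε, γ ε N = g N) →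
    (∀ k, ContMDiffAt 𝓘(ℝ, ℝ) 𝓘(ℝ, E) ∞ (fun ε => γ ε k) 0) →
    HasDerivAt (fun ε => discreteAction Ld N z₀ (γ ε)) 0 0

variable [FiniteDimensional ℝ E] [TopologicalSpace G] [ChartedSpace E G] [Group G]
  [LieGroup 𝓘(ℝ, E) ∞ G]

/-- The boundary data `(g_k, g_{k+1}, z_k)` of the `k`-th step. -/
def stepData (L : VelSpace E G → ℝ) (h : ℝ) (U : Set (VelSpace E G)) (z₀ : ℝ) (g : ℕ → G)
    (k : ℕ) : G × G × ℝ :=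
  (g k, g (k + 1), discreteCost (exactLagrangian L h U) g z₀ k)

/-- The discrete path `g_0, …, g_N` with initial cost `z₀` is admissible: in each step the boundary
value problem is solvable, so that `L_h^e` is defined there. -/
def IsAdmissible (L : VelSpace E G → ℝ) (h : ℝ) (U : Set (VelSpace E G)) (N : ℕ) (z₀ : ℝ)
    (g : ℕ → G) : Prop :=
  ∀ k < N, stepData L h U z₀ g k ∈ bvpDomain L h U

/-- The discrete evolution in `TG × ℝ`: the states `(g_k, ξ_k, z_k)`, `0 ≤ k ≤ N`. For `k < N` it
is the initial state of the solution that joins `g_k` to `g_{k+1}`; for `k = N` it is the final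
state of the last one. -/
def discreteState (L : VelSpace E G → ℝ) (h : ℝ) (U : Set (VelSpace E G)) (N : ℕ) (z₀ : ℝ)
    (g : ℕ → G) (k : ℕ) : VelSpace E G :=
  if k < N then bvpSolution L h U (stepData L h U z₀ g k) 0
  else bvpSolution L h U (stepData L h U z₀ g (N - 1)) h

end Discrete

end ContactLie

end

/-!
The proof works on the Hamiltonian side. By hyperregularity, `𝔽L` turns the solutions of the
Euler-Poincare-Herglotz equations into the integral curves of `X_H` (`isEPHSolution_iff`): at
`𝔽L (g, ξ, z)` the partial derivatives of `H` are `ξ`, `-δL/δg` and `-∂L/∂z`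
(`partials_hamiltonian`). So it suffices to understand the flow of the smooth field `X_H`.

*The flow and the contact form.* In a chart of `G`, `X_H` is a smooth field on an open subset of
the vector space `E × 𝔤* × ℝ`, and for short times its flow is `C¹` in the initial point, its
derivative solving the variational equation (`exists_isLocalFlow`). Along a solution `w` of the
variational equation, `q = θ w` satisfies `q' = -(∂H/∂z) q` (`hasDerivAt_localForm`, the formula
`ℒ_X θ = -(∂H/∂z) θ` in coordinates; it rests on the Maurer-Cartan equation
`fderiv_chartInv_sub`), hence `(Φ_H^t)^* θ = exp (-∫ ∂H/∂z) θ` for short times, uniformly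
along the compact image of an integral curve. The semigroup property of the flow then gives the
openness of the domain, the differentiability and the formula for all times
(`isConformalAt_of_mem`). The expansion for `h → 0` follows by estimating
the exponential (`exists_conformal_factor_expansion`).

*The discrete Herglotz principle.* The exact discrete Lagrangian is the increment of `z` along the
solution with the given boundary data. Evaluating the conformal identity on the velocity of a
variation `(v₀, v₁, ζ)` of the boundary data gives
`ζ' - ⟨μ⁻, g₁⁻¹ v₁⟩ = σ (ζ - ⟨μ⁺, g₀⁻¹ v₀⟩)` with `σ > 0` for the variation `ζ'` of the final cost
(`IsBVPRegion.exists_hasDerivAt_cost`). Iterating this along a discrete path, and varying one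
point at a time, `δS_d = 0` means that the final momentum of each step is the initial momentum of
the next one (`IsAdmissible.isDiscreteHerglotz_iff`), which is to say that the states form an orbit
of `Φ_H^h` (`IsAdmissible.flow_iff`).

*Regular regions.* For small `h` the map `ξ ↦ g(h)` is, in a chart, `C¹`-close to `h A ξ + const`
with `A` the invertible derivative of left translation, uniformly over bounded `(ξ, z)`
(`eventually_hasEndEstimate`). Hence it is injective on balls, by the mean value inequality, and
the inverse function theorem makes the boundary value problem well posed over a neighbourhood of a
compact set (`exists_isBVPRegion`).
-/

noncomputable section

namespace ContactLie

/-! ### Local flows and their derivative in the initial point -/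

section LocalFlow

open Metric

variable {F : Type*} [NormedAddCommGroup F] [NormedSpace ℝ F]

/-- `Φ` is a flow of the vector field `f` for the times `|t| ≤ ε` and the initial points in `B`,
which stays in `Ω`; `D u` solves the variational equation of `f` along `Φ u`, and `D u t` is the
derivative of `u ↦ Φ u t`. The latter is recorded for `t ≥ 0` only, as forward flows suffice. -/
structure IsLocalFlow (f : F → F) (B Ω : Set F) (ε : ℝ) (Φ : F → ℝ → F)
    (D : F → ℝ → F →L[ℝ] F) : Prop where
  apply_zero : ∀ u ∈ B, Φ u 0 = u
  deriv_zero : ∀ u ∈ B, D u 0 = ContinuousLinearMap.id ℝ F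
  mem : ∀ u ∈ B, ∀ t ∈ Icc (-ε) ε, Φ u t ∈ Ω
  hasDerivAt : ∀ u ∈ B, ∀ t ∈ Icc (-ε) ε, HasDerivAt (Φ u) (f (Φ u t)) t
  hasDerivAt_deriv : ∀ u ∈ B, ∀ t ∈ Icc (-ε) ε,
    HasDerivAt (D u) ((fderiv ℝ f (Φ u t)).comp (D u t)) t
  continuousOn : ContinuousOn (fun p : F × ℝ => Φ p.1 p.2) (B ×ˢ Icc (-ε) ε)
  continuousOn_deriv : ContinuousOn (fun p : F × ℝ => D p.1 p.2) (B ×ˢ Icc (-ε) ε)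
  hasFDerivAt : ∀ u ∈ B, ∀ t ∈ Icc 0 ε, HasFDerivAt (fun v => Φ v t) (D u t) u

/-- Taylor's inequality on a convex set on which the derivative is Lipschitz. -/
theorem norm_sub_sub_le_of_lipschitzOnWith_fderiv {f : F → F} {s : Set F} (hs : Convex ℝ s)
    (hd : ∀ x ∈ s, DifferentiableAt ℝ f x) {M : NNReal} (hM : LipschitzOnWith M (fderiv ℝ f) s)
    {a b : F} (ha : a ∈ s) (hb : b ∈ s) :
    ‖f b - f a - fderiv ℝ f a (b - a)‖ ≤ M * ‖b - a‖ ^ 2 := by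
  have h := Convex.norm_image_sub_le_of_norm_hasFDerivWithin_le' (f := f) (f' := fderiv ℝ f)
    (s := segment ℝ a b) (φ := fderiv ℝ f a) (C := M * ‖b - a‖) (x := a) (y := b)
    (fun x hx => (hd x (hs.segment_subset ha hb hx)).hasFDerivAt.hasFDerivWithinAt)
    (fun x hx => by
      have h1 := hM.norm_sub_le (hs.segment_subset ha hb hx) ha
      refine h1.trans ?_
      have : ‖x - a‖ ≤ ‖b - a‖ := by
        obtain ⟨θ, hθ, rfl⟩ := (segment_eq_image_lineMap ℝ a b) ▸ hx
        rw [← dist_eq_norm, dist_lineMap_left, dist_eq_norm, norm_sub_rev a b,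
          Real.norm_of_nonneg hθ.1]
        exact mul_le_of_le_one_left (norm_nonneg _) hθ.2
      gcongr)
    (convex_segment a b) (left_mem_segment ℝ a b) (right_mem_segment ℝ a b)
  calc _ ≤ _ := h
    _ = _ := by ring

/-- If two solutions of `u' = f u` in a convex set start at distance `d`, then their difference is
the solution of the variational equation along the first one up to an error of order `d ^ 2`. -/
theorem norm_sub_sub_le_of_variational {f : F → F} {s : Set F} (hs : Convex ℝ s)
    (hd : ∀ x ∈ s, DifferentiableAt ℝ f x) {K M : NNReal} (hK : LipschitzOnWith K f s)
    (hM : LipschitzOnWith M (fderiv ℝ f) s) (hso : IsOpen s) {ε : ℝ} {a b : ℝ → F}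
    {D : ℝ → F →L[ℝ] F} (has : ∀ t ∈ Icc 0 ε, a t ∈ s) (hbs : ∀ t ∈ Icc 0 ε, b t ∈ s)
    (ha : ∀ t ∈ Icc 0 ε, HasDerivAt a (f (a t)) t) (hb : ∀ t ∈ Icc 0 ε, HasDerivAt b (f (b t)) t)
    (hD : ∀ t ∈ Icc 0 ε, HasDerivAt D ((fderiv ℝ f (a t)).comp (D t)) t)
    (hD0 : D 0 = ContinuousLinearMap.id ℝ F) {t : ℝ} (ht : t ∈ Icc 0 ε) :
    ‖b t - a t - D t (b 0 - a 0)‖ ≤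
      M * Real.exp (K * ε) ^ 2 * Real.exp ((K + 1) * ε) * ‖b 0 - a 0‖ ^ 2 := by
  have hdist : ∀ τ ∈ Icc 0 ε, ‖b τ - a τ‖ ≤ ‖b 0 - a 0‖ * Real.exp (K * ε) := fun τ hτ => by
    have := dist_le_of_trajectories_ODE_of_mem (v := fun _ => f) (s := fun _ => s) (K := K)
      (f := b) (g := a) (a := 0) (b := ε) (δ := dist (b 0) (a 0)) (fun _ _ => hK)
      (fun τ hτ => (hb τ hτ).continuousAt.continuousWithinAt)
      (fun τ hτ => (hb τ (Ico_subset_Icc_self hτ)).hasDerivWithinAt)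
      (fun τ hτ => hbs τ (Ico_subset_Icc_self hτ))
      (fun τ hτ => (ha τ hτ).continuousAt.continuousWithinAt)
      (fun τ hτ => (ha τ (Ico_subset_Icc_self hτ)).hasDerivWithinAt)
      (fun τ hτ => has τ (Ico_subset_Icc_self hτ)) le_rfl τ hτ
    rw [dist_eq_norm, dist_eq_norm] at this
    refine this.trans ?_
    gcongr
    rw [sub_zero]; exact hτ.2
  have hfd : ∀ τ ∈ Icc 0 ε, ‖fderiv ℝ f (a τ)‖ ≤ K := fun τ hτ =>
    norm_fderiv_le_of_lipschitzOn ℝ (hso.mem_nhds (has τ hτ)) hK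
  set w := b 0 - a 0 with hw
  have hder : ∀ τ ∈ Icc 0 ε, HasDerivAt (fun τ => b τ - a τ - D τ w)
      (f (b τ) - f (a τ) - (fderiv ℝ f (a τ)).comp (D τ) w) τ := fun τ hτ =>
    ((hb τ hτ).sub (ha τ hτ)).sub
      (((ContinuousLinearMap.apply ℝ F w).hasFDerivAt).comp_hasDerivAt τ (hD τ hτ))
  have hε : 0 ≤ ε := ht.1.trans ht.2
  have hg := norm_le_gronwallBound_of_norm_deriv_right_le (δ := 0) (K := K + 1)
    (ε := M * (‖w‖ * Real.exp (K * ε)) ^ 2) (a := 0) (b := ε)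
    (fun τ hτ => (hder τ hτ).continuousAt.continuousWithinAt)
    (fun τ hτ => (hder τ (Ico_subset_Icc_self hτ)).hasDerivWithinAt)
    (by simp [hD0, hw]) (fun τ hτ => by
      have hτ' := Ico_subset_Icc_self hτ
      have e : f (b τ) - f (a τ) - (fderiv ℝ f (a τ)).comp (D τ) w =
          (f (b τ) - f (a τ) - fderiv ℝ f (a τ) (b τ - a τ)) +
            fderiv ℝ f (a τ) (b τ - a τ - D τ w) := by
        rw [map_sub _ (b τ - a τ) (D τ w), ContinuousLinearMap.comp_apply]; abel
      have h1 := norm_sub_sub_le_of_lipschitzOnWith_fderiv hs hd hM (has τ hτ') (hbs τ hτ')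
      have h2 := ((fderiv ℝ f (a τ)).le_of_opNorm_le (hfd τ hτ') (b τ - a τ - D τ w))
      have h3 := hdist τ hτ'
      rw [e]
      calc _ ≤ _ := norm_add_le _ _
        _ ≤ M * (‖w‖ * Real.exp (K * ε)) ^ 2 + K * ‖b τ - a τ - D τ w‖ := by
          refine add_le_add (h1.trans ?_) h2
          gcongr
        _ ≤ _ := by nlinarith [norm_nonneg (b τ - a τ - D τ w)]) t ht
  refine hg.trans ?_
  have hK1 : (K : ℝ) + 1 ≠ 0 := by positivity
  rw [gronwallBound_of_K_ne_0 hK1, sub_zero]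
  have hexp : Real.exp ((K + 1) * t) ≤ Real.exp ((K + 1) * ε) := by
    gcongr; exact ht.2
  have hdiv : (M * (‖w‖ * Real.exp (K * ε)) ^ 2) / ((K : ℝ) + 1) ≤
      M * (‖w‖ * Real.exp (K * ε)) ^ 2 :=
    div_le_self (by positivity) (by simp)
  have h1 : 1 ≤ Real.exp ((K + 1) * t) := Real.one_le_exp (by have := ht.1; positivity)
  calc _ ≤ (M * (‖w‖ * Real.exp (K * ε)) ^ 2) * Real.exp ((K + 1) * ε) := by
        simp only [zero_mul, zero_add]
        gcongr
        linarith
    _ = _ := by ring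

/-- A `C²` vector field has a local flow, which is differentiable in the initial point. The flow
and its derivative are obtained together, from the vector field `(u, D) ↦ (f u, f' u ∘ D)`. -/
theorem exists_isLocalFlow [CompleteSpace F] {f : F → F} {u₀ : F} {Ω : Set F}
    (hf : ContDiffAt ℝ 2 f u₀) (hΩ : Ω ∈ 𝓝 u₀) :
    ∃ r > 0, ∃ ε > 0, ∃ Φ D, IsLocalFlow f (ball u₀ r) Ω ε Φ D := by
  have hf' : ContDiffAt ℝ 1 (fderiv ℝ f) u₀ := hf.fderiv_right (m := 1) (by norm_num)
  obtain ⟨K, s₁, hs₁, hK⟩ := (hf.of_le (by norm_num : (1 : WithTop ℕ∞) ≤ 2)).exists_lipschitzOnWith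
  obtain ⟨M, s₂, hs₂, hM⟩ := hf'.exists_lipschitzOnWith
  have hdiff : ∀ᶠ x in 𝓝 u₀, DifferentiableAt ℝ f x :=
    (hf.eventually (by simp)).mono fun x hx => hx.differentiableAt (by norm_num)
  obtain ⟨ρ, hρ, hball⟩ := Metric.mem_nhds_iff.1
    (Filter.inter_mem (Filter.inter_mem hs₁ hs₂) (Filter.inter_mem hdiff hΩ))
  let g : F × (F →L[ℝ] F) → F × (F →L[ℝ] F) := fun p => (f p.1, (fderiv ℝ f p.1).comp p.2)
  let p₀ : F × (F →L[ℝ] F) := (u₀, ContinuousLinearMap.id ℝ F)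
  have hg : ContDiffAt ℝ 1 g p₀ := by
    have h1 : ContDiffAt ℝ 1 (fun p : F × (F →L[ℝ] F) => f p.1) p₀ :=
      ContDiffAt.comp (g := f) p₀ (hf.of_le (by norm_num)) contDiffAt_fst
    have h2 : ContDiffAt ℝ 1 (fun p : F × (F →L[ℝ] F) => fderiv ℝ f p.1) p₀ :=
      ContDiffAt.comp (g := fderiv ℝ f) p₀ hf' contDiffAt_fst
    exact h1.prodMk (h2.clm_comp contDiffAt_snd)
  obtain ⟨ε₁, hε₁, a, r₁, L, K', hr₁, hpl⟩ := IsPicardLindelof.of_contDiffAt_one hg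
  obtain ⟨α, hα, hαc⟩ := (hpl 0).exists_forall_mem_closedBall_eq_hasDerivWithinAt_continuousOn
  simp only [zero_sub, zero_add] at hα hαc
  have hmem : ∀ u, u ∈ ball u₀ (r₁ : ℝ) → (u, ContinuousLinearMap.id ℝ F) ∈ closedBall p₀ r₁ :=
    fun u hu => by
      rw [mem_closedBall, Prod.dist_eq]
      simpa [p₀] using (mem_ball.1 hu).le
  have hcont : ContinuousAt (fun q : F × ℝ => (α ((q.1, ContinuousLinearMap.id ℝ F), q.2)).1)
      (u₀, 0) := by
    have : ContinuousOn (fun q : F × ℝ => (α ((q.1, ContinuousLinearMap.id ℝ F), q.2)).1)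
        (ball u₀ r₁ ×ˢ Icc (-ε₁) ε₁) := by
      refine (continuous_fst.comp_continuousOn hαc).comp (by fun_prop) ?_
      rintro ⟨u, t⟩ ⟨hu, ht⟩
      exact ⟨hmem u hu, ht⟩
    exact this.continuousAt (prod_mem_nhds (ball_mem_nhds _ hr₁) (Icc_mem_nhds (by simpa) hε₁))
  have h0 : (α ((u₀, ContinuousLinearMap.id ℝ F), 0)).1 = u₀ := by
    rw [(hα _ (hmem u₀ (mem_ball_self hr₁))).1]
  have hev := hcont.preimage_mem_nhds (t := ball u₀ ρ) (by
    show _ ∈ 𝓝 ((α ((u₀, ContinuousLinearMap.id ℝ F), 0)).1)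
    rw [h0]; exact ball_mem_nhds _ hρ)
  obtain ⟨δ, hδ, hδs⟩ := Metric.mem_nhds_iff.1 hev
  have hr : 0 < min (r₁ : ℝ) δ := lt_min hr₁ hδ
  have hε : 0 < min (ε₁ / 2) (δ / 2) := lt_min (by linarith) (by linarith)
  set r := min (r₁ : ℝ) δ
  set ε := min (ε₁ / 2) (δ / 2)
  have hεε : ∀ t ∈ Icc (-ε) ε, t ∈ Ioo (-ε₁) ε₁ := fun t ht => by
    have := min_le_left (ε₁ / 2) (δ / 2)
    exact ⟨by linarith [ht.1], by linarith [ht.2]⟩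
  let Φ : F → ℝ → F := fun u t => (α ((u, ContinuousLinearMap.id ℝ F), t)).1
  let D : F → ℝ → F →L[ℝ] F := fun u t => (α ((u, ContinuousLinearMap.id ℝ F), t)).2
  have hr₁' : ∀ u ∈ ball u₀ r, u ∈ ball u₀ (r₁ : ℝ) := fun u hu =>
    ball_subset_ball (min_le_left _ _) hu
  have hin : ∀ u ∈ ball u₀ r, ∀ t ∈ Icc (-ε) ε, Φ u t ∈ ball u₀ ρ := fun u hu t ht => by
    apply hδs (a := (u, t))
    rw [mem_ball, Prod.dist_eq]
    refine max_lt (lt_of_lt_of_le hu (min_le_right _ _)) ?_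
    rw [Real.dist_eq, sub_zero]
    have : ε ≤ δ / 2 := min_le_right _ _
    exact (abs_le.2 ht).trans_lt (by linarith)
  have hder : ∀ u ∈ ball u₀ r, ∀ t ∈ Icc (-ε) ε,
      HasDerivAt (fun t => α ((u, ContinuousLinearMap.id ℝ F), t))
        (g (α ((u, ContinuousLinearMap.id ℝ F), t))) t := fun u hu t ht =>
    ((hα _ (hmem u (hr₁' u hu))).2 t (Ioo_subset_Icc_self (hεε t ht))).hasDerivAt
      (Icc_mem_nhds (hεε t ht).1 (hεε t ht).2)
  have hΦ : ∀ u ∈ ball u₀ r, ∀ t ∈ Icc (-ε) ε, HasDerivAt (Φ u) (f (Φ u t)) t :=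
    fun u hu t ht => (ContinuousLinearMap.fst ℝ F (F →L[ℝ] F)).hasFDerivAt.comp_hasDerivAt t
      (hder u hu t ht)
  have hD : ∀ u ∈ ball u₀ r, ∀ t ∈ Icc (-ε) ε,
      HasDerivAt (D u) ((fderiv ℝ f (Φ u t)).comp (D u t)) t :=
    fun u hu t ht => (ContinuousLinearMap.snd ℝ F (F →L[ℝ] F)).hasFDerivAt.comp_hasDerivAt t
      (hder u hu t ht)
  have hΦ0 : ∀ u ∈ ball u₀ r, Φ u 0 = u := fun u hu => by
    show (α _).1 = _
    rw [(hα _ (hmem u (hr₁' u hu))).1]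
  have hD0 : ∀ u ∈ ball u₀ r, D u 0 = ContinuousLinearMap.id ℝ F := fun u hu => by
    show (α _).2 = _
    rw [(hα _ (hmem u (hr₁' u hu))).1]
  have hcts : ContinuousOn (fun q : F × ℝ => α ((q.1, ContinuousLinearMap.id ℝ F), q.2))
      (ball u₀ r ×ˢ Icc (-ε) ε) := by
    refine hαc.comp (by fun_prop) ?_
    rintro ⟨u, t⟩ ⟨hu, ht⟩
    exact ⟨hmem u (hr₁' u hu), Ioo_subset_Icc_self (hεε t ht)⟩
  refine ⟨r, hr, ε, hε, Φ, D, hΦ0, hD0, fun u hu t ht => (hball (hin u hu t ht)).2.2, hΦ, hD,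
    continuous_fst.comp_continuousOn hcts, continuous_snd.comp_continuousOn hcts, ?_⟩
  intro u hu t ht
  have hsub : ∀ τ ∈ Icc 0 ε, τ ∈ Icc (-ε) ε := fun τ hτ => ⟨by linarith [hτ.1], hτ.2⟩
  rw [hasFDerivAt_iff_isLittleO_nhds_zero]
  set C := M * Real.exp (K * ε) ^ 2 * Real.exp ((K + 1) * ε)
  have hO : (fun v => Φ (u + v) t - Φ u t - D u t v) =O[𝓝 0] fun v => ‖v‖ ^ 2 := by
    refine Asymptotics.IsBigO.of_bound C ?_
    have : ∀ᶠ v in 𝓝 (0 : F), u + v ∈ ball u₀ r := by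
      have hc : ContinuousAt (fun v => u + v) (0 : F) := by fun_prop
      exact hc.eventually_mem (by simpa using isOpen_ball.mem_nhds hu)
    filter_upwards [this] with v hv
    have := norm_sub_sub_le_of_variational (f := f) (convex_ball u₀ ρ)
      (fun x hx => (hball hx).2.1) (hK.mono fun x hx => (hball hx).1.1)
      (hM.mono fun x hx => (hball hx).1.2) isOpen_ball (a := Φ u) (b := Φ (u + v)) (D := D u)
      (fun τ hτ => hin u hu τ (hsub τ hτ)) (fun τ hτ => hin _ hv τ (hsub τ hτ))
      (fun τ hτ => hΦ u hu τ (hsub τ hτ)) (fun τ hτ => hΦ _ hv τ (hsub τ hτ))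
      (fun τ hτ => hD u hu τ (hsub τ hτ)) (hD0 u hu) ht
    rw [hΦ0 _ hv, hΦ0 _ hu, add_sub_cancel_left] at this
    simpa using this
  refine hO.trans_isLittleO ?_
  simpa using (Asymptotics.isLittleO_norm_pow_id (E' := F) one_lt_two)

/-- The first order expansion in time of the derivative of a local flow in the initial point,
uniformly in that point. -/
theorem IsLocalFlow.norm_deriv_sub_le {f : F → F} {Ω : Set F} {u₀ : F} {r ε : ℝ} {Φ : F → ℝ → F}
    {D : F → ℝ → F →L[ℝ] F} (h : IsLocalFlow f (ball u₀ r) Ω ε Φ D) (hr : 0 < r) (hε : 0 < ε)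
    (hf : ContinuousAt (fderiv ℝ f) u₀) {η : ℝ} (hη : 0 < η) :
    ∃ δ > 0, ∀ u ∈ ball u₀ δ, ∀ t ∈ Icc 0 δ,
      ‖D u t - ContinuousLinearMap.id ℝ F - t • fderiv ℝ f u‖ ≤ η * t := by
  have hnhds : ball u₀ r ×ˢ Icc (-ε) ε ∈ 𝓝 (u₀, (0 : ℝ)) :=
    prod_mem_nhds (ball_mem_nhds _ hr) (Icc_mem_nhds (by simpa) hε)
  have h1 := h.continuousOn.continuousAt hnhds
  have h2 := h.continuousOn_deriv.continuousAt hnhds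
  have h0 : Φ u₀ 0 = u₀ := h.apply_zero _ (mem_ball_self hr)
  have h3 : ContinuousAt (fun p : F × ℝ => (fderiv ℝ f (Φ p.1 p.2)).comp (D p.1 p.2)
      - fderiv ℝ f p.1) (u₀, 0) := by
    refine ContinuousAt.sub (ContinuousAt.clm_comp ?_ h2) ?_
    · exact ContinuousAt.comp (g := fderiv ℝ f) (by rw [h0]; exact hf) h1
    · exact ContinuousAt.comp (g := fderiv ℝ f) (f := Prod.fst) (x := (u₀, (0 : ℝ))) hf
        continuousAt_fst
  have h4 : (fderiv ℝ f (Φ u₀ 0)).comp (D u₀ 0) - fderiv ℝ f u₀ = 0 := by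
    rw [h0, h.deriv_zero _ (mem_ball_self hr), ContinuousLinearMap.comp_id, sub_self]
  have h5 := h3.preimage_mem_nhds (t := ball 0 η) (by
    show _ ∈ 𝓝 ((fderiv ℝ f (Φ u₀ 0)).comp (D u₀ 0) - fderiv ℝ f u₀)
    rw [h4]; exact ball_mem_nhds _ hη)
  obtain ⟨δ, hδ, hδs⟩ := Metric.mem_nhds_iff.1 (Filter.inter_mem h5 hnhds)
  refine ⟨δ / 2, by linarith, fun u hu t ht => ?_⟩
  have hq : ∀ τ ∈ Icc 0 t, (u, τ) ∈ ball (u₀, (0 : ℝ)) δ := fun τ hτ => by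
    rw [mem_ball, Prod.dist_eq]
    refine max_lt (lt_of_lt_of_le hu (by linarith)) ?_
    rw [Real.dist_eq, sub_zero, abs_of_nonneg hτ.1]
    linarith [hτ.2, ht.2]
  have hu' : u ∈ ball u₀ r := (hδs (hq 0 ⟨le_rfl, ht.1⟩)).2.1
  have h6 := (convex_Icc 0 t).norm_image_sub_le_of_norm_hasDerivWithin_le
    (f := fun τ => D u τ - τ • fderiv ℝ f u)
    (f' := fun τ => (fderiv ℝ f (Φ u τ)).comp (D u τ) - fderiv ℝ f u) (C := η) (x := 0) (y := t)
    (fun τ hτ => by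
      have h7 := (h.hasDerivAt_deriv u hu' τ (hδs (hq τ hτ)).2.2).sub
        ((hasDerivAt_id τ).smul_const (fderiv ℝ f u))
      rw [one_smul] at h7
      exact h7.hasDerivWithinAt)
    (fun τ hτ => by
      have := (hδs (hq τ hτ)).1
      rw [mem_preimage, mem_ball_zero_iff] at this
      exact this.le)
    ⟨le_rfl, ht.1⟩ ⟨ht.1, le_rfl⟩
  rw [h.deriv_zero _ hu', zero_smul, sub_zero, sub_zero, Real.norm_of_nonneg ht.1] at h6
  rwa [sub_right_comm]

end LocalFlow

/-! ### Left translation and the Maurer-Cartan form in a chart -/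

section Chart

variable {E G : Type*} [NormedAddCommGroup E] [NormedSpace ℝ E] [FiniteDimensional ℝ E]
  [TopologicalSpace G] [ChartedSpace E G] [Group G]

/-- The derivative `T_g G → E` of the chart centred at `c`. -/
def chartDeriv (c g : G) : E →L[ℝ] E := mfderiv 𝓘(ℝ, E) 𝓘(ℝ, E) (extChartAt 𝓘(ℝ, E) c) g

/-- The derivative `E → T_g G` of the inverse of the chart centred at `c`. -/
def chartSymmDeriv (c : G) (x : E) : E →L[ℝ] E :=
  mfderiv 𝓘(ℝ, E) 𝓘(ℝ, E) (extChartAt 𝓘(ℝ, E) c).symm x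

/-- Left translation `𝔤 → T_g G` in the chart centred at `c`. -/
def chartLeft (c : G) (x : E) : E →L[ℝ] E :=
  (chartDeriv c ((extChartAt 𝓘(ℝ, E) c).symm x)).comp (leftMap ((extChartAt 𝓘(ℝ, E) c).symm x))

/-- The Maurer-Cartan form in the chart centred at `c`. -/
def chartInv (c : G) (x : E) : E →L[ℝ] E :=
  (leftInv ((extChartAt 𝓘(ℝ, E) c).symm x)).comp (chartSymmDeriv c x)

variable [LieGroup 𝓘(ℝ, E) ∞ G]

theorem extChartAt_target_mem_nhds' {c : G} {x : E} (hx : x ∈ (extChartAt 𝓘(ℝ, E) c).target) :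
    (extChartAt 𝓘(ℝ, E) c).target ∈ 𝓝 x :=
  (isOpen_extChartAt_target c).mem_nhds hx

theorem contMDiffAt_extChartAt_symm {c : G} {x : E} (hx : x ∈ (extChartAt 𝓘(ℝ, E) c).target) :
    ContMDiffAt 𝓘(ℝ, E) 𝓘(ℝ, E) ∞ (extChartAt 𝓘(ℝ, E) c).symm x :=
  (contMDiffOn_extChartAt_symm c).contMDiffAt (extChartAt_target_mem_nhds' hx)

theorem contMDiffAt_chart {c g : G} (hg : g ∈ (extChartAt 𝓘(ℝ, E) c).source) :
    ContMDiffAt 𝓘(ℝ, E) 𝓘(ℝ, E) ∞ (extChartAt 𝓘(ℝ, E) c) g :=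
  contMDiffAt_extChartAt' (by simpa using hg)

theorem hasMFDerivAt_chart {c g : G} (hg : g ∈ (extChartAt 𝓘(ℝ, E) c).source) :
    HasMFDerivAt 𝓘(ℝ, E) 𝓘(ℝ, E) (extChartAt 𝓘(ℝ, E) c) g (chartDeriv (E := E) c g) :=
  ((contMDiffAt_chart hg).mdifferentiableAt (by simp)).hasMFDerivAt

theorem hasMFDerivAt_chart_symm {c : G} {x : E} (hx : x ∈ (extChartAt 𝓘(ℝ, E) c).target) :
    HasMFDerivAt 𝓘(ℝ, E) 𝓘(ℝ, E) (extChartAt 𝓘(ℝ, E) c).symm x (chartSymmDeriv (E := E) c x) :=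
  ((contMDiffAt_extChartAt_symm hx).mdifferentiableAt (by simp)).hasMFDerivAt

theorem chartDeriv_chartSymmDeriv {c : G} {x : E} (hx : x ∈ (extChartAt 𝓘(ℝ, E) c).target)
    (v : E) : chartDeriv c ((extChartAt 𝓘(ℝ, E) c).symm x) (chartSymmDeriv c x v) = v := by
  have h := (hasMFDerivAt_chart ((extChartAt 𝓘(ℝ, E) c).map_target hx)).comp x
    (hasMFDerivAt_chart_symm hx)
  have h2 : HasMFDerivAt 𝓘(ℝ, E) 𝓘(ℝ, E)
      (extChartAt 𝓘(ℝ, E) c ∘ (extChartAt 𝓘(ℝ, E) c).symm) x (ContinuousLinearMap.id ℝ E) :=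
    (hasMFDerivAt_id x).congr_of_eventuallyEq (by
      filter_upwards [extChartAt_target_mem_nhds' hx] with y hy
      exact (extChartAt 𝓘(ℝ, E) c).right_inv hy)
  exact congrArg (fun T : E →L[ℝ] E => T v) (hasMFDerivAt_unique h h2)

theorem chartSymmDeriv_chartDeriv {c g : G} (hg : g ∈ (extChartAt 𝓘(ℝ, E) c).source)
    (v : E) : chartSymmDeriv c (extChartAt 𝓘(ℝ, E) c g) (chartDeriv c g v) = v := by
  have h := (hasMFDerivAt_chart_symm ((extChartAt 𝓘(ℝ, E) c).map_source hg)).comp g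
    (hasMFDerivAt_chart hg)
  have h2 : HasMFDerivAt 𝓘(ℝ, E) 𝓘(ℝ, E)
      ((extChartAt 𝓘(ℝ, E) c).symm ∘ extChartAt 𝓘(ℝ, E) c) g (ContinuousLinearMap.id ℝ E) :=
    (hasMFDerivAt_id g).congr_of_eventuallyEq (by
      filter_upwards [(isOpen_extChartAt_source c).mem_nhds hg] with y hy
      exact (extChartAt 𝓘(ℝ, E) c).left_inv hy)
  exact congrArg (fun T : E →L[ℝ] E => T v) (hasMFDerivAt_unique h h2)

theorem chartSymmDeriv_chartDeriv' {c : G} {x : E} (hx : x ∈ (extChartAt 𝓘(ℝ, E) c).target)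
    (v : E) : chartSymmDeriv c x (chartDeriv c ((extChartAt 𝓘(ℝ, E) c).symm x) v) = v := by
  have := chartSymmDeriv_chartDeriv ((extChartAt 𝓘(ℝ, E) c).map_target hx) v
  rwa [(extChartAt 𝓘(ℝ, E) c).right_inv hx] at this

theorem chartInv_chartLeft {c : G} {x : E} (hx : x ∈ (extChartAt 𝓘(ℝ, E) c).target) (ξ : E) :
    chartInv c x (chartLeft c x ξ) = ξ := by
  simp only [chartInv, chartLeft, ContinuousLinearMap.comp_apply]
  rw [chartSymmDeriv_chartDeriv' hx, leftInv_leftMap]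

theorem chartLeft_chartInv {c : G} {x : E} (hx : x ∈ (extChartAt 𝓘(ℝ, E) c).target) (v : E) :
    chartLeft c x (chartInv c x v) = v := by
  simp only [chartInv, chartLeft, ContinuousLinearMap.comp_apply]
  rw [leftMap_leftInv, chartDeriv_chartSymmDeriv hx]

theorem hasMFDerivAt_comp_of_eq {f : E → G} {M' : Type*} [TopologicalSpace M'] [ChartedSpace E M']
    {k : G → M'} {x : E} {y : G} {f' k' : E →L[ℝ] E} (hk : HasMFDerivAt 𝓘(ℝ, E) 𝓘(ℝ, E) k y k')
    (hf : HasMFDerivAt 𝓘(ℝ, E) 𝓘(ℝ, E) f x f') (hy : f x = y) :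
    HasMFDerivAt 𝓘(ℝ, E) 𝓘(ℝ, E) (fun a => k (f a)) x (k'.comp f') := by
  subst hy
  exact hk.comp x hf

theorem mdifferentiableAt_mul_left (b a : G) :
    MDifferentiableAt 𝓘(ℝ, E) 𝓘(ℝ, E) (fun a : G => b * a) a :=
  (contMDiff_mul_left (I := 𝓘(ℝ, E)) (n := ∞)).mdifferentiableAt (by simp)

/-- `chartLeft` is a partial derivative of the multiplication of `G` in charts. -/
theorem contDiffAt_chartLeft {c : G} {x : E} (hx : x ∈ (extChartAt 𝓘(ℝ, E) c).target) :
    ContDiffAt ℝ ∞ (chartLeft (E := E) c) x := by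
  set φ := extChartAt 𝓘(ℝ, E) c
  set φ₁ := extChartAt 𝓘(ℝ, E) (1 : G)
  have h1 : φ₁ 1 ∈ φ₁.target := mem_extChartAt_target 1
  have h11 : φ₁.symm (φ₁ 1) = 1 := φ₁.left_inv (mem_extChartAt_source 1)
  have hsrc : φ.symm x * φ₁.symm (φ₁ 1) ∈ φ.source := by
    rw [h11, mul_one]; exact φ.map_target hx
  -- the multiplication of `G` in the charts at `c` and at `1`
  let m : E × E → E := fun p => φ (φ.symm p.1 * φ₁.symm p.2)
  have hm : ContDiffAt ℝ ∞ m (x, φ₁ 1) := by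
    rw [← contMDiffAt_iff_contDiffAt]
    have ha : ContMDiffAt 𝓘(ℝ, E × E) 𝓘(ℝ, E) ∞ (fun p : E × E => φ.symm p.1) (x, φ₁ 1) :=
      ContMDiffAt.comp (g := φ.symm) (f := Prod.fst) (x, φ₁ 1) (contMDiffAt_extChartAt_symm hx)
        contDiff_fst.contMDiff.contMDiffAt
    have hb : ContMDiffAt 𝓘(ℝ, E × E) 𝓘(ℝ, E) ∞ (fun p : E × E => φ₁.symm p.2) (x, φ₁ 1) :=
      ContMDiffAt.comp (g := φ₁.symm) (f := Prod.snd) (x, φ₁ 1) (contMDiffAt_extChartAt_symm h1)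
        contDiff_snd.contMDiff.contMDiffAt
    exact ContMDiffAt.comp (g := φ) (f := fun p : E × E => φ.symm p.1 * φ₁.symm p.2) (x, φ₁ 1)
      (contMDiffAt_chart hsrc) (ha.mul hb)
  have hfd : ContDiffAt ℝ ∞ (fun y => fderiv ℝ (fun a => m (y, a)) (φ₁ 1)) x :=
    ContDiffAt.fderiv (f := fun y a => m (y, a)) (g := fun _ => φ₁ 1) (n := ∞) hm contDiffAt_const
      (by simp)
  have hc : ContDiffAt ℝ ∞
      (fun y => (fderiv ℝ (fun a => m (y, a)) (φ₁ 1)).comp (chartDeriv (1 : G) 1)) x :=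
    hfd.clm_comp contDiffAt_const
  refine hc.congr_of_eventuallyEq ?_
  filter_upwards [extChartAt_target_mem_nhds' hx] with y hy
  have hd1 : HasMFDerivAt 𝓘(ℝ, E) 𝓘(ℝ, E) (fun a : E => φ.symm y * φ₁.symm a) (φ₁ 1)
      ((leftMap (φ.symm y) : E →L[ℝ] E).comp (chartSymmDeriv (E := E) (1 : G) (φ₁ 1))) := by
    refine hasMFDerivAt_comp_of_eq (x := φ₁ 1) (k := fun a : G => φ.symm y * a) (f := φ₁.symm)
      (y := 1) ?_ (hasMFDerivAt_chart_symm h1) h11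
    exact (mdifferentiableAt_mul_left _ _).hasMFDerivAt
  have hd2 : HasFDerivAt (fun a : E => m (y, a))
      ((chartDeriv (E := E) c (φ.symm y)).comp ((leftMap (φ.symm y) : E →L[ℝ] E).comp
        (chartSymmDeriv (E := E) (1 : G) (φ₁ 1)))) (φ₁ 1) :=
    HasMFDerivAt.hasFDerivAt <| hasMFDerivAt_comp_of_eq (x := φ₁ 1) (k := φ)
      (f := fun a : E => φ.symm y * φ₁.symm a) (hasMFDerivAt_chart (φ.map_target hy)) hd1
      (by rw [h11, mul_one])
  rw [hd2.fderiv]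
  ext ξ
  simp only [chartLeft, ContinuousLinearMap.comp_apply]
  rw [chartSymmDeriv_chartDeriv (mem_extChartAt_source 1)]

/-- `chartLeft c x` as an isomorphism, with inverse `chartInv c x`. -/
def chartLeftEquiv {c : G} {x : E} (hx : x ∈ (extChartAt 𝓘(ℝ, E) c).target) : E ≃L[ℝ] E :=
  ContinuousLinearEquiv.equivOfInverse (chartLeft c x) (chartInv c x)
    (chartInv_chartLeft hx) (chartLeft_chartInv hx)

theorem contDiffAt_chartInv {c : G} {x : E} (hx : x ∈ (extChartAt 𝓘(ℝ, E) c).target) :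
    ContDiffAt ℝ ∞ (chartInv (E := E) c) x := by
  have : CompleteSpace E := FiniteDimensional.complete ℝ E
  have h : ∀ y (hy : y ∈ (extChartAt 𝓘(ℝ, E) c).target),
      chartInv c y = (chartLeft (E := E) c y).inverse := fun y hy => by
    have : chartLeft (E := E) c y = (chartLeftEquiv hy : E →L[ℝ] E) := rfl
    rw [this, ContinuousLinearMap.inverse_equiv]; rfl
  have h2 : ContDiffAt ℝ ∞ (fun y => (chartLeft (E := E) c y).inverse) x :=
    ContDiffAt.comp (g := ContinuousLinearMap.inverse) x
      (contDiffAt_map_inverse (chartLeftEquiv hx)) (contDiffAt_chartLeft hx)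
  refine h2.congr_of_eventuallyEq ?_
  filter_upwards [extChartAt_target_mem_nhds' hx] with y hy using h y hy

end Chart

section MaurerCartan

variable {E G : Type*} [NormedAddCommGroup E] [NormedSpace ℝ E] [FiniteDimensional ℝ E]
  [TopologicalSpace G] [ChartedSpace E G] [Group G] [LieGroup 𝓘(ℝ, E) ∞ G]

/-- In a chart, the commutator of the left-invariant vector fields `Aξ` and `Aη` is `A[ξ, η]`. -/
theorem fderiv_chartLeft_sub {c : G} {x : E} (hx : x ∈ (extChartAt 𝓘(ℝ, E) c).target) (ξ η : E) :
    fderiv ℝ (chartLeft (E := E) c) x (chartLeft c x ξ) η -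
      fderiv ℝ (chartLeft (E := E) c) x (chartLeft c x η) ξ =
        chartLeft c x (adjoint E G ξ η) := by
  have : LieGroup 𝓘(ℝ, E) (minSmoothness ℝ 3) G :=
    LieGroup.of_le (n := ∞) (by
      rw [minSmoothness_of_isRCLikeNormedField]
      exact WithTop.coe_le_coe.2 (le_top : (3 : ℕ∞) ≤ ⊤))
  have : CompleteSpace E := FiniteDimensional.complete ℝ E
  set φ := extChartAt 𝓘(ℝ, E) c
  let X : E → (g : G) → TangentSpace 𝓘(ℝ, E) g := fun v =>
    mulInvariantVectorField (I := 𝓘(ℝ, E)) (show GroupLieAlgebra 𝓘(ℝ, E) G from v)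
  have hinv : ∀ y ∈ φ.target, ∀ v : E,
      (mfderiv 𝓘(ℝ, E) 𝓘(ℝ, E) φ.symm y).inverse v = chartDeriv c (φ.symm y) v := fun y hy v => by
    let e : E ≃L[ℝ] E := ContinuousLinearEquiv.equivOfInverse (chartSymmDeriv c y)
      (chartDeriv c (φ.symm y)) (chartDeriv_chartSymmDeriv hy) (chartSymmDeriv_chartDeriv' hy)
    have h1 : (e : E →L[ℝ] E).inverse = e.symm := ContinuousLinearMap.inverse_equiv e
    exact congrArg (fun T : E →L[ℝ] E => T v) h1
  have hpull : ∀ v : E, ∀ y ∈ φ.target,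
      VectorField.mpullback 𝓘(ℝ, E) 𝓘(ℝ, E) φ.symm (X v) y = chartLeft c y v := fun v y hy =>
    hinv y hy _
  have key := VectorField.mpullback_mlieBracket (I := 𝓘(ℝ, E)) (I' := 𝓘(ℝ, E)) (f := φ.symm)
    (x₀ := x) (n := ∞) (V := X ξ) (W := X η)
    (mdifferentiableAt_mulInvariantVectorField _)
    (mdifferentiableAt_mulInvariantVectorField _)
    (contMDiffAt_extChartAt_symm hx) (by
      rw [minSmoothness_of_isRCLikeNormedField]
      exact WithTop.coe_le_coe.2 (le_top : (2 : ℕ∞) ≤ ⊤))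
  have hev : ∀ v : E, VectorField.mpullback 𝓘(ℝ, E) 𝓘(ℝ, E) φ.symm (X v) =ᶠ[𝓝 x]
      (fun y => chartLeft c y v) := fun v => by
    filter_upwards [extChartAt_target_mem_nhds' hx] with y hy using hpull v y hy
  have hl : ∀ V W : (y : E) → TangentSpace 𝓘(ℝ, E) y,
      VectorField.mlieBracket 𝓘(ℝ, E) V W x = VectorField.lieBracket ℝ V W x := fun V W => by
    rw [← VectorField.mlieBracketWithin_univ, VectorField.mlieBracketWithin_eq_lieBracketWithin]
    exact congrFun (VectorField.lieBracketWithin_univ (𝕜 := ℝ) (V := (V : E → E))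
      (W := (W : E → E))) x
  have hbr : VectorField.mlieBracket 𝓘(ℝ, E) (X ξ) (X η) = X (adjoint E G ξ η) :=
    (mulInvariantVector_mlieBracket (I := 𝓘(ℝ, E)) (G := G) ξ η).symm
  rw [hbr] at key
  have key : chartLeft c x (adjoint E G ξ η) =
      VectorField.lieBracket ℝ (fun y => chartLeft c y ξ) (fun y => chartLeft c y η) x :=
    (hpull _ x hx).symm.trans (key.trans
      ((Filter.EventuallyEq.mlieBracket_vectorField_eq (hev ξ) (hev η)).trans (hl _ _)))
  rw [VectorField.lieBracket] at key
  have hd : ∀ v w : E, fderiv ℝ (fun y => chartLeft (E := E) c y v) x w =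
      fderiv ℝ (chartLeft (E := E) c) x w v := fun v w => by
    have := (((contDiffAt_chartLeft hx).differentiableAt (by simp)).hasFDerivAt.clm_apply
      (hasFDerivAt_const v x)).fderiv
    rw [this]; simp
  rw [hd, hd] at key
  exact key.symm

/-- The Maurer-Cartan equation `dω (v, w) = -[ω v, ω w]` in a chart. -/
theorem fderiv_chartInv_sub {c : G} {x : E} (hx : x ∈ (extChartAt 𝓘(ℝ, E) c).target) (v w : E) :
    fderiv ℝ (chartInv (E := E) c) x v w - fderiv ℝ (chartInv (E := E) c) x w v =
      -adjoint E G (chartInv c x v) (chartInv c x w) := by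
  have : CompleteSpace E := FiniteDimensional.complete ℝ E
  have hA := ((contDiffAt_chartLeft hx).differentiableAt (by simp)).hasFDerivAt
  have hB := ((contDiffAt_chartInv hx).differentiableAt (by simp)).hasFDerivAt
  have hprod : ∀ a b : E, fderiv ℝ (chartInv (E := E) c) x a b =
      -chartInv c x (fderiv ℝ (chartLeft (E := E) c) x a (chartInv c x b)) := fun a b => by
    have h1 := (hB.clm_comp hA)
    have h2 : HasFDerivAt (fun y => (chartInv (E := E) c y).comp (chartLeft c y))
        (0 : E →L[ℝ] E →L[ℝ] E) x :=
      (hasFDerivAt_const (ContinuousLinearMap.id ℝ E) x).congr_of_eventuallyEq (by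
        filter_upwards [extChartAt_target_mem_nhds' hx] with y hy
        ext v
        exact chartInv_chartLeft hy v)
    have h3 := congrArg (fun T : E →L[ℝ] E →L[ℝ] E => T a (chartInv c x b)) (h1.unique h2)
    simp only [add_apply, ContinuousLinearMap.comp_apply, zero_apply,
      ContinuousLinearMap.compL_apply, ContinuousLinearMap.flip_apply,
      chartLeft_chartInv hx] at h3
    rw [add_comm] at h3
    exact eq_neg_of_add_eq_zero_left h3
  have hmc := fderiv_chartLeft_sub hx (chartInv c x v) (chartInv c x w)
  rw [chartLeft_chartInv hx, chartLeft_chartInv hx] at hmc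
  rw [hprod, hprod, neg_sub_neg, ← map_sub, ← neg_sub, hmc, map_neg, chartInv_chartLeft hx]

end MaurerCartan

/-! ### The contact Hamiltonian vector field in a chart -/

section Curves

variable {E G : Type*} [NormedAddCommGroup E] [NormedSpace ℝ E] [FiniteDimensional ℝ E]
  [TopologicalSpace G] [ChartedSpace E G]

/-- The linear map `ℝ → V` with value `v` at `1`: the derivative of a curve with velocity `v`. -/
abbrev velocity {V : Type*} [NormedAddCommGroup V] [NormedSpace ℝ V] (v : V) : ℝ →L[ℝ] V :=
  (1 : ℝ →L[ℝ] ℝ).smulRight v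

theorem toSpanSingleton_eq_velocity {V : Type*} [NormedAddCommGroup V] [NormedSpace ℝ V] (v : V) :
    ContinuousLinearMap.toSpanSingleton ℝ v = velocity v := by
  ext; simp

theorem hasMFDerivWithinAt_iff_hasDerivWithinAt {V : Type*} [NormedAddCommGroup V]
    [NormedSpace ℝ V] {f : ℝ → V} {s : Set ℝ} {t : ℝ} {v : V} :
    HasMFDerivWithinAt 𝓘(ℝ, ℝ) 𝓘(ℝ, V) f s t (velocity (V := V) v) ↔ HasDerivWithinAt f v s t := by
  rw [hasDerivWithinAt_iff_hasFDerivWithinAt, toSpanSingleton_eq_velocity]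
  exact hasMFDerivWithinAt_iff_hasFDerivWithinAt

/-- A map with derivative `F'` sends a curve with velocity `v` to a curve with velocity `F' v`. -/
theorem hasMFDerivWithinAt_comp_velocity {E₁ E₂ H₁ H₂ M N : Type*} [NormedAddCommGroup E₁]
    [NormedSpace ℝ E₁] [NormedAddCommGroup E₂] [NormedSpace ℝ E₂] [TopologicalSpace H₁]
    [TopologicalSpace H₂] {I : ModelWithCorners ℝ E₁ H₁} {J : ModelWithCorners ℝ E₂ H₂}
    [TopologicalSpace M] [ChartedSpace H₁ M] [TopologicalSpace N] [ChartedSpace H₂ N]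
    {F : M → N} {γ : ℝ → M} {s : Set ℝ} {t : ℝ} {v : E₁} {F' : E₁ →L[ℝ] E₂}
    (hF : HasMFDerivAt I J F (γ t) F')
    (hγ : HasMFDerivWithinAt 𝓘(ℝ, ℝ) I γ s t (velocity (V := E₁) v)) :
    HasMFDerivWithinAt 𝓘(ℝ, ℝ) J (fun τ => F (γ τ)) s t (velocity (V := E₂) (F' v)) := by
  have h := hF.comp_hasMFDerivWithinAt t hγ
  have e : F'.comp (velocity v) = velocity (F' v) := by
    ext; simp
  exact h.congr_mfderiv e

section Product

variable {V : Type*} [NormedAddCommGroup V] [NormedSpace ℝ V]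

/-- The velocity of a curve in `G × V × ℝ` is the triple of the velocities of its components. -/
theorem hasMFDerivWithinAt_prod_iff {γ : ℝ → G × V × ℝ} {s : Set ℝ} {t : ℝ} {v : E × V × ℝ} :
    HasMFDerivWithinAt 𝓘(ℝ, ℝ) ((𝓘(ℝ, E)).prod ((𝓘(ℝ, V)).prod 𝓘(ℝ, ℝ))) γ s t
        (velocity (V := E × V × ℝ) v) ↔
      HasMFDerivWithinAt 𝓘(ℝ, ℝ) 𝓘(ℝ, E) (fun τ => (γ τ).1) s t (velocity (V := E) v.1) ∧
      HasDerivWithinAt (fun τ => (γ τ).2.1) v.2.1 s t ∧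
      HasDerivWithinAt (fun τ => (γ τ).2.2) v.2.2 s t := by
  rw [← hasMFDerivWithinAt_iff_hasDerivWithinAt, ← hasMFDerivWithinAt_iff_hasDerivWithinAt]
  constructor
  · intro h
    have h1 := (hasMFDerivAt_fst (I := 𝓘(ℝ, E)) (I' := (𝓘(ℝ, V)).prod 𝓘(ℝ, ℝ))
      (γ t)).comp_hasMFDerivWithinAt t h
    have h2 := (hasMFDerivAt_snd (I := 𝓘(ℝ, E)) (I' := (𝓘(ℝ, V)).prod 𝓘(ℝ, ℝ))
      (γ t)).comp_hasMFDerivWithinAt t h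
    have h3 := (hasMFDerivAt_fst (I := 𝓘(ℝ, V)) (I' := 𝓘(ℝ, ℝ))
      (γ t).2).comp_hasMFDerivWithinAt t h2
    have h4 := (hasMFDerivAt_snd (I := 𝓘(ℝ, V)) (I' := 𝓘(ℝ, ℝ))
      (γ t).2).comp_hasMFDerivWithinAt t h2
    exact ⟨h1, h3, h4⟩
  · rintro ⟨h1, h2, h3⟩
    exact h1.prodMk (h2.prodMk h3)

end Product

variable [Group G] [LieGroup 𝓘(ℝ, E) ∞ G]

theorem hasDerivWithinAt_chart_comp {c : G} {x : ℝ → G} {s : Set ℝ} {t : ℝ} {a : E}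
    (hx : HasMFDerivWithinAt 𝓘(ℝ, ℝ) 𝓘(ℝ, E) x s t (velocity (V := E) a))
    (hs : x t ∈ (extChartAt 𝓘(ℝ, E) c).source) :
    HasDerivWithinAt (fun τ => extChartAt 𝓘(ℝ, E) c (x τ)) (chartDeriv c (x t) a) s t := by
  have h := (hasMFDerivAt_chart hs).comp_hasMFDerivWithinAt t hx
  have e : (chartDeriv (E := E) c (x t)).comp (velocity a) = velocity (chartDeriv c (x t) a) := by
    ext; simp
  exact hasMFDerivWithinAt_iff_hasDerivWithinAt.1 (h.congr_mfderiv e)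

theorem hasMFDerivWithinAt_chart_symm_comp {c : G} {x : ℝ → E} {s : Set ℝ} {t : ℝ} {a : E}
    (hx : HasDerivWithinAt x a s t) (hs : x t ∈ (extChartAt 𝓘(ℝ, E) c).target) :
    HasMFDerivWithinAt 𝓘(ℝ, ℝ) 𝓘(ℝ, E) (fun τ => (extChartAt 𝓘(ℝ, E) c).symm (x τ)) s t
      (velocity (V := E) (chartSymmDeriv c (x t) a)) := by
  have h := (hasMFDerivAt_chart_symm hs).comp_hasMFDerivWithinAt t
    (hasMFDerivWithinAt_iff_hasDerivWithinAt.2 hx)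
  have e : (chartSymmDeriv (E := E) c (x t)).comp (velocity a) =
      velocity (chartSymmDeriv c (x t) a) := by
    ext; simp
  exact h.congr_mfderiv e

end Curves

section LocalField

variable {E G : Type*} [NormedAddCommGroup E] [NormedSpace ℝ E] [FiniteDimensional ℝ E]
  [TopologicalSpace G] [ChartedSpace E G] [Group G]

variable (E) in
/-- The model space of `G × 𝔤* × ℝ`. -/
abbrev LocalPhase := E × (E →L[ℝ] ℝ) × ℝ

/-- The chart of `G × 𝔤* × ℝ` given by the chart of `G` centred at `c`. -/
def phaseChart (c : G) (y : PhaseSpace E G) : LocalPhase E := (extChartAt 𝓘(ℝ, E) c y.1, y.2)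

/-- The inverse of `phaseChart c`. -/
def phaseSymm (c : G) (u : LocalPhase E) : PhaseSpace E G :=
  ((extChartAt 𝓘(ℝ, E) c).symm u.1, u.2)

/-- The domain of `phaseChart c`. -/
def phaseSource (c : G) : Set (PhaseSpace E G) := {y | y.1 ∈ (extChartAt 𝓘(ℝ, E) c).source}

/-- The range of `phaseChart c`. -/
def phaseTarget (c : G) : Set (LocalPhase E) := {u | u.1 ∈ (extChartAt 𝓘(ℝ, E) c).target}

/-- The Hamiltonian in the chart centred at `c`. -/
def localHam (H : PhaseSpace E G → ℝ) (c : G) (u : LocalPhase E) : ℝ := H (phaseSymm c u)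

/-- The contact form in the chart centred at `c`. -/
def localForm (c : G) (u w : LocalPhase E) : ℝ := w.2.2 - u.2.1 (chartInv c u.1 w.1)

variable [LieGroup 𝓘(ℝ, E) ∞ G]

/-- The contact Hamiltonian vector field in the chart centred at `c`. -/
def localField (H : PhaseSpace E G → ℝ) (c : G) (u : LocalPhase E) : LocalPhase E :=
  (chartLeft c u.1 (dMomentum H (phaseSymm c u)),
    coadjoint G (dMomentum H (phaseSymm c u)) u.2.1 - hamBase H (phaseSymm c u)
      - hamCost H (phaseSymm c u) • u.2.1,
    u.2.1 (dMomentum H (phaseSymm c u)) - localHam H c u)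

theorem isOpen_phaseSource (c : G) : IsOpen (phaseSource (E := E) c) :=
  (isOpen_extChartAt_source c).preimage continuous_fst

theorem isOpen_phaseTarget (c : G) : IsOpen (phaseTarget (E := E) c) :=
  (isOpen_extChartAt_target c).preimage continuous_fst

theorem phaseSymm_phaseChart {c : G} {y : PhaseSpace E G} (hy : y ∈ phaseSource c) :
    phaseSymm c (phaseChart c y) = y :=
  Prod.ext ((extChartAt 𝓘(ℝ, E) c).left_inv hy) rfl

theorem phaseChart_mem {c : G} {y : PhaseSpace E G} (hy : y ∈ phaseSource c) :
    phaseChart c y ∈ phaseTarget (E := E) c :=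
  (extChartAt 𝓘(ℝ, E) c).map_source hy

theorem phaseSymm_mem {c : G} {u : LocalPhase E} (hu : u ∈ phaseTarget (G := G) c) :
    phaseSymm c u ∈ phaseSource (E := E) c :=
  (extChartAt 𝓘(ℝ, E) c).map_target hu

theorem contMDiffAt_phaseSymm {c : G} {u : LocalPhase E} (hu : u ∈ phaseTarget (G := G) c) :
    ContMDiffAt 𝓘(ℝ, LocalPhase E) (phaseModel E) ∞ (phaseSymm (G := G) c) u := by
  have h1 : ContMDiffAt 𝓘(ℝ, LocalPhase E) 𝓘(ℝ, E) ∞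
      (fun u : LocalPhase E => (extChartAt 𝓘(ℝ, E) c).symm u.1) u :=
    ContMDiffAt.comp (g := (extChartAt 𝓘(ℝ, E) c).symm) (f := Prod.fst) u
      (contMDiffAt_extChartAt_symm hu) contDiff_fst.contMDiff.contMDiffAt
  exact h1.prodMk ((contDiff_fst.comp contDiff_snd).contMDiff.contMDiffAt.prodMk
    (contDiff_snd.comp contDiff_snd).contMDiff.contMDiffAt)

theorem contMDiffAt_phaseChart {c : G} {y : PhaseSpace E G} (hy : y ∈ phaseSource c) :
    ContMDiffAt (phaseModel E) 𝓘(ℝ, LocalPhase E) ∞ (phaseChart c) y := by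
  have h1 : ContMDiffAt (phaseModel E) 𝓘(ℝ, E) ∞
      (fun y : PhaseSpace E G => extChartAt 𝓘(ℝ, E) c y.1) y :=
    ContMDiffAt.comp (g := extChartAt 𝓘(ℝ, E) c) (f := Prod.fst) y
      (contMDiffAt_chart hy) contMDiffAt_fst
  exact h1.prodMk_space ((contMDiffAt_fst.comp y contMDiffAt_snd).prodMk_space
    (contMDiffAt_snd.comp y contMDiffAt_snd))

variable {H : PhaseSpace E G → ℝ}

theorem contDiffAt_localHam (hH : ContMDiff (phaseModel E) 𝓘(ℝ, ℝ) ∞ H) {c : G}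
    {u : LocalPhase E} (hu : u ∈ phaseTarget (G := G) c) : ContDiffAt ℝ ∞ (localHam H c) u := by
  rw [← contMDiffAt_iff_contDiffAt]
  exact hH.contMDiffAt.comp u (contMDiffAt_phaseSymm hu)

theorem fderiv_localHam_momentum (hH : ContMDiff (phaseModel E) 𝓘(ℝ, ℝ) ∞ H) {c : G}
    {u : LocalPhase E} (hu : u ∈ phaseTarget (G := G) c) (ν : E →L[ℝ] ℝ) :
    fderiv ℝ (localHam H c) u (0, ν, 0) = ν (dMomentum H (phaseSymm c u)) := by
  rw [apply_dMomentum]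
  have h1 := ((contDiffAt_localHam hH hu).differentiableAt (by simp)).hasFDerivAt
  have h0 : HasFDerivAt (fun μ : E →L[ℝ] ℝ => μ) (ContinuousLinearMap.id ℝ _) u.2.1 :=
    hasFDerivAt_id _
  have h2 : HasFDerivAt (fun μ : E →L[ℝ] ℝ => ((u.1, μ, u.2.2) : LocalPhase E))
      _ u.2.1 :=
    (hasFDerivAt_const u.1 _).prodMk (h0.prodMk (hasFDerivAt_const u.2.2 _))
  have h3 := HasFDerivAt.comp (g := localHam H c) u.2.1 h1 h2
  have h4 : fderiv ℝ (fun μ => H ((phaseSymm c u).1, μ, (phaseSymm c u).2.2)) (phaseSymm c u).2.1 =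
      _ := h3.fderiv
  rw [h4]
  rfl

theorem fderiv_localHam_cost (hH : ContMDiff (phaseModel E) 𝓘(ℝ, ℝ) ∞ H) {c : G}
    {u : LocalPhase E} (hu : u ∈ phaseTarget (G := G) c) :
    fderiv ℝ (localHam H c) u (0, 0, 1) = hamCost H (phaseSymm c u) := by
  have h1 := ((contDiffAt_localHam hH hu).differentiableAt (by simp)).hasFDerivAt
  have h2 : HasDerivAt (fun s : ℝ => ((u.1, u.2.1, s) : LocalPhase E)) (0, 0, 1) u.2.2 :=
    (hasDerivAt_const _ _).prodMk ((hasDerivAt_const _ _).prodMk (hasDerivAt_id _))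
  have h3 := HasFDerivAt.comp_hasDerivAt (l := localHam H c) u.2.2 h1 h2
  exact h3.deriv.symm

theorem fderiv_localHam_base (hH : ContMDiff (phaseModel E) 𝓘(ℝ, ℝ) ∞ H) {c : G}
    {u : LocalPhase E} (hu : u ∈ phaseTarget (G := G) c) (η : E) :
    fderiv ℝ (localHam H c) u (chartLeft c u.1 η, 0) = hamBase H (phaseSymm c u) η := by
  have h1 := ((contDiffAt_localHam hH hu).differentiableAt (by simp)).hasFDerivAt
  have h2 : HasFDerivAt (fun x : E => ((x, u.2) : LocalPhase E))
      (ContinuousLinearMap.inl ℝ E ((E →L[ℝ] ℝ) × ℝ)) u.1 :=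
    (hasFDerivAt_id _).prodMk (hasFDerivAt_const _ _)
  have h3 : HasFDerivAt (fun x : E => H ((extChartAt 𝓘(ℝ, E) c).symm x, u.2))
      ((fderiv ℝ (localHam H c) u).comp (ContinuousLinearMap.inl ℝ E ((E →L[ℝ] ℝ) × ℝ))) u.1 :=
    HasFDerivAt.comp (g := localHam H c) u.1 h1 h2
  have h4 : MDifferentiableAt 𝓘(ℝ, E) 𝓘(ℝ, ℝ) (fun g => H (g, u.2))
      ((extChartAt 𝓘(ℝ, E) c).symm u.1) :=
    MDifferentiableAt.comp (I' := phaseModel E) _ (g := H) (f := fun g => (g, u.2))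
      (hH.mdifferentiableAt (by simp)) (mdifferentiableAt_id.prodMk mdifferentiableAt_const)
  have h5 := (h4.hasMFDerivAt.comp u.1 (hasMFDerivAt_chart_symm hu)).hasFDerivAt
  have h6 := congrArg (fun T : E →L[ℝ] ℝ => T (chartLeft c u.1 η)) (h3.unique h5)
  refine h6.trans ?_
  show (show E →L[ℝ] ℝ from mfderiv 𝓘(ℝ, E) 𝓘(ℝ, ℝ) (fun g => H (g, u.2))
    ((extChartAt 𝓘(ℝ, E) c).symm u.1)) (chartSymmDeriv c u.1 (chartDeriv c
      ((extChartAt 𝓘(ℝ, E) c).symm u.1) (leftMap ((extChartAt 𝓘(ℝ, E) c).symm u.1) η))) = _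
  rw [chartSymmDeriv_chartDeriv' hu]
  rfl

theorem fderiv_localHam_apply (hH : ContMDiff (phaseModel E) 𝓘(ℝ, ℝ) ∞ H) {c : G}
    {u : LocalPhase E} (hu : u ∈ phaseTarget (G := G) c) (w : LocalPhase E) :
    fderiv ℝ (localHam H c) u w = hamBase H (phaseSymm c u) (chartInv c u.1 w.1) +
      w.2.1 (dMomentum H (phaseSymm c u)) + hamCost H (phaseSymm c u) * w.2.2 := by
  have e : w = ((chartLeft c u.1 (chartInv c u.1 w.1), 0) : LocalPhase E) +
      ((0, w.2.1, 0) : LocalPhase E) + w.2.2 • ((0, 0, 1) : LocalPhase E) := by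
    rw [chartLeft_chartInv hu]
    ext <;> simp
  conv_lhs => rw [e]
  rw [map_add, map_add, map_smul, fderiv_localHam_base hH hu, fderiv_localHam_momentum hH hu,
    fderiv_localHam_cost hH hu, smul_eq_mul, mul_comm (w.2.2)]

variable (E G) in
/-- `ξ ↦ ad_ξ` as a continuous linear map. -/
def adjointL : E →L[ℝ] E →L[ℝ] E :=
  LinearMap.toContinuousLinearMap
    { toFun := adjoint E G
      map_add' := fun ξ ξ' => by
        ext η
        have : CompleteSpace E := FiniteDimensional.complete ℝ E
        have : LieGroup 𝓘(ℝ, E) (minSmoothness ℝ 3) G :=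
          LieGroup.of_le (n := ∞) (by
            rw [minSmoothness_of_isRCLikeNormedField]
            exact WithTop.coe_le_coe.2 (le_top : (3 : ℕ∞) ≤ ⊤))
        exact add_lie (show GroupLieAlgebra 𝓘(ℝ, E) G from ξ)
          (show GroupLieAlgebra 𝓘(ℝ, E) G from ξ') (show GroupLieAlgebra 𝓘(ℝ, E) G from η)
      map_smul' := fun r ξ => by
        ext η
        have : CompleteSpace E := FiniteDimensional.complete ℝ E
        have : LieGroup 𝓘(ℝ, E) (minSmoothness ℝ 3) G :=
          LieGroup.of_le (n := ∞) (by
            rw [minSmoothness_of_isRCLikeNormedField]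
            exact WithTop.coe_le_coe.2 (le_top : (3 : ℕ∞) ≤ ⊤))
        exact smul_lie r (show GroupLieAlgebra 𝓘(ℝ, E) G from ξ)
          (show GroupLieAlgebra 𝓘(ℝ, E) G from η) }

variable (E) in
/-- The identification of `𝔤**` with `𝔤`. -/
def bidualL : ((E →L[ℝ] ℝ) →L[ℝ] ℝ) →L[ℝ] E :=
  LinearMap.toContinuousLinearMap (𝕜 := ℝ) (E := (E →L[ℝ] ℝ) →L[ℝ] ℝ) (F' := E)
    { toFun := fun l => (Module.evalEquiv ℝ E).symm ((l : (E →L[ℝ] ℝ) →ₗ[ℝ] ℝ) ∘ₗ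
        (LinearMap.toContinuousLinearMap : (E →ₗ[ℝ] ℝ) ≃ₗ[ℝ] (E →L[ℝ] ℝ)).toLinearMap)
      map_add' := fun l l' => by
        rw [← map_add, ← LinearMap.add_comp]; rfl
      map_smul' := fun r l => by
        rw [RingHom.id_apply, ← map_smul, ← LinearMap.smul_comp]; rfl }

theorem dMomentum_eq_bidualL (H : PhaseSpace E G → ℝ) (y : PhaseSpace E G) :
    dMomentum H y = bidualL E (fderiv ℝ (fun μ => H (y.1, μ, y.2.2)) y.2.1) := rfl

theorem contDiffAt_dMomentum (hH : ContMDiff (phaseModel E) 𝓘(ℝ, ℝ) ∞ H) {c : G}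
    {u : LocalPhase E} (hu : u ∈ phaseTarget (G := G) c) :
    ContDiffAt ℝ ∞ (fun u => dMomentum H (phaseSymm c u)) u := by
  have h1 : ContDiffAt ℝ ∞ (fderiv ℝ (localHam H c)) u :=
    (contDiffAt_localHam hH hu).fderiv_right (m := ∞) (by simp)
  have h2 : ContDiffAt ℝ ∞ (fun u => bidualL E ((fderiv ℝ (localHam H c) u).comp
      ((ContinuousLinearMap.inr ℝ E ((E →L[ℝ] ℝ) × ℝ)).comp
        (ContinuousLinearMap.inl ℝ (E →L[ℝ] ℝ) ℝ)))) u :=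
    ContDiffAt.comp (g := bidualL E) u (ContinuousLinearMap.contDiff (𝕜 := ℝ)
      (E := (E →L[ℝ] ℝ) →L[ℝ] ℝ) (F := E) (n := ∞) (bidualL E)).contDiffAt
      (h1.clm_comp contDiffAt_const)
  refine h2.congr_of_eventuallyEq ?_
  filter_upwards [(isOpen_phaseTarget c).mem_nhds hu] with v hv
  rw [dMomentum_eq_bidualL]
  congr 1
  ext ν
  rw [← apply_dMomentum, ← fderiv_localHam_momentum hH hv]
  rfl

theorem contDiffAt_localField (hH : ContMDiff (phaseModel E) 𝓘(ℝ, ℝ) ∞ H) {c : G}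
    {u : LocalPhase E} (hu : u ∈ phaseTarget (G := G) c) :
    ContDiffAt ℝ ∞ (localField H c) u := by
  have h0 := contDiffAt_dMomentum hH hu
  have h1 : ContDiffAt ℝ ∞ (fderiv ℝ (localHam H c)) u :=
    (contDiffAt_localHam hH hu).fderiv_right (m := ∞) (by simp)
  have hA : ContDiffAt ℝ ∞ (fun u : LocalPhase E => chartLeft (E := E) c u.1) u :=
    ContDiffAt.comp (g := chartLeft (E := E) c) u (contDiffAt_chartLeft hu) contDiffAt_fst
  have hμ : ContDiffAt ℝ ∞ (fun u : LocalPhase E => u.2.1) u :=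
    (contDiff_fst.comp contDiff_snd).contDiffAt
  have hb : ContDiffAt ℝ ∞ (fun u => hamBase H (phaseSymm c u)) u := by
    have : ContDiffAt ℝ ∞ (fun u => (fderiv ℝ (localHam H c) u).comp
        ((ContinuousLinearMap.inl ℝ E ((E →L[ℝ] ℝ) × ℝ)).comp (chartLeft c u.1))) u :=
      h1.clm_comp (contDiffAt_const.clm_comp hA)
    refine this.congr_of_eventuallyEq ?_
    filter_upwards [(isOpen_phaseTarget c).mem_nhds hu] with v hv
    ext η
    exact (fderiv_localHam_base hH hv η).symm
  have hc : ContDiffAt ℝ ∞ (fun u => hamCost H (phaseSymm c u)) u := by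
    have : ContDiffAt ℝ ∞ (fun u => fderiv ℝ (localHam H c) u (0, 0, 1)) u :=
      h1.clm_apply contDiffAt_const
    refine this.congr_of_eventuallyEq ?_
    filter_upwards [(isOpen_phaseTarget c).mem_nhds hu] with v hv
    exact (fderiv_localHam_cost hH hv).symm
  have had : ContDiffAt ℝ ∞ (fun u => adjoint E G (dMomentum H (phaseSymm c u))) u :=
    (adjointL E G).contDiff.contDiffAt.comp u h0
  exact (hA.clm_apply h0).prodMk ((((hμ.clm_comp had).sub hb).sub (hc.smul hμ)).prodMk
    ((hμ.clm_apply h0).sub (contDiffAt_localHam hH hu)))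

theorem differentiableAt_hamCost (hH : ContMDiff (phaseModel E) 𝓘(ℝ, ℝ) ∞ H) {c : G}
    {u : LocalPhase E} (hu : u ∈ phaseTarget (G := G) c) :
    DifferentiableAt ℝ (fun u => hamCost H (phaseSymm c u)) u := by
  have h1 : ContDiffAt ℝ ∞ (fderiv ℝ (localHam H c)) u :=
    (contDiffAt_localHam hH hu).fderiv_right (m := ∞) (by simp)
  have : ContDiffAt ℝ ∞ (fun u => fderiv ℝ (localHam H c) u (0, 0, 1)) u :=
    h1.clm_apply contDiffAt_const
  refine (this.differentiableAt (by simp)).congr_of_eventuallyEq ?_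
  filter_upwards [(isOpen_phaseTarget c).mem_nhds hu] with v hv
  exact (fderiv_localHam_cost hH hv).symm

/-- The contact form of the contact Hamiltonian vector field is `-H`. -/
theorem localForm_localField {c : G} {u : LocalPhase E} (hu : u ∈ phaseTarget (G := G) c) :
    localForm c u (localField H c u) = -localHam H c u := by
  show u.2.1 (dMomentum H (phaseSymm c u)) - localHam H c u -
    u.2.1 (chartInv c u.1 (chartLeft c u.1 (dMomentum H (phaseSymm c u)))) = _
  rw [chartInv_chartLeft hu]; ring

/-- The derivative of the contact form along a curve of points and a curve of vectors. -/
theorem hasFDerivAt_localForm {X : Type*} [NormedAddCommGroup X] [NormedSpace ℝ X] {c : G}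
    {a b : X → LocalPhase E} {a' b' : X →L[ℝ] LocalPhase E} {p : X}
    (ha : HasFDerivAt a a' p) (hb : HasFDerivAt b b' p)
    (hp : a p ∈ phaseTarget (G := G) c) (v : X) :
    ∃ l : X →L[ℝ] ℝ, HasFDerivAt (fun q => localForm c (a q) (b q)) l p ∧
      l v = (b' v).2.2 - (a' v).2.1 (chartInv c (a p).1 (b p).1) -
        (a p).2.1 (fderiv ℝ (chartInv (E := E) c) (a p).1 (a' v).1 (b p).1) -
        (a p).2.1 (chartInv c (a p).1 (b' v).1) := by
  have hB := ((contDiffAt_chartInv (G := G) hp).differentiableAt (by simp)).hasFDerivAt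
  have h1 := HasFDerivAt.comp (g := chartInv (E := E) c) p hB ha.fst
  have h2 := h1.clm_apply hb.fst
  have h3 := ha.snd.fst.clm_apply h2
  refine ⟨_, hb.snd.snd.sub h3, ?_⟩
  simp only [sub_apply, add_apply, ContinuousLinearMap.comp_apply,
    ContinuousLinearMap.flip_apply, map_add, ContinuousLinearMap.coe_fst',
    ContinuousLinearMap.coe_snd', Function.comp_apply]
  ring

/-- The contact form of a solution `w` of the variational equation along an integral curve `u` of
the contact Hamiltonian vector field satisfies a scalar linear equation. In other words,
`L_{X_H} θ = -(∂H/∂z) θ`; here it follows from `ι_{X_H} θ = -H` and the Maurer-Cartan equation. -/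
theorem hasDerivAt_localForm (hH : ContMDiff (phaseModel E) 𝓘(ℝ, ℝ) ∞ H) {c : G}
    {u w : ℝ → LocalPhase E} {t : ℝ} (ht : u t ∈ phaseTarget (G := G) c)
    (hu : HasDerivAt u (localField H c (u t)) t)
    (hw : HasDerivAt w (fderiv ℝ (localField H c) (u t) (w t)) t) :
    HasDerivAt (fun τ => localForm c (u τ) (w τ))
      (-hamCost H (phaseSymm c (u t)) * localForm c (u t) (w t)) t := by
  set p := u t
  have hf := ((contDiffAt_localField hH ht).differentiableAt (by simp)).hasFDerivAt
  -- the derivative of `θ(X_H) = -H` in the direction `w`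
  obtain ⟨l, hl, hlv⟩ := hasFDerivAt_localForm (c := c) (hasFDerivAt_id p) hf ht (w t)
  have hl2 : HasFDerivAt (fun q => localForm c (id q) (localField H c q))
      (-fderiv ℝ (localHam H c) p) p :=
    ((contDiffAt_localHam hH ht).differentiableAt (by simp)).hasFDerivAt.neg.congr_of_eventuallyEq
      (by filter_upwards [(isOpen_phaseTarget c).mem_nhds ht] with q hq
          exact localForm_localField hq)
  have e1 := congrArg (fun T : LocalPhase E →L[ℝ] ℝ => T (w t)) (hl.unique hl2)
  simp only [hlv, neg_apply, ContinuousLinearMap.id_apply, id,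
    fderiv_localHam_apply hH ht] at e1
  obtain ⟨m, hm, hmv⟩ := hasFDerivAt_localForm (c := c) hu.hasFDerivAt hw.hasFDerivAt ht (1 : ℝ)
  have hmc := congrArg p.2.1 (fderiv_chartInv_sub ht (localField H c p).1 (w t).1)
  have e2 : m 1 = -hamCost H (phaseSymm c p) * localForm c p (w t) := by
    simp only [ContinuousLinearMap.toSpanSingleton_apply, one_smul] at hmv
    have e3 : chartInv c p.1 (localField H c p).1 = dMomentum H (phaseSymm c p) :=
      chartInv_chartLeft ht _
    have e4 : (localField H c p).2.1 (chartInv c p.1 (w t).1) =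
        p.2.1 (adjoint E G (dMomentum H (phaseSymm c p)) (chartInv c p.1 (w t).1)) -
          hamBase H (phaseSymm c p) (chartInv c p.1 (w t).1) -
          hamCost H (phaseSymm c p) * p.2.1 (chartInv c p.1 (w t).1) := rfl
    rw [map_sub, map_neg, e3] at hmc
    rw [e3] at e1
    rw [hmv, localForm]
    change _ - (localField H c p).2.1 (chartInv c p.1 (w t).1) - _ - _ = _
    rw [e4]
    linarith
  have := hm.hasDerivAt
  rwa [e2] at this

end LocalField

/-! ### The flow is a conformal contactomorphism -/

/-- The solution of a scalar linear homogeneous equation. -/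
theorem eq_exp_neg_integral_mul {g q : ℝ → ℝ} {ε t : ℝ} (hg : ContinuousOn g (Icc (-ε) ε))
    (hq : ∀ τ ∈ Icc 0 ε, HasDerivAt q (-g τ * q τ) τ) (ht : t ∈ Icc 0 ε) :
    q t = Real.exp (-∫ τ in (0 : ℝ)..t, g τ) * q 0 := by
  have hsub : Icc 0 ε ⊆ Icc (-ε) ε := fun τ hτ => ⟨by linarith [hτ.1, hτ.2], hτ.2⟩
  have hε : 0 ≤ ε := ht.1.trans ht.2
  have hint : MeasureTheory.IntegrableOn g (uIcc 0 ε) := by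
    rw [uIcc_of_le hε]
    exact (hg.mono hsub).integrableOn_Icc
  have hprim : ContinuousOn (fun τ => ∫ s in (0 : ℝ)..τ, g s) (Icc 0 ε) := by
    rw [← uIcc_of_le hε]
    exact intervalIntegral.continuousOn_primitive_interval hint
  have hder : ∀ τ ∈ Ico 0 ε, HasDerivAt (fun τ => ∫ s in (0 : ℝ)..τ, g s) (g τ) τ :=
    fun τ hτ => by
    have hmem : τ ∈ Ioo (-ε) ε := ⟨by linarith [hτ.1, hτ.2], hτ.2⟩
    refine intervalIntegral.integral_hasDerivAt_right ?_ ?_ ?_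
    · refine ContinuousOn.intervalIntegrable (hg.mono ?_)
      rw [uIcc_of_le hτ.1]
      exact fun s hs => hsub ⟨hs.1, hs.2.trans hτ.2.le⟩
    · exact (hg.mono Ioo_subset_Icc_self).stronglyMeasurableAtFilter isOpen_Ioo _ hmem
    · exact hg.continuousAt (Icc_mem_nhds hmem.1 hmem.2)
  have hconst := constant_of_has_deriv_right_zero
    (f := fun τ => Real.exp (∫ s in (0 : ℝ)..τ, g s) * q τ) (a := 0) (b := ε)
    ((Real.continuous_exp.comp_continuousOn hprim).mul
      fun τ hτ => (hq τ hτ).continuousAt.continuousWithinAt)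
    (fun τ hτ => by
      have h := ((hder τ hτ).exp.mul (hq τ (Ico_subset_Icc_self hτ))).hasDerivWithinAt (s := Ici τ)
      exact h.congr_deriv (by ring)) t ht
  simp only [intervalIntegral.integral_same, Real.exp_zero, one_mul] at hconst
  rw [← hconst, ← mul_assoc, ← Real.exp_add, neg_add_cancel, Real.exp_zero, one_mul]

section Flow

variable {E G : Type*} [NormedAddCommGroup E] [NormedSpace ℝ E] [FiniteDimensional ℝ E]
  [TopologicalSpace G] [ChartedSpace E G] [Group G] [LieGroup 𝓘(ℝ, E) ∞ G]
  {H : PhaseSpace E G → ℝ}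

theorem hasDerivWithinAt_phaseChart_comp {c : G} {γ : ℝ → PhaseSpace E G} {s : Set ℝ} {t : ℝ}
    (hγ : HasMFDerivWithinAt 𝓘(ℝ, ℝ) (phaseModel E) γ s t
      (velocity (V := E × (E →L[ℝ] ℝ) × ℝ) (contactField H (γ t))))
    (ht : γ t ∈ phaseSource c) :
    HasDerivWithinAt (fun τ => phaseChart c (γ τ)) (localField H c (phaseChart c (γ t))) s t := by
  obtain ⟨h1, h2, h3⟩ := hasMFDerivWithinAt_prod_iff.1 hγ
  have h := (hasDerivWithinAt_chart_comp h1 ht).prodMk (h2.prodMk h3)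
  have e : localField H c (phaseChart c (γ t)) = (chartDeriv (E := E) c (γ t).1
      (leftMap (γ t).1 (dMomentum H (γ t))), (contactField H (γ t)).2.1,
      (contactField H (γ t)).2.2) := by
    unfold localField localHam
    rw [phaseSymm_phaseChart ht]
    have e' : (extChartAt 𝓘(ℝ, E) c).symm (phaseChart c (γ t)).1 = (γ t).1 :=
      (extChartAt 𝓘(ℝ, E) c).left_inv ht
    simp only [chartLeft, ContinuousLinearMap.comp_apply, e']
    rfl
  rw [e]
  exact h

theorem hasMFDerivWithinAt_phaseSymm_comp {c : G} {u : ℝ → LocalPhase E} {s : Set ℝ} {t : ℝ}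
    (hu : HasDerivWithinAt u (localField H c (u t)) s t) (ht : u t ∈ phaseTarget (G := G) c) :
    HasMFDerivWithinAt 𝓘(ℝ, ℝ) (phaseModel E) (fun τ => phaseSymm (G := G) c (u τ)) s t
      (velocity (V := E × (E →L[ℝ] ℝ) × ℝ) (contactField H (phaseSymm c (u t)))) := by
  refine hasMFDerivWithinAt_prod_iff.2 ⟨?_, hu.snd.fst, hu.snd.snd⟩
  have h := hasMFDerivWithinAt_chart_symm_comp (G := G) (c := c) hu.fst ht
  have e : chartSymmDeriv c (u t).1 (localField H c (u t)).1 =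
      leftMap (phaseSymm c (u t)).1 (dMomentum H (phaseSymm c (u t))) :=
    chartSymmDeriv_chartDeriv' ht _
  rw [e] at h
  exact h

theorem IsFlowLine.mono {T T' : ℝ} {y : PhaseSpace E G} {γ : ℝ → PhaseSpace E G}
    (h : IsFlowLine H T y γ) (hT : T' ≤ T) : IsFlowLine H T' y γ :=
  ⟨h.1, h.2.mono (Icc_subset_Icc_right hT)⟩

theorem IsFlowLine.continuousOn {T : ℝ} {y : PhaseSpace E G} {γ : ℝ → PhaseSpace E G}
    (h : IsFlowLine H T y γ) : ContinuousOn γ (Icc 0 T) :=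
  fun t ht => (h.2 t ht).continuousWithinAt

theorem continuousAt_phaseChart {c : G} {y : PhaseSpace E G} (hy : y ∈ phaseSource c) :
    ContinuousAt (phaseChart (E := E) c) y :=
  (contMDiffAt_phaseChart hy).continuousAt

theorem continuous_hamCost (hH : ContMDiff (phaseModel E) 𝓘(ℝ, ℝ) ∞ H) :
    Continuous (hamCost H) := by
  rw [continuous_iff_continuousAt]
  intro y
  have hy : y ∈ phaseSource y.1 := mem_extChartAt_source y.1
  have h := ContinuousAt.comp (g := fun u => hamCost H (phaseSymm y.1 u))
    (differentiableAt_hamCost hH (phaseChart_mem hy)).continuousAt (continuousAt_phaseChart hy)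
  refine h.congr ?_
  filter_upwards [(isOpen_phaseSource y.1).mem_nhds hy] with z hz
  show hamCost H (phaseSymm y.1 (phaseChart y.1 z)) = _
  rw [phaseSymm_phaseChart hz]

/-- Integral curves of `X_H` with the same initial point agree. -/
theorem IsFlowLine.eqOn [T2Space G] (hH : ContMDiff (phaseModel E) 𝓘(ℝ, ℝ) ∞ H) {T : ℝ}
    {y : PhaseSpace E G} {γ γ' : ℝ → PhaseSpace E G} (h : IsFlowLine H T y γ)
    (h' : IsFlowLine H T y γ') : EqOn γ γ' (Icc 0 T) := by
  have hclosed : IsClosed ({t | γ t = γ' t} ∩ Icc 0 T) := by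
    rw [inter_comm]
    exact (h.continuousOn.prodMk h'.continuousOn).preimage_isClosed_of_isClosed isClosed_Icc
      isClosed_diagonal
  refine hclosed.Icc_subset_of_forall_mem_nhdsWithin (h.1.trans h'.1.symm) ?_
  rintro t ⟨htt, ht⟩
  change γ t = γ' t at htt
  set c := (γ t).1
  have hsrc : γ t ∈ phaseSource c := mem_extChartAt_source c
  have hsrc' : γ' t ∈ phaseSource c := htt ▸ hsrc
  obtain ⟨K, W, hW, hK⟩ := ((contDiffAt_localField hH (phaseChart_mem hsrc)).of_le
    (by simp : (1 : WithTop ℕ∞) ≤ ∞)).exists_lipschitzOnWith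
  have hN : {z | z ∈ phaseSource c ∧ phaseChart c z ∈ W} ∈ 𝓝 (γ t) :=
    inter_mem ((isOpen_phaseSource c).mem_nhds hsrc) (continuousAt_phaseChart hsrc hW)
  have hIcc : Icc 0 T ∈ 𝓝[≥] t := by
    exact mem_of_superset (Icc_mem_nhdsGE ht.2) (Icc_subset_Icc_left ht.1)
  have hc1 := ((h.continuousOn t (Ico_subset_Icc_self ht)).mono_of_mem_nhdsWithin hIcc) hN
  have hc2 := ((h'.continuousOn t (Ico_subset_Icc_self ht)).mono_of_mem_nhdsWithin hIcc)
    (htt ▸ hN)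
  obtain ⟨b, hb, hbs⟩ := (mem_nhdsGE_iff_exists_Icc_subset).1
    (inter_mem (inter_mem hc1 hc2) hIcc)
  have hder : ∀ {δ : ℝ → PhaseSpace E G}, IsFlowLine H T y δ →
      (∀ τ ∈ Icc t b, δ τ ∈ phaseSource c) → ∀ τ ∈ Icc t b, HasDerivWithinAt
        (fun τ => phaseChart c (δ τ)) (localField H c (phaseChart c (δ τ))) (Icc t b) τ := by
    intro δ hδ hs τ hτ
    exact hasDerivWithinAt_phaseChart_comp
      ((hδ.2 τ (hbs hτ).2).mono fun σ hσ => (hbs hσ).2) (hs τ hτ)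
  have hd1 := hder h fun τ hτ => (hbs hτ).1.1.1
  have hd2 := hder h' fun τ hτ => (hbs hτ).1.2.1
  have hright : ∀ {f : ℝ → LocalPhase E} {f' : LocalPhase E} {τ : ℝ}, τ ∈ Ico t b →
      HasDerivWithinAt f f' (Icc t b) τ → HasDerivWithinAt f f' (Ici τ) τ := fun hτ hf =>
    hf.mono_of_mem_nhdsWithin
      (mem_of_superset (Icc_mem_nhdsGE hτ.2) (Icc_subset_Icc_left hτ.1))
  have heq := ODE_solution_unique_of_mem_Icc_right (v := fun _ => localField H c)
    (s := fun _ => W) (K := K) (f := fun τ => phaseChart c (γ τ))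
    (g := fun τ => phaseChart c (γ' τ)) (a := t) (b := b) (fun _ _ => hK)
    (fun τ hτ => (hd1 τ hτ).continuousWithinAt)
    (fun τ hτ => hright hτ (hd1 τ (Ico_subset_Icc_self hτ)))
    (fun τ hτ => (hbs (Ico_subset_Icc_self hτ)).1.1.2)
    (fun τ hτ => (hd2 τ hτ).continuousWithinAt)
    (fun τ hτ => hright hτ (hd2 τ (Ico_subset_Icc_self hτ)))
    (fun τ hτ => (hbs (Ico_subset_Icc_self hτ)).1.2.2)
    (by show phaseChart c (γ t) = phaseChart c (γ' t); rw [htt])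
  refine mem_of_superset (Ioc_mem_nhdsGT hb) fun τ hτ => ?_
  have hτ' := Ioc_subset_Icc_self hτ
  have := congrArg (phaseSymm (G := G) c) (heq hτ')
  rwa [phaseSymm_phaseChart (hbs hτ').1.1.1, phaseSymm_phaseChart (hbs hτ').1.2.1] at this

theorem flow_eq [T2Space G] (hH : ContMDiff (phaseModel E) 𝓘(ℝ, ℝ) ∞ H) {T : ℝ}
    {y : PhaseSpace E G} {γ : ℝ → PhaseSpace E G} (h : IsFlowLine H T y γ) {t : ℝ}
    (ht : t ∈ Icc 0 T) : flow H t y = γ t := by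
  have h1 := h.mono ht.2
  have hex : ∃ γ, IsFlowLine H t y γ := ⟨γ, h1⟩
  unfold flow
  rw [dif_pos hex]
  exact hex.choose_spec.eqOn hH h1 ⟨ht.1, le_rfl⟩

/-- Concatenation of integral curves. -/
theorem IsFlowLine.append {s t : ℝ} (hs : 0 ≤ s) (ht : 0 ≤ t) {y : PhaseSpace E G}
    {γ γ' : ℝ → PhaseSpace E G} (h : IsFlowLine H s y γ) (h' : IsFlowLine H t (γ s) γ') :
    IsFlowLine H (s + t) y (fun τ => if τ ≤ s then γ τ else γ' (τ - s)) := by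
  refine ⟨by simp [hs, h.1], ?_⟩
  set δ : ℝ → PhaseSpace E G := fun τ => if τ ≤ s then γ τ else γ' (τ - s)
  have e1 : EqOn δ γ (Icc 0 s) := fun τ hτ => if_pos hτ.2
  have e2 : EqOn δ (fun τ => γ' (τ - s)) (Icc s (s + t)) := fun τ hτ => by
    by_cases hτs : τ ≤ s
    · obtain rfl := le_antisymm hτs hτ.1
      simp [δ, h'.1]
    · exact if_neg hτs
  have h2 : IsMIntegralCurveOn (I := phaseModel E) (fun τ => γ' (τ - s)) (contactField H)
      (Icc s (s + t)) := by
    have := h'.2.comp_add (-s)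
    refine IsMIntegralCurveOn.mono this ?_
    intro τ hτ
    exact ⟨by linarith [hτ.1], by linarith [hτ.2]⟩
  have d1 : ∀ τ ∈ Icc 0 s, HasMFDerivWithinAt 𝓘(ℝ, ℝ) (phaseModel E) δ (Icc 0 s) τ
      ((1 : ℝ →L[ℝ] ℝ).smulRight (contactField H (δ τ))) := fun τ hτ => by
    rw [e1 hτ]
    exact (h.2 τ hτ).congr_of_eventuallyEq (eventually_of_mem self_mem_nhdsWithin e1) (e1 hτ)
  have d2 : ∀ τ ∈ Icc s (s + t), HasMFDerivWithinAt 𝓘(ℝ, ℝ) (phaseModel E) δ (Icc s (s + t)) τ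
      ((1 : ℝ →L[ℝ] ℝ).smulRight (contactField H (δ τ))) := fun τ hτ => by
    rw [e2 hτ]
    exact (h2 τ hτ).congr_of_eventuallyEq (eventually_of_mem self_mem_nhdsWithin e2) (e2 hτ)
  intro τ hτ
  rcases lt_trichotomy τ s with hlt | rfl | hgt
  · refine (d1 τ ⟨hτ.1, hlt.le⟩).mono_of_mem_nhdsWithin ?_
    filter_upwards [self_mem_nhdsWithin, mem_nhdsWithin_of_mem_nhds (Iio_mem_nhds hlt)] with σ h1 h2
    exact ⟨h1.1, (mem_Iio.1 h2).le⟩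
  · have hu := (d1 τ ⟨hs, le_rfl⟩).union (d2 τ ⟨le_rfl, by linarith⟩)
    rwa [Icc_union_Icc_eq_Icc hs (by linarith)] at hu
  · refine (d2 τ ⟨hgt.le, hτ.2⟩).mono_of_mem_nhdsWithin ?_
    filter_upwards [self_mem_nhdsWithin, mem_nhdsWithin_of_mem_nhds (Ioi_mem_nhds hgt)] with σ h1 h2
    exact ⟨(mem_Ioi.1 h2).le, h1.2⟩

theorem isFlowLine_flow [T2Space G] (hH : ContMDiff (phaseModel E) 𝓘(ℝ, ℝ) ∞ H) {T : ℝ}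
    (hT : 0 ≤ T) {y : PhaseSpace E G} (hy : y ∈ flowDomain H T) :
    IsFlowLine H T y (fun t => flow H t y) := by
  obtain ⟨γ, hγ⟩ := hy
  have e : EqOn (fun t => flow H t y) γ (Icc 0 T) := fun t ht => flow_eq hH hγ ht
  refine ⟨(e ⟨le_rfl, hT⟩).trans hγ.1, fun t ht => ?_⟩
  rw [e ht]
  exact (hγ.2 t ht).congr_of_eventuallyEq (eventually_of_mem self_mem_nhdsWithin e) (e ht)

/-- The semigroup property of the flow. -/
theorem flow_add [T2Space G] (hH : ContMDiff (phaseModel E) 𝓘(ℝ, ℝ) ∞ H) {s t : ℝ}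
    (hs : 0 ≤ s) (ht : 0 ≤ t) {y : PhaseSpace E G} (hy : y ∈ flowDomain H s)
    (hy' : flow H s y ∈ flowDomain H t) :
    y ∈ flowDomain H (s + t) ∧ ∀ τ ∈ Icc 0 t, flow H (s + τ) y = flow H τ (flow H s y) := by
  obtain ⟨γ, hγ⟩ := hy
  have e : flow H s y = γ s := flow_eq hH hγ ⟨hs, le_rfl⟩
  obtain ⟨γ', hγ'⟩ := hy'
  have h := hγ.append hs ht (e ▸ hγ')
  refine ⟨⟨_, h⟩, fun τ hτ => ?_⟩
  rw [flow_eq hH h (t := s + τ) ⟨by linarith [hτ.1], by linarith [hτ.2]⟩, flow_eq hH hγ' hτ]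
  by_cases h0 : s + τ ≤ s
  · have : τ = 0 := le_antisymm (by linarith) hτ.1
    subst this
    simp [hγ'.1, e]
  · simp [h0]

/-! ### Local flows of the contact Hamiltonian vector field -/

theorem exists_isLocalFlow_localField (hH : ContMDiff (phaseModel E) 𝓘(ℝ, ℝ) ∞ H) {c : G}
    {u₀ : LocalPhase E} (hu₀ : u₀ ∈ phaseTarget (G := G) c) :
    ∃ r > 0, ∃ ε > 0, ∃ Φ D,
      IsLocalFlow (localField H c) (Metric.ball u₀ r) (phaseTarget (G := G) c) ε Φ D := by
  have : CompleteSpace E := FiniteDimensional.complete ℝ E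
  exact exists_isLocalFlow
    ((contDiffAt_localField hH hu₀).of_le (WithTop.coe_le_coe.2 (le_top : (2 : ℕ∞) ≤ ⊤)))
    ((isOpen_phaseTarget c).mem_nhds hu₀)

variable {c : G} {B : Set (LocalPhase E)} {ε : ℝ} {Φ : LocalPhase E → ℝ → LocalPhase E}
  {D : LocalPhase E → ℝ → LocalPhase E →L[ℝ] LocalPhase E}

theorem IsLocalFlow.isFlowLine (h : IsLocalFlow (localField H c) B (phaseTarget (G := G) c) ε Φ D)
    {u : LocalPhase E} (hu : u ∈ B) :
    IsFlowLine H ε (phaseSymm c u) (fun τ => phaseSymm c (Φ u τ)) := by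
  refine ⟨by simp only [h.apply_zero u hu], fun t ht => ?_⟩
  have ht' : t ∈ Icc (-ε) ε := ⟨by linarith [ht.1, ht.2], ht.2⟩
  exact hasMFDerivWithinAt_phaseSymm_comp (h.hasDerivAt u hu t ht').hasDerivWithinAt
    (h.mem u hu t ht')

theorem IsLocalFlow.flow_eq [T2Space G] (hH : ContMDiff (phaseModel E) 𝓘(ℝ, ℝ) ∞ H)
    (h : IsLocalFlow (localField H c) B (phaseTarget (G := G) c) ε Φ D)
    {u : LocalPhase E} (hu : u ∈ B) {t : ℝ} (ht : t ∈ Icc 0 ε) :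
    phaseSymm c u ∈ flowDomain H t ∧ flow H t (phaseSymm c u) = phaseSymm c (Φ u t) :=
  ⟨⟨_, (h.isFlowLine hu).mono ht.2⟩, ContactLie.flow_eq hH (h.isFlowLine hu) ht⟩

theorem hasMFDerivAt_phaseSymm {u : LocalPhase E} (hu : u ∈ phaseTarget (G := G) c) :
    HasMFDerivAt 𝓘(ℝ, LocalPhase E) (phaseModel E) (phaseSymm (G := G) c) u
      ((chartSymmDeriv (E := E) c u.1).prodMap (ContinuousLinearMap.id ℝ ((E →L[ℝ] ℝ) × ℝ))) := by
  have h1 := (hasMFDerivAt_chart_symm hu).comp u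
    (ContinuousLinearMap.fst ℝ E ((E →L[ℝ] ℝ) × ℝ)).hasMFDerivAt
  have h2 := ((ContinuousLinearMap.fst ℝ (E →L[ℝ] ℝ) ℝ).comp
    (ContinuousLinearMap.snd ℝ E ((E →L[ℝ] ℝ) × ℝ))).hasMFDerivAt (x := u)
  have h3 := ((ContinuousLinearMap.snd ℝ (E →L[ℝ] ℝ) ℝ).comp
    (ContinuousLinearMap.snd ℝ E ((E →L[ℝ] ℝ) × ℝ))).hasMFDerivAt (x := u)
  exact h1.prodMk (h2.prodMk h3)

theorem contactForm_phaseSymm {u : LocalPhase E} (hu : u ∈ phaseTarget (G := G) c)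
    (w : LocalPhase E) : contactForm (phaseSymm (G := G) c u)
      (mfderiv 𝓘(ℝ, LocalPhase E) (phaseModel E) (phaseSymm (G := G) c) u w) =
        localForm c u w := by
  rw [(hasMFDerivAt_phaseSymm hu).mfderiv]
  rfl

theorem mfderiv_phaseSymm_phaseChart {y : PhaseSpace E G} (hy : y ∈ phaseSource c)
    (v : E × (E →L[ℝ] ℝ) × ℝ) :
    mfderiv 𝓘(ℝ, LocalPhase E) (phaseModel E) (phaseSymm (G := G) c) (phaseChart c y)
      (mfderiv (phaseModel E) 𝓘(ℝ, LocalPhase E) (phaseChart c) y v) = v := by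
  have h1 := ((contMDiffAt_phaseSymm (phaseChart_mem hy)).mdifferentiableAt
    (by simp)).hasMFDerivAt
  have h2 := ((contMDiffAt_phaseChart hy).mdifferentiableAt (by simp)).hasMFDerivAt
  have h3 := h1.comp y h2
  have h4 : HasMFDerivAt (phaseModel E) (phaseModel E) (phaseSymm c ∘ phaseChart c) y
      (ContinuousLinearMap.id ℝ (E × (E →L[ℝ] ℝ) × ℝ)) :=
    (hasMFDerivAt_id y).congr_of_eventuallyEq (by
      filter_upwards [(isOpen_phaseSource c).mem_nhds hy] with z hz
      exact phaseSymm_phaseChart hz)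
  exact congrArg (fun T : (E × (E →L[ℝ] ℝ) × ℝ) →L[ℝ] (E × (E →L[ℝ] ℝ) × ℝ) => T v)
    (hasMFDerivAt_unique h3 h4)

variable (H) in
/-- The flow of `X_H` is defined near `y` up to time `t`, it is differentiable at `y`, and it is a
conformal contactomorphism there. -/
structure IsConformalAt (t : ℝ) (y : PhaseSpace E G) : Prop where
  mem_nhds : flowDomain H t ∈ 𝓝 y
  mdifferentiableAt : MDifferentiableAt (phaseModel E) (phaseModel E) (flow H t) y
  contactForm_mfderiv : ∀ v : E × (E →L[ℝ] ℝ) × ℝ,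
    contactForm (flow H t y) (mfderiv (phaseModel E) (phaseModel E) (flow H t) y v) =
      Real.exp (-∫ τ in (0 : ℝ)..t, hamCost H (flow H τ y)) * contactForm y v

theorem IsLocalFlow.isConformalAt [T2Space G] (hH : ContMDiff (phaseModel E) 𝓘(ℝ, ℝ) ∞ H)
    (h : IsLocalFlow (localField H c) B (phaseTarget (G := G) c) ε Φ D) (hB : IsOpen B)
    {y : PhaseSpace E G} (hy : y ∈ phaseSource c) (hyB : phaseChart c y ∈ B) {t : ℝ}
    (ht : t ∈ Icc 0 ε) : IsConformalAt H t y := by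
  set u := phaseChart c y
  have hε : 0 ≤ ε := ht.1.trans ht.2
  have ht' : t ∈ Icc (-ε) ε := ⟨by linarith [ht.1], ht.2⟩
  have hyu : phaseSymm c u = y := phaseSymm_phaseChart hy
  have hN : {z | z ∈ phaseSource c ∧ phaseChart c z ∈ B} ∈ 𝓝 y :=
    inter_mem ((isOpen_phaseSource c).mem_nhds hy)
      (continuousAt_phaseChart hy (hB.mem_nhds hyB))
  have hev : flow H t =ᶠ[𝓝 y] fun z => phaseSymm c (Φ (phaseChart c z) t) := by
    filter_upwards [hN] with z hz
    have := (h.flow_eq hH hz.2 ht).2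
    rwa [phaseSymm_phaseChart hz.1] at this
  have hΦu : Φ u t ∈ phaseTarget (G := G) c := h.mem u hyB t ht'
  have h1 := ((contMDiffAt_phaseChart hy).mdifferentiableAt (by simp)).hasMFDerivAt
  have h2 : HasMFDerivAt 𝓘(ℝ, LocalPhase E) 𝓘(ℝ, LocalPhase E) (fun u => Φ u t) u (D u t) :=
    (h.hasFDerivAt u hyB t ht).hasMFDerivAt
  have h3 := ((contMDiffAt_phaseSymm hΦu).mdifferentiableAt (by simp)).hasMFDerivAt
  have h4 := (h3.comp y (HasMFDerivAt.comp y h2 h1)).congr_of_eventuallyEq hev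
  refine ⟨?_, h4.mdifferentiableAt, fun v => ?_⟩
  · filter_upwards [hN] with z hz
    have := (h.flow_eq hH hz.2 ht).1
    rwa [phaseSymm_phaseChart hz.1] at this
  · set w : LocalPhase E := mfderiv (phaseModel E) 𝓘(ℝ, LocalPhase E) (phaseChart c) y v with hw
    have e1 : mfderiv (phaseModel E) (phaseModel E) (flow H t) y v =
        mfderiv 𝓘(ℝ, LocalPhase E) (phaseModel E) (phaseSymm (G := G) c) (Φ u t) (D u t w) :=
      congrArg (fun T : (E × (E →L[ℝ] ℝ) × ℝ) →L[ℝ] (E × (E →L[ℝ] ℝ) × ℝ) => T v) h4.mfderiv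
    have e2 : flow H t y = phaseSymm c (Φ u t) := hev.self_of_nhds
    have e3 : contactForm y v = localForm c u w := by
      have := contactForm_phaseSymm (G := G) (phaseChart_mem hy) w
      rwa [mfderiv_phaseSymm_phaseChart hy, hyu] at this
    rw [e1, e2, contactForm_phaseSymm hΦu, e3]
    have key := eq_exp_neg_integral_mul (g := fun τ => hamCost H (phaseSymm c (Φ u τ)))
      (q := fun τ => localForm c (Φ u τ) (D u τ w)) (ε := ε) (t := t)
      (fun τ hτ => by
        refine ContinuousAt.continuousWithinAt ?_
        exact ContinuousAt.comp (g := fun u => hamCost H (phaseSymm c u))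
          (differentiableAt_hamCost hH (h.mem u hyB τ hτ)).continuousAt
          (h.hasDerivAt u hyB τ hτ).continuousAt)
      (fun τ hτ => by
        have hτ' : τ ∈ Icc (-ε) ε := ⟨by linarith [hτ.1], hτ.2⟩
        refine hasDerivAt_localForm hH (h.mem u hyB τ hτ') (h.hasDerivAt u hyB τ hτ') ?_
        exact (ContinuousLinearMap.apply ℝ (LocalPhase E) w).hasFDerivAt.comp_hasDerivAt τ
          (h.hasDerivAt_deriv u hyB τ hτ')) ht
    simp only [h.apply_zero u hyB, h.deriv_zero u hyB, ContinuousLinearMap.id_apply] at key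
    rw [key]
    congr 3
    refine intervalIntegral.integral_congr fun τ hτ => ?_
    rw [uIcc_of_le ht.1] at hτ
    have := (h.flow_eq hH hyB (t := τ) ⟨hτ.1, hτ.2.trans ht.2⟩).2
    rw [hyu] at this
    simp only [this]

/-- Conformality for small times, uniformly near a point. -/
theorem eventually_isConformalAt [T2Space G] (hH : ContMDiff (phaseModel E) 𝓘(ℝ, ℝ) ∞ H)
    (y₀ : PhaseSpace E G) :
    ∃ ε > 0, ∀ᶠ y in 𝓝 y₀, ∀ t ∈ Icc 0 ε, IsConformalAt H t y := by
  have hy₀ : y₀ ∈ phaseSource y₀.1 := mem_extChartAt_source y₀.1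
  obtain ⟨r, hr, ε, hε, Φ, D, h⟩ := exists_isLocalFlow_localField hH (phaseChart_mem hy₀)
  refine ⟨ε, hε, ?_⟩
  filter_upwards [(isOpen_phaseSource y₀.1).mem_nhds hy₀,
    continuousAt_phaseChart hy₀ (Metric.ball_mem_nhds _ hr)] with y hy hyB t ht
  exact h.isConformalAt hH Metric.isOpen_ball hy hyB ht

theorem IsConformalAt.mem {t : ℝ} {y : PhaseSpace E G} (h : IsConformalAt H t y) :
    y ∈ flowDomain H t := mem_of_mem_nhds h.mem_nhds

/-- The conformal factors multiply along the semigroup property of the flow. -/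
theorem IsConformalAt.add [T2Space G] (hH : ContMDiff (phaseModel E) 𝓘(ℝ, ℝ) ∞ H) {s t : ℝ}
    (hs : 0 ≤ s) (ht : 0 ≤ t) {y : PhaseSpace E G} (h : IsConformalAt H s y)
    (h' : IsConformalAt H t (flow H s y)) : IsConformalAt H (s + t) y := by
  have hev : ∀ᶠ z in 𝓝 y, z ∈ flowDomain H s ∧ flow H s z ∈ flowDomain H t :=
    (show ∀ᶠ z in 𝓝 y, z ∈ flowDomain H s from h.mem_nhds).and
      (h.mdifferentiableAt.continuousAt h'.mem_nhds)
  have hflow : flow H (s + t) =ᶠ[𝓝 y] flow H t ∘ flow H s := by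
    filter_upwards [hev] with z hz
    exact (flow_add hH hs ht hz.1 hz.2).2 t ⟨ht, le_rfl⟩
  have hd := (h'.mdifferentiableAt.hasMFDerivAt.comp y
    h.mdifferentiableAt.hasMFDerivAt).congr_of_eventuallyEq hflow
  refine ⟨?_, hd.mdifferentiableAt, fun v => ?_⟩
  · filter_upwards [hev] with z hz
    exact (flow_add hH hs ht hz.1 hz.2).1
  · obtain ⟨hdom, hadd⟩ := flow_add hH hs ht h.mem h'.mem
    set w : E × (E →L[ℝ] ℝ) × ℝ := mfderiv (phaseModel E) (phaseModel E) (flow H s) y v with hw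
    have e1 : mfderiv (phaseModel E) (phaseModel E) (flow H (s + t)) y v =
        mfderiv (phaseModel E) (phaseModel E) (flow H t) (flow H s y) w :=
      congrArg (fun T : (E × (E →L[ℝ] ℝ) × ℝ) →L[ℝ] (E × (E →L[ℝ] ℝ) × ℝ) => T v) hd.mfderiv
    have e2 : flow H (s + t) y = flow H t (flow H s y) := hflow.self_of_nhds
    rw [e1, e2, h'.contactForm_mfderiv, h.contactForm_mfderiv, ← mul_assoc, ← Real.exp_add]
    congr 2
    have hcont : ContinuousOn (fun τ => hamCost H (flow H τ y)) (Icc 0 (s + t)) :=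
      (continuous_hamCost hH).comp_continuousOn
        (isFlowLine_flow hH (by linarith) hdom).continuousOn
    have i1 : IntervalIntegrable (fun τ => hamCost H (flow H τ y)) MeasureTheory.volume 0 s :=
      (hcont.mono (by rw [uIcc_of_le hs]; exact Icc_subset_Icc_right (by linarith))
        ).intervalIntegrable
    have i2 : IntervalIntegrable (fun τ => hamCost H (flow H τ y)) MeasureTheory.volume s (s + t) :=
      (hcont.mono (by rw [uIcc_of_le (by linarith)]; exact Icc_subset_Icc_left hs)
        ).intervalIntegrable
    rw [← intervalIntegral.integral_add_adjacent_intervals i1 i2]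
    have e3 : ∫ τ in s..s + t, hamCost H (flow H τ y) =
        ∫ τ in (0 : ℝ)..t, hamCost H (flow H τ (flow H s y)) := by
      have := intervalIntegral.integral_comp_add_left (a := 0) (b := t)
        (fun τ => hamCost H (flow H τ y)) s
      rw [add_zero] at this
      rw [← this]
      refine intervalIntegral.integral_congr fun τ hτ => ?_
      rw [uIcc_of_le ht] at hτ
      simp only [hadd τ hτ]
    rw [e3]
    ring

/-- `(Φ_H^t)^* θ = exp (-∫₀ᵗ (∂H/∂z) ∘ Φ_H^τ dτ) θ` on the (open) domain of the flow: the statement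
for small times propagates along the compact integral curve by the semigroup property. -/
theorem isConformalAt_of_mem [T2Space G] (hH : ContMDiff (phaseModel E) 𝓘(ℝ, ℝ) ∞ H) {T : ℝ}
    (hT : 0 ≤ T) {y : PhaseSpace E G} (hy : y ∈ flowDomain H T) : IsConformalAt H T y := by
  have hfl := isFlowLine_flow hH hT hy
  obtain ⟨ε, hε, hunif⟩ : ∃ ε > 0, ∀ z ∈ (fun t => flow H t y) '' Icc 0 T,
      ∀ t ∈ Icc 0 ε, IsConformalAt H t z := by
    refine (isCompact_Icc.image_of_continuousOn hfl.continuousOn).induction_on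
      (p := fun s => ∃ ε > 0, ∀ z ∈ s, ∀ t ∈ Icc 0 ε, IsConformalAt H t z) ?_ ?_ ?_ ?_
    · exact ⟨1, one_pos, fun z hz => hz.elim⟩
    · rintro s t hst ⟨ε, hε, h⟩
      exact ⟨ε, hε, fun z hz => h z (hst hz)⟩
    · rintro s t ⟨ε, hε, h⟩ ⟨ε', hε', h'⟩
      refine ⟨min ε ε', lt_min hε hε', ?_⟩
      rintro z (hz | hz) τ hτ
      · exact h z hz τ ⟨hτ.1, hτ.2.trans (min_le_left _ _)⟩
      · exact h' z hz τ ⟨hτ.1, hτ.2.trans (min_le_right _ _)⟩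
    · intro z _
      obtain ⟨ε, hε, h⟩ := eventually_isConformalAt hH z
      exact ⟨_, mem_nhdsWithin_of_mem_nhds h, ε, hε, fun w hw => hw⟩
  have hn : ∀ n : ℕ, ∀ t ∈ Icc 0 T, t ≤ n * ε → IsConformalAt H t y := by
    intro n
    induction n with
    | zero =>
      intro t ht htn
      have h0 : t = 0 := le_antisymm (by simpa using htn) ht.1
      subst h0
      have := hunif y ⟨0, ⟨le_rfl, hT⟩, hfl.1⟩ 0 ⟨le_rfl, hε.le⟩
      exact this
    | succ n ih =>
      intro t ht htn
      by_cases hle : t ≤ ε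
      · exact hunif y ⟨0, ⟨le_rfl, hT⟩, hfl.1⟩ t ⟨ht.1, hle⟩
      · push Not at hle
        have h1 := ih (t - ε) ⟨by linarith, by linarith [ht.2]⟩ (by push_cast at htn; linarith)
        have h2 := hunif (flow H (t - ε) y) ⟨t - ε, ⟨by linarith, by linarith [ht.2]⟩, rfl⟩ ε
          ⟨hε.le, le_rfl⟩
        have := h1.add hH (by linarith) hε.le h2
        rwa [sub_add_cancel] at this
  obtain ⟨n, hn'⟩ := exists_nat_ge (T / ε)
  exact hn n T ⟨hT, le_rfl⟩ (by rwa [div_le_iff₀ hε] at hn')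

end Flow

/-! ### The conformal factor for short times -/

/-- `exp (-∫₀ʰ g) = 1 - h g(0) + O(h²)` if `g` is Lipschitz at `0`. -/
theorem exp_neg_integral_sub_isBigO {g : ℝ → ℝ} {C δ : ℝ} (hδ : 0 < δ) (hC : 0 ≤ C)
    (hg : ∀ τ ∈ Icc 0 δ, |g τ - g 0| ≤ C * τ) (hc : ContinuousOn g (Icc 0 δ)) :
    (fun h => Real.exp (-∫ τ in (0 : ℝ)..h, g τ) - 1 + h * g 0) =O[𝓝[>] 0] fun h : ℝ => h ^ 2 := by
  set M := |g 0| + C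
  have hM : 0 ≤ M := by positivity
  refine Asymptotics.IsBigO.of_bound (M ^ 2 + C) ?_
  have hpos : 0 < min δ (min 1 (1 / (M + 1))) :=
    lt_min hδ (lt_min one_pos (by positivity))
  filter_upwards [Ioo_mem_nhdsGT hpos] with h hh
  have h0 : 0 < h := hh.1
  have hhδ : h < δ := hh.2.trans_le (min_le_left _ _)
  have hh1 : h < 1 := hh.2.trans_le ((min_le_right _ _).trans (min_le_left _ _))
  have hhM : h < 1 / (M + 1) := hh.2.trans_le ((min_le_right _ _).trans (min_le_right _ _))
  set I := ∫ τ in (0 : ℝ)..h, g τ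
  have hI : |I - h * g 0| ≤ C * h ^ 2 := by
    have hi : IntervalIntegrable g MeasureTheory.volume 0 h :=
      (hc.mono (by rw [uIcc_of_le h0.le]; exact Icc_subset_Icc_right hhδ.le)).intervalIntegrable
    have e : I - h * g 0 = ∫ τ in (0 : ℝ)..h, (g τ - g 0) := by
      rw [intervalIntegral.integral_sub hi intervalIntegrable_const,
        intervalIntegral.integral_const, sub_zero, smul_eq_mul]
    rw [e, ← Real.norm_eq_abs]
    have := intervalIntegral.norm_integral_le_of_norm_le_const (a := 0) (b := h)
      (f := fun τ => g τ - g 0) (C := C * h) (fun τ hτ => by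
        rw [uIoc_of_le h0.le] at hτ
        refine (hg τ ⟨hτ.1.le, hτ.2.trans hhδ.le⟩).trans ?_
        gcongr
        exact hτ.2)
    rw [sub_zero, abs_of_pos h0] at this
    calc _ ≤ _ := this
      _ = _ := by ring
  have hIM : |I| ≤ M * h := by
    have h1 : |h * g 0| = |g 0| * h := by rw [abs_mul, abs_of_pos h0, mul_comm]
    have h2 := abs_add_le (I - h * g 0) (h * g 0)
    rw [sub_add_cancel, h1] at h2
    have h3 : C * h ^ 2 ≤ C * h := by
      have : h ^ 2 ≤ h := by nlinarith
      gcongr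
    calc |I| ≤ C * h + |g 0| * h := by linarith
      _ = M * h := by ring
  have hI1 : |-I| ≤ 1 := by
    rw [abs_neg]
    refine hIM.trans ?_
    have : (M + 1) * h ≤ 1 := by
      have := hhM.le
      rwa [le_div_iff₀ (by positivity), mul_comm] at this
    linarith
  have hexp := Real.abs_exp_sub_one_sub_id_le hI1
  have e : Real.exp (-I) - 1 + h * g 0 = (Real.exp (-I) - 1 - (-I)) - (I - h * g 0) := by ring
  rw [Real.norm_eq_abs, Real.norm_of_nonneg (by positivity : 0 ≤ h ^ 2), e]
  have hI2 : (-I) ^ 2 ≤ M ^ 2 * h ^ 2 := by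
    rw [neg_sq, ← sq_abs, ← mul_pow]
    gcongr
  calc _ ≤ _ := abs_sub _ _
    _ ≤ M ^ 2 * h ^ 2 + C * h ^ 2 := add_le_add (hexp.trans hI2) hI
    _ = _ := by ring

section Flow

variable {E G : Type*} [NormedAddCommGroup E] [NormedSpace ℝ E] [FiniteDimensional ℝ E]
  [TopologicalSpace G] [ChartedSpace E G] [Group G] [LieGroup 𝓘(ℝ, E) ∞ G] [T2Space G]
  {H : PhaseSpace E G → ℝ}

/-- The conformal factor of the flow for small times. -/
theorem exists_conformal_factor_expansion (hH : ContMDiff (phaseModel E) 𝓘(ℝ, ℝ) ∞ H)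
    (y : PhaseSpace E G) :
    ∃ r : ℝ → ℝ, r =O[𝓝[>] 0] (fun h => h ^ 2) ∧ ∀ᶠ h in 𝓝[>] (0 : ℝ), y ∈ flowDomain H h ∧
      ∀ v : E × (E →L[ℝ] ℝ) × ℝ,
        contactForm (flow H h y) (mfderiv (phaseModel E) (phaseModel E) (flow H h) y v) =
          (1 - h * hamCost H y + r h) * contactForm y v := by
  set c := y.1
  have hy : y ∈ phaseSource c := mem_extChartAt_source c
  obtain ⟨ρ, hρ, ε, hε, Φ, D, hΦ⟩ := exists_isLocalFlow_localField hH (phaseChart_mem hy)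
  set u := phaseChart c y
  have huB : u ∈ Metric.ball u ρ := Metric.mem_ball_self hρ
  have hyu : phaseSymm c u = y := phaseSymm_phaseChart hy
  have hε0 : ∀ τ ∈ Icc 0 ε, τ ∈ Icc (-ε) ε := fun τ hτ => ⟨by linarith [hτ.1], hτ.2⟩
  have hfl : ∀ τ ∈ Icc 0 ε, flow H τ y = phaseSymm c (Φ u τ) := fun τ hτ => by
    have := (hΦ.flow_eq hH huB hτ).2
    rwa [hyu] at this
  have hd : DifferentiableAt ℝ (fun τ => hamCost H (phaseSymm c (Φ u τ))) 0 :=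
    DifferentiableAt.comp (g := fun u => hamCost H (phaseSymm c u)) (0 : ℝ)
      (differentiableAt_hamCost hH (hΦ.mem u huB 0 (hε0 0 ⟨le_rfl, hε.le⟩)))
      (hΦ.hasDerivAt u huB 0 (hε0 0 ⟨le_rfl, hε.le⟩)).differentiableAt
  obtain ⟨C, hC⟩ := hd.hasDerivAt.isBigO_sub.bound
  obtain ⟨δ, hδ, hδs⟩ := Metric.eventually_nhds_iff_ball.1 hC
  have hmin : 0 < min (δ / 2) ε := lt_min (by linarith) hε
  have hbound : ∀ τ ∈ Icc 0 (min (δ / 2) ε),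
      |hamCost H (flow H τ y) - hamCost H (flow H 0 y)| ≤ |C| * τ := fun τ hτ => by
    have hτε : τ ∈ Icc 0 ε := ⟨hτ.1, hτ.2.trans (min_le_right _ _)⟩
    rw [hfl τ hτε, hfl 0 ⟨le_rfl, hε.le⟩]
    have := hδs τ (by
      rw [Metric.mem_ball, Real.dist_eq, sub_zero, abs_of_nonneg hτ.1]
      linarith [hτ.2.trans (min_le_left _ _)])
    rw [Real.norm_eq_abs, Real.norm_eq_abs, sub_zero, abs_of_nonneg hτ.1] at this
    exact this.trans (mul_le_mul_of_nonneg_right (le_abs_self C) hτ.1)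
  have hdom : y ∈ flowDomain H ε := by
    have := (hΦ.flow_eq hH huB (t := ε) ⟨hε.le, le_rfl⟩).1
    rwa [hyu] at this
  have hflow := isFlowLine_flow hH hε.le hdom
  have hcont : ContinuousOn (fun τ => hamCost H (flow H τ y)) (Icc 0 (min (δ / 2) ε)) :=
    (continuous_hamCost hH).comp_continuousOn
      (hflow.continuousOn.mono (Icc_subset_Icc_right (min_le_right _ _)))
  refine ⟨_, exp_neg_integral_sub_isBigO hmin (abs_nonneg C) hbound hcont, ?_⟩
  filter_upwards [Ioo_mem_nhdsGT hε] with h hh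
  have hconf := hΦ.isConformalAt hH Metric.isOpen_ball hy huB (t := h) ⟨hh.1.le, hh.2.le⟩
  refine ⟨hconf.mem, fun v => ?_⟩
  have h0 : flow H 0 y = y := hflow.1
  rw [hconf.contactForm_mfderiv, h0]
  ring

end Flow

/-! ### The Legendre transform -/

section Legendre

variable {E G : Type*} [NormedAddCommGroup E] [NormedSpace ℝ E] [FiniteDimensional ℝ E]
  [TopologicalSpace G] [ChartedSpace E G] [Group G] [LieGroup 𝓘(ℝ, E) ∞ G]
  {L : VelSpace E G → ℝ}

/-- The differential of the Lagrangian in terms of its partial derivatives. -/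
theorem mfderiv_lagrangian (x : VelSpace E G)
    (hL : MDifferentiableAt (velModel E) 𝓘(ℝ, ℝ) L x) (w : E × E × ℝ) :
    (show ℝ from mfderiv (velModel E) 𝓘(ℝ, ℝ) L x w) =
      dBase L x (leftInv x.1 w.1) + dVel L x w.2.1 + dCost L x * w.2.2 := by
  have h1 : MDifferentiableAt ((𝓘(ℝ, E)).prod 𝓘(ℝ, ℝ)) 𝓘(ℝ, ℝ)
      (fun m : E × ℝ => L (x.1, m)) x.2 :=
    MDifferentiableAt.comp (I' := velModel E) x.2 (g := L) (f := fun m => (x.1, m)) hL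
      (mdifferentiableAt_const.prodMk mdifferentiableAt_id)
  have e1 := mfderiv_prod_eq_add_apply (v := w) hL
  have e2 := mfderiv_prod_eq_add_apply (v := w.2) h1
  have e3 : dBase L x (leftInv x.1 w.1) =
      (show E →L[ℝ] ℝ from mfderiv 𝓘(ℝ, E) 𝓘(ℝ, ℝ) (fun g => L (g, x.2)) x.1) w.1 := by
    show (show E →L[ℝ] ℝ from mfderiv 𝓘(ℝ, E) 𝓘(ℝ, ℝ) (fun g => L (g, x.2)) x.1)
      (leftMap x.1 (leftInv x.1 w.1)) = _
    rw [leftMap_leftInv]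
  have e4 : (show E →L[ℝ] ℝ from mfderiv 𝓘(ℝ, E) 𝓘(ℝ, ℝ)
      (fun ξ : E => L (x.1, ξ, x.2.2)) x.2.1) w.2.1 = dVel L x w.2.1 := by
    rw [mfderiv_eq_fderiv]; rfl
  have e5 : (show ℝ →L[ℝ] ℝ from mfderiv 𝓘(ℝ, ℝ) 𝓘(ℝ, ℝ)
      (fun s : ℝ => L (x.1, x.2.1, s)) x.2.2) w.2.2 = dCost L x * w.2.2 := by
    rw [mfderiv_eq_fderiv]
    show fderiv ℝ (fun s : ℝ => L (x.1, x.2.1, s)) x.2.2 w.2.2 = _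
    rw [fderiv_eq_smul_deriv, smul_eq_mul, mul_comm, dCost]
  rw [e3, ← e4, ← e5, add_assoc]
  exact e1.trans (congrArg _ e2)

theorem IsHyperregular.bijective (hreg : IsHyperregular L) : Function.Bijective (legendre L) := by
  obtain ⟨D, hD⟩ := hreg
  have : legendre L = D := (funext hD).symm
  rw [this]
  exact D.bijective

/-- The inverse of the contact Legendre transform, chosen as in the definition of `hamiltonian`; it
is an inverse only for hyperregular `L`. -/
def legendreInv (L : VelSpace E G → ℝ) : PhaseSpace E G → VelSpace E G :=
  Function.invFun (legendre L)

theorem IsHyperregular.legendreInv_legendre (hreg : IsHyperregular L) (x : VelSpace E G) :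
    legendreInv L (legendre L x) = x :=
  Function.leftInverse_invFun hreg.bijective.1 x

theorem IsHyperregular.legendre_legendreInv (hreg : IsHyperregular L) (y : PhaseSpace E G) :
    legendre L (legendreInv L y) = y :=
  Function.rightInverse_invFun hreg.bijective.2 y

theorem IsHyperregular.contMDiff_legendre (hreg : IsHyperregular L) :
    ContMDiff (velModel E) (phaseModel E) ∞ (legendre L) := by
  obtain ⟨D, hD⟩ := hreg
  have : legendre L = D := (funext hD).symm
  rw [this]
  exact D.contMDiff

theorem IsHyperregular.contMDiff_legendreInv (hreg : IsHyperregular L) :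
    ContMDiff (phaseModel E) (velModel E) ∞ (legendreInv L) := by
  have hreg' := hreg
  obtain ⟨D, hD⟩ := hreg
  have : legendreInv L = D.symm := by
    funext y
    refine D.injective ?_
    exact ((hD _).trans (hreg'.legendre_legendreInv y)).trans (D.apply_symm_apply y).symm
  rw [this]
  exact D.symm.contMDiff

theorem IsHyperregular.legendreInv_fst (hreg : IsHyperregular L) (y : PhaseSpace E G) :
    (legendreInv L y).1 = y.1 :=
  congrArg Prod.fst (hreg.legendre_legendreInv y)

theorem IsHyperregular.legendreInv_cost (hreg : IsHyperregular L) (y : PhaseSpace E G) :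
    (legendreInv L y).2.2 = y.2.2 :=
  congrArg (fun y : PhaseSpace E G => y.2.2) (hreg.legendre_legendreInv y)

theorem contMDiff_hamiltonian (hL : ContMDiff (velModel E) 𝓘(ℝ, ℝ) ∞ L)
    (hreg : IsHyperregular L) : ContMDiff (phaseModel E) 𝓘(ℝ, ℝ) ∞ (hamiltonian L) := by
  have h1 : ContMDiff (phaseModel E) 𝓘(ℝ, E) ∞ (fun y => (legendreInv L y).2.1) :=
    contMDiff_fst.comp (contMDiff_snd.comp hreg.contMDiff_legendreInv)
  have h2 : ContMDiff (phaseModel E) 𝓘(ℝ, E →L[ℝ] ℝ) ∞ (fun y : PhaseSpace E G => y.2.1) :=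
    contMDiff_fst.comp contMDiff_snd
  exact (h2.clm_apply h1).sub (hL.comp hreg.contMDiff_legendreInv)

/-- The differential of the Hamiltonian at `𝔽L (g, ξ, z)`; the variation of `ξ` cancels, because
`μ = δL/δξ`. -/
theorem mfderiv_hamiltonian (hL : ContMDiff (velModel E) 𝓘(ℝ, ℝ) ∞ L)
    (hreg : IsHyperregular L) (x : VelSpace E G) (w : E × (E →L[ℝ] ℝ) × ℝ) :
    (show ℝ from mfderiv (phaseModel E) 𝓘(ℝ, ℝ) (hamiltonian L) (legendre L x) w) =
      w.2.1 x.2.1 - dBase L x (leftInv x.1 w.1) - dCost L x * w.2.2 := by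
  set c := x.1
  set y := legendre L x
  have hy : y ∈ phaseSource c := mem_extChartAt_source c
  -- a curve `Y` through `y` with velocity `w`
  let w₀ : LocalPhase E := (chartDeriv c y.1 w.1, w.2)
  let Y : ℝ → PhaseSpace E G := fun t => phaseSymm c (phaseChart c y + t • w₀)
  have hY0 : Y 0 = y := by
    simp only [Y, zero_smul, add_zero]
    exact phaseSymm_phaseChart hy
  have hline : HasDerivWithinAt (fun t : ℝ => phaseChart c y + t • w₀) w₀ univ 0 := by
    have := ((hasDerivAt_id (0 : ℝ)).smul_const w₀).const_add (phaseChart c y)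
    rw [one_smul] at this
    exact this.hasDerivWithinAt
  have hYd : HasMFDerivWithinAt 𝓘(ℝ, ℝ) (phaseModel E) Y univ 0
      (velocity (V := E × (E →L[ℝ] ℝ) × ℝ) w) := by
    have h1 := hasMFDerivWithinAt_chart_symm_comp (G := G) (c := c) hline.fst (by
      simp only [zero_smul, add_zero]; exact phaseChart_mem hy)
    have e : chartSymmDeriv c (phaseChart c y + (0 : ℝ) • w₀).1 w₀.1 = w.1 := by
      rw [zero_smul, add_zero]
      exact chartSymmDeriv_chartDeriv hy w.1
    rw [e] at h1
    exact hasMFDerivWithinAt_prod_iff.2 ⟨h1, hline.snd.fst, hline.snd.snd⟩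
  -- its image `X` under the inverse Legendre transform, with velocity `v`
  have hx : legendreInv L (Y 0) = x := by rw [hY0, hreg.legendreInv_legendre]
  obtain ⟨v, hXd⟩ : ∃ v : E × E × ℝ, HasMFDerivWithinAt 𝓘(ℝ, ℝ) (velModel E)
      (fun t => legendreInv L (Y t)) univ 0 (velocity (V := E × E × ℝ) v) :=
    ⟨_, hasMFDerivWithinAt_comp_velocity (E₁ := E × (E →L[ℝ] ℝ) × ℝ) (E₂ := E × E × ℝ)
      ((hreg.contMDiff_legendreInv.mdifferentiableAt (by simp)).hasMFDerivAt) hYd⟩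
  obtain ⟨hY1, hY2, hY3⟩ := hasMFDerivWithinAt_prod_iff.1 hYd
  obtain ⟨hX1, hX2, hX3⟩ := hasMFDerivWithinAt_prod_iff.1 hXd
  have hv1 : v.1 = w.1 := by
    have e : (fun t => (legendreInv L (Y t)).1) = fun t => (Y t).1 :=
      funext fun t => hreg.legendreInv_fst _
    rw [e] at hX1
    have hX0 : (legendreInv L (Y 0)).1 = (Y 0).1 := hreg.legendreInv_fst _
    have := hasMFDerivAt_unique (hasMFDerivWithinAt_univ.1 hX1) (hasMFDerivWithinAt_univ.1 hY1)
    have h2 := congrArg (fun T : ℝ →L[ℝ] E => T 1) this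
    simpa using h2
  have hv3 : v.2.2 = w.2.2 := by
    have e : (fun t => (legendreInv L (Y t)).2.2) = fun t => (Y t).2.2 :=
      funext fun t => hreg.legendreInv_cost _
    rw [e] at hX3
    exact (hX3.hasDerivAt univ_mem).unique (hY3.hasDerivAt univ_mem)
  have hLd := hasMFDerivWithinAt_iff_hasDerivWithinAt.1 (hasMFDerivWithinAt_comp_velocity
    (E₁ := E × E × ℝ) (E₂ := ℝ) ((hL.mdifferentiableAt (by simp)).hasMFDerivAt) hXd)
  have hHd := hasMFDerivWithinAt_iff_hasDerivWithinAt.1 (hasMFDerivWithinAt_comp_velocity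
    (E₁ := E × (E →L[ℝ] ℝ) × ℝ) (E₂ := ℝ)
    (((contMDiff_hamiltonian hL hreg).mdifferentiableAt (by simp)).hasMFDerivAt) hYd)
  have hH2 := (hY2.clm_apply hX2).sub hLd
  have huniq := (hHd.hasDerivAt univ_mem).unique (hH2.hasDerivAt univ_mem)
  have hLv := mfderiv_lagrangian x (hL.mdifferentiableAt (by simp)) v
  rw [hx, hY0] at huniq
  refine (Eq.trans huniq ?_)
  rw [hv1, hv3] at hLv
  refine (congrArg (fun r : ℝ => w.2.1 x.2.1 + y.2.1 v.2.1 - r) hLv).trans ?_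
  show w.2.1 x.2.1 + dVel L x v.2.1 - _ = _
  ring

theorem partials_hamiltonian (hL : ContMDiff (velModel E) 𝓘(ℝ, ℝ) ∞ L)
    (hreg : IsHyperregular L) (x : VelSpace E G) :
    dMomentum (hamiltonian L) (legendre L x) = x.2.1 ∧
      hamBase (hamiltonian L) (legendre L x) = -dBase L x ∧
      hamCost (hamiltonian L) (legendre L x) = -dCost L x := by
  have key : ∀ w : E × (E →L[ℝ] ℝ) × ℝ, _ := fun w =>
    (mfderiv_eq_partials (hamiltonian L) (legendre L x)
      ((contMDiff_hamiltonian hL hreg).mdifferentiableAt (by simp)) w).symm.trans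
      (mfderiv_hamiltonian hL hreg x w)
  refine ⟨?_, ?_, ?_⟩
  · by_contra hne
    obtain ⟨f, hf⟩ := SeparatingDual.exists_separating_of_ne (R := ℝ) hne
    exact hf (by simpa using key (0, f, 0))
  · ext η
    have := key (leftMap x.1 η, 0, 0)
    have e : leftInv (legendre L x).1 (leftMap x.1 η) = η := leftInv_leftMap x.1 η
    simp only [e, leftInv_leftMap] at this
    simpa using this
  · simpa using key (0, 0, 1)

/-- In terms of the Lagrangian, `X_H` at `𝔽L (g, ξ, z)` is the right-hand side of the
Euler-Poincare-Herglotz equations. -/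
theorem contactField_legendre (hL : ContMDiff (velModel E) 𝓘(ℝ, ℝ) ∞ L)
    (hreg : IsHyperregular L) (x : VelSpace E G) :
    contactField (hamiltonian L) (legendre L x) =
      (show E × (E →L[ℝ] ℝ) × ℝ from (leftMap x.1 x.2.1,
        coadjoint G x.2.1 (dVel L x) + dBase L x + dCost L x • dVel L x, L x)) := by
  obtain ⟨h1, h2, h3⟩ := partials_hamiltonian hL hreg x
  have hH : hamiltonian L (legendre L x) = dVel L x x.2.1 - L x := by
    show (legendre L x).2.1 (legendreInv L (legendre L x)).2.1 -
      L (legendreInv L (legendre L x)) = _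
    rw [hreg.legendreInv_legendre]
    rfl
  unfold contactField
  rw [h1, h2, h3, hH]
  refine Prod.ext rfl (Prod.ext ?_ ?_)
  · show coadjoint G x.2.1 (dVel L x) - -dBase L x - -dCost L x • dVel L x = _
    refine Eq.trans ?_ (show coadjoint G x.2.1 (dVel L x) + dBase L x + dCost L x • dVel L x = _
      from rfl)
    ext η
    simp
  · show dVel L x x.2.1 - (dVel L x x.2.1 - L x) = L x
    ring

/-- The Legendre transform matches the solutions of the Euler-Poincare-Herglotz equations with the
integral curves of `X_H`. -/
theorem isEPHSolution_iff (hL : ContMDiff (velModel E) 𝓘(ℝ, ℝ) ∞ L)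
    (hreg : IsHyperregular L) {s : Set ℝ} {c : ℝ → VelSpace E G} :
    IsEPHSolution L s c ↔ IsMIntegralCurveOn (I := phaseModel E) (fun t => legendre L (c t))
      (contactField (hamiltonian L)) s := by
  refine forall₂_congr fun t _ => ?_
  rw [contactField_legendre hL hreg]
  exact ⟨fun h => hasMFDerivWithinAt_prod_iff.2 ⟨h.1, h.2.2, h.2.1⟩, fun h => by
    obtain ⟨h1, h2, h3⟩ := hasMFDerivWithinAt_prod_iff.1 h
    exact ⟨h1, h3, h2⟩⟩

end Legendre

/-! ### The discrete Herglotz principle and the flow -/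

section Step

variable {E G : Type*} [NormedAddCommGroup E] [NormedSpace ℝ E] [FiniteDimensional ℝ E]
  [TopologicalSpace G] [ChartedSpace E G] [Group G] [LieGroup 𝓘(ℝ, E) ∞ G]
  {L : VelSpace E G → ℝ} {h : ℝ} {U : Set (VelSpace E G)} {d : G × G × ℝ}

theorem IsEPHSolution.isFlowLine (hL : ContMDiff (velModel E) 𝓘(ℝ, ℝ) ∞ L)
    (hreg : IsHyperregular L) {c : ℝ → VelSpace E G} (hc : IsEPHSolution L (Icc 0 h) c) :
    IsFlowLine (hamiltonian L) h (legendre L (c 0)) fun t => legendre L (c t) :=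
  ⟨rfl, (isEPHSolution_iff hL hreg).1 hc⟩

theorem IsFlowLine.isEPHSolution (hL : ContMDiff (velModel E) 𝓘(ℝ, ℝ) ∞ L)
    (hreg : IsHyperregular L) {y : PhaseSpace E G} {γ : ℝ → PhaseSpace E G}
    (hγ : IsFlowLine (hamiltonian L) h y γ) :
    IsEPHSolution L (Icc 0 h) fun t => legendreInv L (γ t) := by
  rw [isEPHSolution_iff hL hreg]
  simp only [hreg.legendre_legendreInv]
  exact hγ.2

theorem IsEPHSolution.eqOn [T2Space G] (hL : ContMDiff (velModel E) 𝓘(ℝ, ℝ) ∞ L)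
    (hreg : IsHyperregular L) {c c' : ℝ → VelSpace E G} (hc : IsEPHSolution L (Icc 0 h) c)
    (hc' : IsEPHSolution L (Icc 0 h) c') (h0 : c 0 = c' 0) : EqOn c c' (Icc 0 h) := fun t ht => by
  have h2 := hc'.isFlowLine hL hreg
  rw [← h0] at h2
  exact hreg.bijective.1
    ((hc.isFlowLine hL hreg).eqOn (contMDiff_hamiltonian hL hreg) h2 ht)

theorem bvpSolution_spec (hd : d ∈ bvpDomain L h U) :
    IsBVPSolution L h U d (bvpSolution L h U d) := by
  have hd' : ∃ c, IsBVPSolution L h U d c := hd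
  rw [bvpSolution, dif_pos hd']
  exact hd'.choose_spec

/-- The initial state `(g₀, μ, z₀)`, in `G × 𝔤* × ℝ`, of the solution with boundary data `d`. -/
def initialPhase (L : VelSpace E G → ℝ) (h : ℝ) (U : Set (VelSpace E G)) (d : G × G × ℝ) :
    PhaseSpace E G :=
  legendre L (bvpSolution L h U d 0)

/-- The final state `(g₁, μ, z₁)`, in `G × 𝔤* × ℝ`, of the solution with boundary data `d`. -/
def finalPhase (L : VelSpace E G → ℝ) (h : ℝ) (U : Set (VelSpace E G)) (d : G × G × ℝ) :
    PhaseSpace E G :=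
  legendre L (bvpSolution L h U d h)

theorem initialPhase_mem (hL : ContMDiff (velModel E) 𝓘(ℝ, ℝ) ∞ L) (hreg : IsHyperregular L)
    (hd : d ∈ bvpDomain L h U) : initialPhase L h U d ∈ flowDomain (hamiltonian L) h :=
  ⟨_, (bvpSolution_spec hd).1.isFlowLine hL hreg⟩

theorem flow_initialPhase [T2Space G] (hL : ContMDiff (velModel E) 𝓘(ℝ, ℝ) ∞ L)
    (hreg : IsHyperregular L) (hh : 0 < h) (hd : d ∈ bvpDomain L h U) :
    flow (hamiltonian L) h (initialPhase L h U d) = finalPhase L h U d :=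
  ContactLie.flow_eq (contMDiff_hamiltonian hL hreg)
    ((bvpSolution_spec hd).1.isFlowLine hL hreg) (right_mem_Icc.2 hh.le)

theorem initialPhase_fst (hd : d ∈ bvpDomain L h U) : (initialPhase L h U d).1 = d.1 :=
  (bvpSolution_spec hd).2.2.1

theorem initialPhase_cost (hd : d ∈ bvpDomain L h U) : (initialPhase L h U d).2.2 = d.2.2 :=
  (bvpSolution_spec hd).2.2.2.1

theorem finalPhase_fst (hd : d ∈ bvpDomain L h U) : (finalPhase L h U d).1 = d.2.1 :=
  (bvpSolution_spec hd).2.2.2.2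

theorem IsEPHSolution.integral_eq (hL : ContMDiff (velModel E) 𝓘(ℝ, ℝ) ∞ L)
    (hreg : IsHyperregular L) (hh : 0 < h) {c : ℝ → VelSpace E G}
    (hc : IsEPHSolution L (Icc 0 h) c) :
    ∫ t in (0 : ℝ)..h, L (c t) = (c h).2.2 - (c 0).2.2 := by
  have hcont : ContinuousOn c (Icc 0 h) := by
    have := hreg.contMDiff_legendreInv.continuous.comp_continuousOn
      (hc.isFlowLine hL hreg).continuousOn
    simpa only [Function.comp_def, hreg.legendreInv_legendre] using this
  refine intervalIntegral.integral_eq_sub_of_hasDerivAt_of_le hh.le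
    (f := fun t => (c t).2.2) ?_ (fun t ht => ?_) ?_
  · exact (continuous_snd.comp continuous_snd).comp_continuousOn hcont
  · exact (hc t (Ioo_subset_Icc_self ht)).2.1.hasDerivAt (Icc_mem_nhds ht.1 ht.2)
  · refine ContinuousOn.intervalIntegrable ?_
    rw [uIcc_of_le hh.le]
    exact hL.continuous.comp_continuousOn hcont

/-- The exact discrete Lagrangian is the increment of the cost variable. -/
theorem add_exactLagrangian (hL : ContMDiff (velModel E) 𝓘(ℝ, ℝ) ∞ L) (hreg : IsHyperregular L)
    (hh : 0 < h) (hd : d ∈ bvpDomain L h U) :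
    d.2.2 + exactLagrangian L h U d = (finalPhase L h U d).2.2 := by
  obtain ⟨h1, -, -, h3, -⟩ := bvpSolution_spec hd
  rw [exactLagrangian, h1.integral_eq hL hreg hh, h3]
  show d.2.2 + ((bvpSolution L h U d h).2.2 - d.2.2) = (bvpSolution L h U d h).2.2
  ring

/-- The conformal factor of the time-`h` flow at the initial state of the solution with boundary
data `d`. -/
def stepFactor (L : VelSpace E G → ℝ) (h : ℝ) (U : Set (VelSpace E G)) (d : G × G × ℝ) : ℝ :=
  Real.exp (-∫ t in (0 : ℝ)..h,
    hamCost (hamiltonian L) (flow (hamiltonian L) t (initialPhase L h U d)))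

theorem stepFactor_pos : 0 < stepFactor L h U d := Real.exp_pos _

/-- The first variation of the exact discrete Lagrangian: since the time-`h` flow is a conformal
contactomorphism, a variation `(v₀, v₁, ζ)` of the boundary data changes the final cost by a
`ζ'` with `ζ' - ⟨μ⁻, g₁⁻¹ v₁⟩ = σ (ζ - ⟨μ⁺, g₀⁻¹ v₀⟩)`, where `μ⁺`, `μ⁻` are the initial and the
final momentum and `σ` is the conformal factor. -/
theorem IsBVPRegion.exists_hasDerivAt_cost [T2Space G]
    (hL : ContMDiff (velModel E) 𝓘(ℝ, ℝ) ∞ L) (hreg : IsHyperregular L) (hh : 0 < h)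
    (hU : IsBVPRegion L h U) {d : ℝ → G × G × ℝ} (hd : d 0 ∈ bvpDomain L h U) {v₀ v₁ : E} {ζ : ℝ}
    (h0 : HasMFDerivWithinAt 𝓘(ℝ, ℝ) 𝓘(ℝ, E) (fun ε => (d ε).1) univ 0 (velocity (V := E) v₀))
    (h1 : HasMFDerivWithinAt 𝓘(ℝ, ℝ) 𝓘(ℝ, E) (fun ε => (d ε).2.1) univ 0 (velocity (V := E) v₁))
    (hz : HasDerivAt (fun ε => (d ε).2.2) ζ 0) :
    ∃ ζ', HasDerivAt (fun ε => (d ε).2.2 + exactLagrangian L h U (d ε)) ζ' 0 ∧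
      ζ' - (finalPhase L h U (d 0)).2.1 (leftInv (d 0).2.1 v₁) =
        stepFactor L h U (d 0) * (ζ - (initialPhase L h U (d 0)).2.1 (leftInv (d 0).1 v₀)) := by
  obtain ⟨-, -, -, hopen, hsmooth⟩ := hU
  have hH := contMDiff_hamiltonian hL hreg
  have hdm : MDifferentiableAt 𝓘(ℝ, ℝ) ((𝓘(ℝ, E)).prod ((𝓘(ℝ, E)).prod 𝓘(ℝ, ℝ))) d 0 :=
    (hasMFDerivWithinAt_univ.1 h0).mdifferentiableAt.prodMk
      ((hasMFDerivWithinAt_univ.1 h1).mdifferentiableAt.prodMk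
        hz.differentiableAt.mdifferentiableAt)
  have hev : ∀ᶠ ε in 𝓝 (0 : ℝ), d ε ∈ bvpDomain L h U :=
    hdm.continuousAt.eventually_mem (hopen.mem_nhds hd)
  -- the initial velocity, then the initial state, then the initial momentum along the variation
  obtain ⟨ξ', hξ⟩ : ∃ ξ', HasDerivAt (fun ε => (bvpSolution L h U (d ε) 0).2.1) ξ' 0 := by
    have := (((hsmooth.contMDiffAt (hopen.mem_nhds hd)).mdifferentiableAt (by simp)).comp
      (0 : ℝ) hdm).differentiableAt
    exact ⟨_, this.hasDerivAt⟩
  have hX : HasMFDerivWithinAt 𝓘(ℝ, ℝ) (velModel E) (fun ε => bvpSolution L h U (d ε) 0) univ 0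
      (velocity (V := E × E × ℝ) (v₀, ξ', ζ)) := by
    refine hasMFDerivWithinAt_prod_iff.2 ⟨?_, hξ.hasDerivWithinAt, ?_⟩
    · refine h0.congr_of_eventuallyEq ?_ (initialPhase_fst hd)
      rw [nhdsWithin_univ]
      exact hev.mono fun ε hε => initialPhase_fst hε
    · exact (hz.congr_of_eventuallyEq (hev.mono fun ε hε => initialPhase_cost hε)).hasDerivWithinAt
  obtain ⟨ν, hν⟩ : ∃ ν, HasDerivWithinAt (fun ε => (initialPhase L h U (d ε)).2.1) ν univ 0 :=
    ⟨_, (hasMFDerivWithinAt_prod_iff.1 (hasMFDerivWithinAt_comp_velocity (E₁ := E × E × ℝ)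
      (E₂ := E × (E →L[ℝ] ℝ) × ℝ)
      ((hreg.contMDiff_legendre.mdifferentiableAt (by simp)).hasMFDerivAt) hX)).2.1⟩
  have hY : HasMFDerivWithinAt 𝓘(ℝ, ℝ) (phaseModel E) (fun ε => initialPhase L h U (d ε)) univ 0
      (velocity (V := E × (E →L[ℝ] ℝ) × ℝ) (v₀, ν, ζ)) := by
    obtain ⟨a, -, b⟩ := hasMFDerivWithinAt_prod_iff.1 hX
    exact hasMFDerivWithinAt_prod_iff.2 ⟨a, hν, b⟩
  -- the final state along the variation
  have hconf := isConformalAt_of_mem hH hh.le (initialPhase_mem hL hreg hd)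
  obtain ⟨q, hq, hQ⟩ : ∃ q : E × (E →L[ℝ] ℝ) × ℝ,
      contactForm (flow (hamiltonian L) h (initialPhase L h U (d 0))) q =
        stepFactor L h U (d 0) * contactForm (initialPhase L h U (d 0)) (v₀, ν, ζ) ∧
      HasMFDerivWithinAt 𝓘(ℝ, ℝ) (phaseModel E)
        (fun ε => flow (hamiltonian L) h (initialPhase L h U (d ε))) univ 0
        (velocity (V := E × (E →L[ℝ] ℝ) × ℝ) q) :=
    ⟨_, hconf.contactForm_mfderiv (v₀, ν, ζ),
      hasMFDerivWithinAt_comp_velocity (E₁ := E × (E →L[ℝ] ℝ) × ℝ) (E₂ := E × (E →L[ℝ] ℝ) × ℝ)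
        hconf.mdifferentiableAt.hasMFDerivAt hY⟩
  obtain ⟨hQ1, -, hQ3⟩ := hasMFDerivWithinAt_prod_iff.1 hQ
  have hq1 : q.1 = v₁ := by
    have hev1 : (fun ε => (d ε).2.1) =ᶠ[𝓝 0]
        fun ε => (flow (hamiltonian L) h (initialPhase L h U (d ε))).1 :=
      hev.mono fun ε hε => by
        show (d ε).2.1 = (flow (hamiltonian L) h (initialPhase L h U (d ε))).1
        rw [flow_initialPhase hL hreg hh hε, finalPhase_fst hε]
    have h2 := (hasMFDerivWithinAt_univ.1 hQ1).congr_of_eventuallyEq hev1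
    have h3 := congrArg (fun T : ℝ →L[ℝ] E => T 1)
      (hasMFDerivAt_unique h2 (hasMFDerivWithinAt_univ.1 h1))
    simpa using h3
  refine ⟨q.2.2, (hQ3.hasDerivAt univ_mem).congr_of_eventuallyEq (hev.mono fun ε hε => ?_), ?_⟩
  · show (d ε).2.2 + exactLagrangian L h U (d ε) =
      (flow (hamiltonian L) h (initialPhase L h U (d ε))).2.2
    rw [flow_initialPhase hL hreg hh hε, add_exactLagrangian hL hreg hh hε]
  · rw [flow_initialPhase hL hreg hh hd] at hq
    have hq' : q.2.2 - (finalPhase L h U (d 0)).2.1 (leftInv (finalPhase L h U (d 0)).1 q.1) =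
      stepFactor L h U (d 0) *
        (ζ - (initialPhase L h U (d 0)).2.1 (leftInv (initialPhase L h U (d 0)).1 v₀)) := hq
    rwa [finalPhase_fst hd, initialPhase_fst hd, hq1] at hq'

end Step

section Path

variable {E G : Type*} [NormedAddCommGroup E] [NormedSpace ℝ E]

theorem discreteAction_eq (Ld : G × G × ℝ → ℝ) (N : ℕ) (z₀ : ℝ) (g : ℕ → G) :
    discreteAction Ld N z₀ g = discreteCost Ld g z₀ N - z₀ := by
  induction N with
  | zero => simp [discreteAction, discreteCost]
  | succ N ih =>
    rw [discreteAction, Finset.sum_range_succ, ← discreteAction, ih, discreteCost]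
    ring

variable [FiniteDimensional ℝ E]
  [TopologicalSpace G] [T2Space G] [ChartedSpace E G] [Group G] [LieGroup 𝓘(ℝ, E) ∞ G]
  {L : VelSpace E G → ℝ} {h : ℝ} {U : Set (VelSpace E G)} {N : ℕ} {z₀ : ℝ} {g : ℕ → G}

theorem IsAdmissible.discreteCost_succ (hL : ContMDiff (velModel E) 𝓘(ℝ, ℝ) ∞ L)
    (hreg : IsHyperregular L) (hh : 0 < h) (hg : IsAdmissible L h U N z₀ g) {k : ℕ} (hk : k < N) :
    discreteCost (exactLagrangian L h U) g z₀ (k + 1) =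
      (finalPhase L h U (stepData L h U z₀ g k)).2.2 :=
  add_exactLagrangian hL hreg hh (hg k hk)

theorem legendre_discreteState {k : ℕ} (hk : k < N) :
    legendre L (discreteState L h U N z₀ g k) = initialPhase L h U (stepData L h U z₀ g k) := by
  rw [discreteState, if_pos hk, initialPhase]

theorem legendre_discreteState_last {k : ℕ} (hk : k + 1 = N) :
    legendre L (discreteState L h U N z₀ g (k + 1)) =
      finalPhase L h U (stepData L h U z₀ g k) := by
  subst hk
  rw [discreteState, if_neg (lt_irrefl _), Nat.add_sub_cancel, finalPhase]

theorem IsAdmissible.discreteState_spec (hL : ContMDiff (velModel E) 𝓘(ℝ, ℝ) ∞ L)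
    (hreg : IsHyperregular L) (hh : 0 < h) (hN : 1 ≤ N) (hg : IsAdmissible L h U N z₀ g)
    {k : ℕ} (hk : k ≤ N) :
    (discreteState L h U N z₀ g k).1 = g k ∧
      (discreteState L h U N z₀ g k).2.2 = discreteCost (exactLagrangian L h U) g z₀ k := by
  show (legendre L (discreteState L h U N z₀ g k)).1 = g k ∧
    (legendre L (discreteState L h U N z₀ g k)).2.2 = discreteCost (exactLagrangian L h U) g z₀ k
  rcases hk.lt_or_eq with hk' | rfl
  · rw [legendre_discreteState hk']
    exact ⟨initialPhase_fst (hg k hk'), initialPhase_cost (hg k hk')⟩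
  · obtain ⟨j, rfl⟩ := Nat.exists_eq_add_of_le' hN
    rw [legendre_discreteState_last rfl, hg.discreteCost_succ hL hreg hh (Nat.lt_succ_self j)]
    exact ⟨finalPhase_fst (hg j (Nat.lt_succ_self j)), rfl⟩

/-- The discrete evolution follows the flow if and only if the final momentum of each step is the
initial momentum of the next one. -/
theorem IsAdmissible.flow_iff (hL : ContMDiff (velModel E) 𝓘(ℝ, ℝ) ∞ L)
    (hreg : IsHyperregular L) (hh : 0 < h) (hg : IsAdmissible L h U N z₀ g) :
    (∀ k < N, legendre L (discreteState L h U N z₀ g k) ∈ flowDomain (hamiltonian L) h ∧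
      legendre L (discreteState L h U N z₀ g (k + 1)) =
        flow (hamiltonian L) h (legendre L (discreteState L h U N z₀ g k))) ↔
    ∀ k, k + 1 < N → (finalPhase L h U (stepData L h U z₀ g k)).2.1 =
      (initialPhase L h U (stepData L h U z₀ g (k + 1))).2.1 := by
  constructor
  · intro H k hk
    have hk' : k < N := Nat.lt_of_succ_lt hk
    have := (H k hk').2
    rw [legendre_discreteState hk, legendre_discreteState hk',
      flow_initialPhase hL hreg hh (hg k hk')] at this
    rw [this]
  · intro H k hk
    rw [legendre_discreteState hk]
    refine ⟨initialPhase_mem hL hreg (hg k hk), ?_⟩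
    rw [flow_initialPhase hL hreg hh (hg k hk)]
    rcases (Nat.succ_le_of_lt hk).lt_or_eq with hk' | hk'
    · rw [legendre_discreteState hk']
      refine Prod.ext ?_ (Prod.ext (H k hk').symm ?_)
      · rw [initialPhase_fst (hg _ hk'), finalPhase_fst (hg k hk)]; rfl
      · rw [initialPhase_cost (hg _ hk'), ← hg.discreteCost_succ hL hreg hh hk]; rfl
    · exact legendre_discreteState_last hk'

/-- The variation of the costs along a variation of an admissible path. -/
theorem IsAdmissible.exists_variation (hL : ContMDiff (velModel E) 𝓘(ℝ, ℝ) ∞ L)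
    (hreg : IsHyperregular L) (hh : 0 < h) (hU : IsBVPRegion L h U)
    (hg : IsAdmissible L h U N z₀ g) {γ : ℝ → ℕ → G} (hγ0 : γ 0 = g) {v : ℕ → E}
    (hv : ∀ k, HasMFDerivWithinAt 𝓘(ℝ, ℝ) 𝓘(ℝ, E) (fun ε => γ ε k) univ 0
      (velocity (V := E) (v k))) :
    ∃ ζ : ℕ → ℝ, ζ 0 = 0 ∧
      (∀ k ≤ N, HasDerivAt
        (fun ε => discreteCost (exactLagrangian L h U) (γ ε) z₀ k) (ζ k) 0) ∧
      ∀ k < N, ζ (k + 1) - (finalPhase L h U (stepData L h U z₀ g k)).2.1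
          (leftInv (g (k + 1)) (v (k + 1))) =
        stepFactor L h U (stepData L h U z₀ g k) *
          (ζ k - (initialPhase L h U (stepData L h U z₀ g k)).2.1 (leftInv (g k) (v k))) := by
  set z : ℕ → ℝ → ℝ := fun k ε => discreteCost (exactLagrangian L h U) (γ ε) z₀ k
  have step : ∀ k < N, ∀ ζ, HasDerivAt (z k) ζ 0 → ∃ ζ', HasDerivAt (z (k + 1)) ζ' 0 ∧
      ζ' - (finalPhase L h U (stepData L h U z₀ g k)).2.1 (leftInv (g (k + 1)) (v (k + 1))) =
        stepFactor L h U (stepData L h U z₀ g k) *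
          (ζ - (initialPhase L h U (stepData L h U z₀ g k)).2.1 (leftInv (g k) (v k))) := by
    intro k hk ζ hζ
    have e : stepData L h U z₀ (γ 0) k = stepData L h U z₀ g k := by rw [hγ0]
    have h1 := hU.exists_hasDerivAt_cost hL hreg hh (d := fun ε => stepData L h U z₀ (γ ε) k)
      (by show stepData L h U z₀ (γ 0) k ∈ _; rw [e]; exact hg k hk) (hv k) (hv (k + 1)) hζ
    simp only [e] at h1
    exact h1
  have hz : ∀ k ≤ N, HasDerivAt (z k) (deriv (z k) 0) 0 := by
    intro k
    induction k with
    | zero =>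
      intro _
      have h0 : HasDerivAt (z 0) 0 0 := hasDerivAt_const (0 : ℝ) z₀
      exact h0.differentiableAt.hasDerivAt
    | succ k ih =>
      intro hk
      obtain ⟨ζ', h1, -⟩ := step k hk _ (ih (Nat.le_of_succ_le hk))
      exact h1.differentiableAt.hasDerivAt
  refine ⟨fun k => deriv (z k) 0, ?_, hz, fun k hk => ?_⟩
  · show deriv (fun _ : ℝ => z₀) 0 = 0
    simp
  · obtain ⟨ζ', h1, h2⟩ := step k hk _ (hz k hk.le)
    show deriv (z (k + 1)) 0 - _ = _
    rw [h1.deriv]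
    exact h2

theorem velocity_eq_zero_of_const {x : ℝ → G} {a : G} (hx : ∀ ε, x ε = a) {v : E}
    (hv : HasMFDerivWithinAt 𝓘(ℝ, ℝ) 𝓘(ℝ, E) x univ 0 (velocity (V := E) v)) : v = 0 := by
  have e : x = fun _ => a := funext hx
  rw [e] at hv
  have h1 : v = (0 : ℝ →L[ℝ] E) 1 := (one_smul ℝ v).symm.trans
    (congrArg (fun T : ℝ →L[ℝ] E => T 1)
      (hasMFDerivAt_unique (hasMFDerivWithinAt_univ.1 hv) (hasMFDerivAt_const a (0 : ℝ))))
  exact h1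

/-- The discrete Herglotz principle is the matching of the momenta. -/
theorem IsAdmissible.isDiscreteHerglotz_iff (hL : ContMDiff (velModel E) 𝓘(ℝ, ℝ) ∞ L)
    (hreg : IsHyperregular L) (hh : 0 < h) (hU : IsBVPRegion L h U) (hN : 1 ≤ N)
    (hg : IsAdmissible L h U N z₀ g) :
    IsDiscreteHerglotz E (exactLagrangian L h U) N z₀ g ↔
    ∀ k, k + 1 < N → (finalPhase L h U (stepData L h U z₀ g k)).2.1 =
      (initialPhase L h U (stepData L h U z₀ g (k + 1))).2.1 := by
  constructor
  · intro H k hk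
    ext η
    -- vary `g (k + 1)` only, with velocity `η` in the left trivialization
    set c := g (k + 1)
    set φ := extChartAt 𝓘(ℝ, E) c
    have hc : c ∈ φ.source := mem_extChartAt_source c
    have hline : HasDerivWithinAt (fun ε : ℝ => φ c + ε • chartDeriv c c (leftMap c η))
        (chartDeriv c c (leftMap c η)) univ 0 := by
      have := ((hasDerivAt_id (0 : ℝ)).smul_const
        (chartDeriv c c (leftMap c η))).const_add (φ c)
      rw [one_smul] at this
      exact this.hasDerivWithinAt
    set x : ℝ → G := fun ε => φ.symm (φ c + ε • chartDeriv c c (leftMap c η)) with hxdef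
    have hx0 : x 0 = c := by
      simp only [hxdef, zero_smul, add_zero]
      exact φ.left_inv hc
    have hx : HasMFDerivWithinAt 𝓘(ℝ, ℝ) 𝓘(ℝ, E) x univ 0 (velocity (V := E) (leftMap c η)) := by
      have h1 := hasMFDerivWithinAt_chart_symm_comp (G := G) (c := c) hline (by
        simp only [zero_smul, add_zero]
        exact φ.map_source hc)
      have e : chartSymmDeriv c (φ c + (0 : ℝ) • chartDeriv c c (leftMap c η))
          (chartDeriv c c (leftMap c η)) = leftMap c η := by
        rw [zero_smul, add_zero]
        exact chartSymmDeriv_chartDeriv hc _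
      rw [e] at h1
      exact h1
    have hxs : ContMDiffAt 𝓘(ℝ, ℝ) 𝓘(ℝ, E) ∞ x 0 := by
      have h1 : ContMDiffAt 𝓘(ℝ, E) 𝓘(ℝ, E) ∞ φ.symm
          (φ c + (0 : ℝ) • chartDeriv c c (leftMap c η)) := by
        rw [zero_smul, add_zero]
        exact contMDiffAt_extChartAt_symm (φ.map_source hc)
      have h2 : ContDiff ℝ ∞ (fun ε : ℝ => φ c + ε • chartDeriv c c (leftMap c η)) := by fun_prop
      exact h1.comp (0 : ℝ) h2.contMDiff.contMDiffAt
    set γ : ℝ → ℕ → G := fun ε j => if j = k + 1 then x ε else g j with hγ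
    have hγne : ∀ j, j ≠ k + 1 → ∀ ε, γ ε j = g j := fun j hj ε => if_neg hj
    have hγeq : ∀ ε, γ ε (k + 1) = x ε := fun ε => if_pos rfl
    have hγ0 : γ 0 = g := by
      funext j
      by_cases hj : j = k + 1
      · subst hj; rw [hγeq, hx0]
      · exact hγne j hj 0
    set v : ℕ → E := fun j => if j = k + 1 then leftMap c η else 0 with hvdef
    have hv : ∀ j, HasMFDerivWithinAt 𝓘(ℝ, ℝ) 𝓘(ℝ, E) (fun ε => γ ε j) univ 0
        (velocity (V := E) (v j)) := by
      intro j
      by_cases hj : j = k + 1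
      · subst hj
        have e1 : (fun ε => γ ε (k + 1)) = x := funext hγeq
        have e2 : v (k + 1) = leftMap c η := if_pos rfl
        rw [e1, e2]; exact hx
      · have e1 : (fun ε => γ ε j) = fun _ => g j := funext (hγne j hj)
        have e2 : v j = 0 := if_neg hj
        rw [e1, e2]
        refine (hasMFDerivAt_const (g j) (0 : ℝ)).hasMFDerivWithinAt.congr_mfderiv ?_
        show (0 : ℝ →L[ℝ] E) = velocity (V := E) 0
        simp
    have hv0 : ∀ j, j ≠ k + 1 → v j = 0 := fun j hj => if_neg hj
    have hv1 : leftInv (g (k + 1)) (v (k + 1)) = η := by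
      have e2 : v (k + 1) = leftMap c η := if_pos rfl
      rw [e2]; exact leftInv_leftMap c η
    obtain ⟨ζ, hζ0, hζd, hζ⟩ := hg.exists_variation hL hreg hh hU hγ0 hv
    have hcrit := H γ hγ0 (hγne 0 (by omega)) (hγne N (by omega)) (fun j => by
      by_cases hj : j = k + 1
      · subst hj
        have e1 : (fun ε => γ ε (k + 1)) = x := funext hγeq
        rw [e1]; exact hxs
      · have e1 : (fun ε => γ ε j) = fun _ => g j := funext (hγne j hj)
        rw [e1]; exact contMDiffAt_const)
    have hζN : ζ N = 0 := by
      simp only [discreteAction_eq] at hcrit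
      exact ((hζd N le_rfl).sub_const z₀).unique hcrit
    -- the variation only reaches the costs from `z (k + 1)` on, and after `z (k + 2)` it is
    -- multiplied by positive factors up to `z N`, where it vanishes
    have hbefore : ∀ j, j ≤ k → ζ j = 0 := by
      intro j
      induction j with
      | zero => exact fun _ => hζ0
      | succ j ih =>
        intro hj
        have := hζ j (by omega)
        rw [hv0 _ (by omega), hv0 j (by omega), ih (by omega)] at this
        simpa using this
    have hafter : ∀ j, k + 2 + j ≤ N → ζ (k + 2 + j) = 0 → ζ (k + 2) = 0 := by
      intro j
      induction j with
      | zero => exact fun _ h => h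
      | succ j ih => intro hj hz
                     have := hζ (k + 2 + j) (by omega)
                     rw [hv0 _ (by omega), hv0 (k + 2 + j) (by omega)] at this
                     refine ih (by omega) ?_
                     have h3 : ζ (k + 2 + j + 1) = 0 := hz
                     simpa [h3, stepFactor_pos.ne'] using this
    have h1 := hζ k (by omega)
    rw [hbefore k le_rfl, hv0 k (by omega), hv1] at h1
    have h2 := hζ (k + 1) hk
    rw [hv0 (k + 1 + 1) (by omega), hv1, hafter (N - (k + 2)) (by omega)
      (by rw [show k + 2 + (N - (k + 2)) = N by omega]; exact hζN)] at h2
    have h3 : ζ (k + 1) - (initialPhase L h U (stepData L h U z₀ g (k + 1))).2.1 η = 0 := by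
      simpa [stepFactor_pos.ne'] using h2
    have h4 : ζ (k + 1) - (finalPhase L h U (stepData L h U z₀ g k)).2.1 η = 0 := by
      simpa using h1
    linarith
  · intro H γ hγ0 hγl hγr hγs
    have hex : ∀ k, ∃ v : E, HasMFDerivWithinAt 𝓘(ℝ, ℝ) 𝓘(ℝ, E) (fun ε => γ ε k) univ 0
        (velocity (V := E) v) := fun k => by
      have h1 := hasMFDerivWithinAt_univ.2 (((hγs k).mdifferentiableAt (by simp)).hasMFDerivAt)
      refine ⟨(show ℝ →L[ℝ] E from mfderiv 𝓘(ℝ, ℝ) 𝓘(ℝ, E) (fun ε => γ ε k) 0) 1,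
        h1.congr_mfderiv ?_⟩
      refine ContinuousLinearMap.ext_ring (R₁ := ℝ) ?_
      exact (one_smul ℝ _).symm
    choose v hv using hex
    obtain ⟨ζ, hζ0, hζd, hζ⟩ := hg.exists_variation hL hreg hh hU hγ0 hv
    have hv0 : v 0 = 0 := velocity_eq_zero_of_const hγl (hv 0)
    have hvN : v N = 0 := velocity_eq_zero_of_const hγr (hv N)
    have key : ∀ k, k < N → ζ (k + 1) =
        (finalPhase L h U (stepData L h U z₀ g k)).2.1 (leftInv (g (k + 1)) (v (k + 1))) := by
      intro k
      induction k with
      | zero =>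
        intro hk
        have := hζ 0 hk
        rw [hζ0, hv0] at this
        simp only [map_zero, sub_zero, mul_zero] at this
        linarith
      | succ k ih =>
        intro hk
        have := hζ (k + 1) hk
        rw [ih (by omega), H k hk, sub_self, mul_zero] at this
        linarith
    have hζN : ζ N = 0 := by
      obtain ⟨j, rfl⟩ := Nat.exists_eq_add_of_le' hN
      rw [key j (by omega), hvN]
      simp
    simp only [discreteAction_eq]
    have := (hζd N le_rfl).sub_const z₀
    rwa [hζN] at this

/-- An orbit of the time-`h` flow that starts in the regular region in each step comes from an
admissible path. -/
theorem exists_isAdmissible_of_flow (hL : ContMDiff (velModel E) 𝓘(ℝ, ℝ) ∞ L)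
    (hreg : IsHyperregular L) (hh : 0 < h) (hU : IsBVPRegion L h U) (hN : 1 ≤ N)
    {y : ℕ → PhaseSpace E G} (hy : ∀ k < N, y k ∈ legendre L '' U ∧
      y k ∈ flowDomain (hamiltonian L) h ∧ y (k + 1) = flow (hamiltonian L) h (y k)) :
    ∃ (z₀ : ℝ) (g : ℕ → G), IsAdmissible L h U N z₀ g ∧
      ∀ k ≤ N, y k = legendre L (discreteState L h U N z₀ g k) := by
  have hH := contMDiff_hamiltonian hL hreg
  set d : ℕ → G × G × ℝ := fun k => ((y k).1, (y (k + 1)).1, (y k).2.2) with hd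
  set c : ℕ → ℝ → VelSpace E G := fun k t => legendreInv L (flow (hamiltonian L) t (y k)) with hc
  have hfl : ∀ k < N, IsFlowLine (hamiltonian L) h (y k) fun t => flow (hamiltonian L) t (y k) :=
    fun k hk => isFlowLine_flow hH hh.le (hy k hk).2.1
  have hsol : ∀ k < N, IsBVPSolution L h U (d k) (c k) := by
    intro k hk
    obtain ⟨⟨x, hx, hxy⟩, -, h2⟩ := hy k hk
    have h0 : c k 0 = x := by
      have : flow (hamiltonian L) 0 (y k) = y k := (hfl k hk).1
      simp only [hc, this]
      rw [← hxy, hreg.legendreInv_legendre]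
    refine ⟨(hfl k hk).isEPHSolution hL hreg, h0 ▸ hx, ?_, ?_, ?_⟩
    · rw [h0]; exact congrArg Prod.fst hxy
    · rw [h0]; exact congrArg (fun y : PhaseSpace E G => y.2.2) hxy
    · simp only [hc, hd, hreg.legendreInv_fst, h2]
  have hdom : ∀ k < N, d k ∈ bvpDomain L h U := fun k hk => ⟨_, hsol k hk⟩
  have heq : ∀ k < N, EqOn (bvpSolution L h U (d k)) (c k) (Icc 0 h) := fun k hk =>
    hU.2.2.1 _ _ _ (bvpSolution_spec (hdom k hk)) (hsol k hk)
  have hini : ∀ k < N, initialPhase L h U (d k) = y k := fun k hk => by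
    have : flow (hamiltonian L) 0 (y k) = y k := (hfl k hk).1
    rw [initialPhase, heq k hk (left_mem_Icc.2 hh.le), hreg.legendre_legendreInv, this]
  have hfin : ∀ k < N, finalPhase L h U (d k) = y (k + 1) := fun k hk => by
    rw [finalPhase, heq k hk (right_mem_Icc.2 hh.le), hreg.legendre_legendreInv, (hy k hk).2.2]
  set g : ℕ → G := fun k => (y k).1
  have hcost : ∀ k, k ≤ N →
      discreteCost (exactLagrangian L h U) g (y 0).2.2 k = (y k).2.2 := by
    intro k
    induction k with
    | zero => exact fun _ => rfl
    | succ k ih =>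
      intro hk
      rw [discreteCost, ih (by omega), ← hfin k hk]
      exact add_exactLagrangian hL hreg hh (hdom k hk)
  have hstep : ∀ k < N, stepData L h U (y 0).2.2 g k = d k := fun k hk => by
    rw [stepData, hcost k hk.le]
  refine ⟨(y 0).2.2, g, fun k hk => by rw [hstep k hk]; exact hdom k hk, fun k hk => ?_⟩
  rcases hk.lt_or_eq with hk' | rfl
  · rw [legendre_discreteState hk', hstep k hk', hini k hk']
  · obtain ⟨j, rfl⟩ := Nat.exists_eq_add_of_le' hN
    rw [legendre_discreteState_last rfl, hstep j (by omega), hfin j (by omega)]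

end Path

/-! ### The endpoint map for short times -/

section Endpoint

variable {E G : Type*} [NormedAddCommGroup E] [NormedSpace ℝ E] [FiniteDimensional ℝ E]
  [TopologicalSpace G] [ChartedSpace E G] [Group G] [LieGroup 𝓘(ℝ, E) ∞ G]
  {L : VelSpace E G → ℝ} {c : G} {h : ℝ}

/-- The point of `G × 𝔤 × ℝ` with chart coordinates `q`. -/
def velSymm (c : G) (q : E × E × ℝ) : VelSpace E G := ((extChartAt 𝓘(ℝ, E) c).symm q.1, q.2)

/-- The contact Legendre transform in the chart centred at `c`. -/
def localLegendre (L : VelSpace E G → ℝ) (c : G) (q : E × E × ℝ) : LocalPhase E :=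
  phaseChart c (legendre L (velSymm c q))

/-- The endpoint `g(h)`, in the chart centred at `c`, of the solution with initial state `q`. -/
def localEnd (L : VelSpace E G → ℝ) (h : ℝ) (c : G) (q : E × E × ℝ) : E :=
  extChartAt 𝓘(ℝ, E) c (flow (hamiltonian L) h (legendre L (velSymm c q))).1

theorem localLegendre_fst {q : E × E × ℝ} (hq : q.1 ∈ (extChartAt 𝓘(ℝ, E) c).target) :
    (localLegendre L c q).1 = q.1 :=
  (extChartAt 𝓘(ℝ, E) c).right_inv hq

theorem phaseSymm_localLegendre {q : E × E × ℝ} (hq : q.1 ∈ (extChartAt 𝓘(ℝ, E) c).target) :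
    phaseSymm c (localLegendre L c q) = legendre L (velSymm c q) :=
  phaseSymm_phaseChart ((extChartAt 𝓘(ℝ, E) c).map_target hq)

theorem contDiffAt_localLegendre (hreg : IsHyperregular L) {q : E × E × ℝ}
    (hq : q.1 ∈ (extChartAt 𝓘(ℝ, E) c).target) : ContDiffAt ℝ ∞ (localLegendre L c) q := by
  have h1 : ContMDiffAt 𝓘(ℝ, E × E × ℝ) 𝓘(ℝ, E) ∞
      (fun q : E × E × ℝ => (extChartAt 𝓘(ℝ, E) c).symm q.1) q :=
    ContMDiffAt.comp (g := (extChartAt 𝓘(ℝ, E) c).symm) (f := Prod.fst) q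
      (contMDiffAt_extChartAt_symm hq) contDiff_fst.contMDiff.contMDiffAt
  have h2 : ContMDiffAt 𝓘(ℝ, E × E × ℝ) (velModel E) ∞ (velSymm (G := G) c) q :=
    h1.prodMk ((contDiff_fst.comp contDiff_snd).contMDiff.contMDiffAt.prodMk
      (contDiff_snd.comp contDiff_snd).contMDiff.contMDiffAt)
  have h3 : ContMDiffAt 𝓘(ℝ, E × E × ℝ) 𝓘(ℝ, LocalPhase E) ∞ (localLegendre L c) q :=
    (contMDiffAt_phaseChart (c := c) (y := legendre L (velSymm c q))
      ((extChartAt 𝓘(ℝ, E) c).map_target hq)).comp q (hreg.contMDiff_legendre.contMDiffAt.comp q h2)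
  exact h3.contDiffAt

theorem hasDerivAt_line {F : Type*} [NormedAddCommGroup F] [NormedSpace ℝ F] (q w : F) :
    HasDerivAt (fun s : ℝ => q + s • w) w 0 := by
  have := ((hasDerivAt_id (0 : ℝ)).smul_const w).const_add q
  rwa [one_smul] at this

theorem fderiv_apply_eq_of_line {F F' : Type*} [NormedAddCommGroup F] [NormedSpace ℝ F]
    [NormedAddCommGroup F'] [NormedSpace ℝ F'] {f : F → F'} {q w : F} {v : F'}
    (hf : DifferentiableAt ℝ f q) (hv : HasDerivAt (fun s : ℝ => f (q + s • w)) v 0) :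
    fderiv ℝ f q w = v := by
  have h1 : HasFDerivAt f (fderiv ℝ f q) (q + (0 : ℝ) • w) := by
    rw [zero_smul, add_zero]; exact hf.hasFDerivAt
  exact (h1.comp_hasDerivAt (0 : ℝ) (hasDerivAt_line q w)).unique hv

/-- Along the fibre `𝔤`, the base component of the local Legendre transform is constant. -/
theorem fderiv_localLegendre_fst (hreg : IsHyperregular L) {q : E × E × ℝ}
    (hq : q.1 ∈ (extChartAt 𝓘(ℝ, E) c).target) (η : E) :
    (fderiv ℝ (localLegendre L c) q (0, η, 0)).1 = 0 := by
  have hd := (contDiffAt_localLegendre hreg hq).differentiableAt (by simp)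
  have h1 := fderiv_apply_eq_of_line (w := ((0, η, 0) : E × E × ℝ)) (v := (0 : E)) hd.fst (by
    have : (fun s : ℝ => (localLegendre L c (q + s • ((0, η, 0) : E × E × ℝ))).1) =
        fun _ => q.1 := by
      funext s
      rw [localLegendre_fst (by simpa using hq)]
      simp
    rw [this]
    exact hasDerivAt_const _ _)
  rw [fderiv.fst hd] at h1
  exact h1

/-- The derivative along the fibre `𝔤` of the base component `T_e L_g ξ` of the vector field. -/
theorem fderiv_localField_localLegendre_fst (hL : ContMDiff (velModel E) 𝓘(ℝ, ℝ) ∞ L)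
    (hreg : IsHyperregular L) {q : E × E × ℝ}
    (hq : q.1 ∈ (extChartAt 𝓘(ℝ, E) c).target) (η : E) :
    (fderiv ℝ (localField (hamiltonian L) c) (localLegendre L c q)
      (fderiv ℝ (localLegendre L c) q (0, η, 0))).1 = chartLeft c q.1 η := by
  have hd := (contDiffAt_localLegendre hreg hq).differentiableAt (by simp)
  have hmem : localLegendre L c q ∈ phaseTarget (G := G) c := by
    show (localLegendre L c q).1 ∈ (extChartAt 𝓘(ℝ, E) c).target
    rwa [localLegendre_fst hq]
  have hf := (contDiffAt_localField (contMDiff_hamiltonian hL hreg) hmem).differentiableAt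
    (by simp)
  have hcomp := hf.comp q hd
  have h1 := fderiv_apply_eq_of_line (w := ((0, η, 0) : E × E × ℝ))
    (v := chartLeft (E := E) c q.1 η) hcomp.fst (by
    have : (fun s : ℝ => (localField (hamiltonian L) c
        (localLegendre L c (q + s • ((0, η, 0) : E × E × ℝ)))).1) =
        fun s => chartLeft c q.1 (q.2.1 + s • η) := by
      funext s
      have hs : (q + s • ((0, η, 0) : E × E × ℝ)).1 = q.1 := by simp
      have hs' : (q + s • ((0, η, 0) : E × E × ℝ)).1 ∈ (extChartAt 𝓘(ℝ, E) c).target := by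
        rwa [hs]
      rw [localField, phaseSymm_localLegendre hs', (partials_hamiltonian hL hreg _).1,
        localLegendre_fst hs', hs]
      simp [velSymm]
    show HasDerivAt (fun s : ℝ => (localField (hamiltonian L) c
        (localLegendre L c (q + s • ((0, η, 0) : E × E × ℝ)))).1) _ 0
    rw [this]
    exact (chartLeft (E := E) c q.1).hasFDerivAt.comp_hasDerivAt (0 : ℝ)
      (hasDerivAt_line q.2.1 η))
  rw [fderiv.fst hcomp, fderiv_comp q hf hd] at h1
  exact h1

/-- The endpoint map `q = (x, ξ, z) ↦ g(h)` in the chart centred at `c` is `C¹` at `q`, and its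
derivative in the direction of `ξ` is `h A` up to an error `κ h`. -/
structure HasEndEstimate (L : VelSpace E G → ℝ) (h : ℝ) (c : G) (A : E →L[ℝ] E) (κ : ℝ)
    (q : E × E × ℝ) : Prop where
  mem_target : q.1 ∈ (extChartAt 𝓘(ℝ, E) c).target
  eventually_mem : ∀ᶠ q' in 𝓝 q, legendre L (velSymm c q') ∈ flowDomain (hamiltonian L) h ∧
    (flow (hamiltonian L) h (legendre L (velSymm c q'))).1 ∈ (extChartAt 𝓘(ℝ, E) c).source
  contDiffAt : ContDiffAt ℝ 1 (localEnd L h c) q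
  norm_sub_le : ∀ η, ‖fderiv ℝ (localEnd L h c) q (0, η, 0) - h • A η‖ ≤ κ * h * ‖η‖

/-- The derivative of the flow is `1 + h X' + o(h)`, uniformly near a point, and `ξ` enters the base
component of the field `X` linearly, through `T_e L_g`. -/
theorem eventually_hasEndEstimate [T2Space G] (hL : ContMDiff (velModel E) 𝓘(ℝ, ℝ) ∞ L)
    (hreg : IsHyperregular L) (c : G) (p₀ : E × ℝ) {κ : ℝ} (hκ : 0 < κ) :
    ∀ᶠ a : (E × ℝ) × E × ℝ in 𝓝 ((extChartAt 𝓘(ℝ, E) c c, 0), p₀), 0 < a.1.2 →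
      HasEndEstimate L a.1.2 c (chartLeft c (extChartAt 𝓘(ℝ, E) c c)) κ (a.1.1, a.2) := by
  set φ := extChartAt 𝓘(ℝ, E) c
  set q₀ : E × E × ℝ := (φ c, p₀)
  have hH := contMDiff_hamiltonian hL hreg
  have hq₀ : q₀.1 ∈ φ.target := mem_extChartAt_target c
  have hmemT : ∀ q : E × E × ℝ, q.1 ∈ φ.target → localLegendre L c q ∈ phaseTarget (G := G) c :=
    fun q hq => by
      show (localLegendre L c q).1 ∈ φ.target
      rwa [localLegendre_fst hq]
  obtain ⟨r, hr, ε, hε, Φ, D, hΦ⟩ := exists_isLocalFlow_localField hH (hmemT q₀ hq₀)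
  have hcf := contDiffAt_localField hH (hmemT q₀ hq₀)
  have hcl := contDiffAt_localLegendre hreg hq₀
  set C := ‖fderiv ℝ (localLegendre L c) q₀‖ + 1
  have hC : 0 < C := by positivity
  obtain ⟨δ, hδ, hest⟩ := hΦ.norm_deriv_sub_le hr hε
    (hcf.continuousAt_fderiv (by simp)) (η := κ / (2 * C)) (by positivity)
  have e1 : ∀ᶠ q in 𝓝 q₀, q.1 ∈ φ.target :=
    continuousAt_fst.eventually_mem (extChartAt_target_mem_nhds' hq₀)
  have e2 : ∀ᶠ q in 𝓝 q₀, localLegendre L c q ∈ Metric.ball (localLegendre L c q₀) (min δ r) :=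
    hcl.continuousAt.eventually_mem (Metric.ball_mem_nhds _ (lt_min hδ hr))
  have e3 : ∀ᶠ q in 𝓝 q₀, ‖fderiv ℝ (localLegendre L c) q‖ < C :=
    (hcl.continuousAt_fderiv (by simp)).norm.eventually_lt continuousAt_const (by simp [C])
  have e4 : ∀ᶠ q in 𝓝 q₀, ‖chartLeft (E := E) c q.1 - chartLeft c (φ c)‖ < κ / 2 := by
    have h1 : ContinuousAt (fun q : E × E × ℝ => chartLeft (E := E) c q.1) q₀ :=
      ContinuousAt.comp (g := chartLeft (E := E) c) (contDiffAt_chartLeft hq₀).continuousAt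
        continuousAt_fst
    refine (h1.sub continuousAt_const).norm.eventually_lt continuousAt_const ?_
    simpa [q₀] using hκ
  have e := (e1.and (e2.and (e3.and e4))).eventually_nhds
  have e' : ∀ᶠ a : (E × ℝ) × E × ℝ in 𝓝 ((φ c, 0), p₀), ∀ᶠ q in 𝓝 (a.1.1, a.2),
      q.1 ∈ φ.target ∧
        localLegendre L c q ∈ Metric.ball (localLegendre L c q₀) (min δ r) ∧
        ‖fderiv ℝ (localLegendre L c) q‖ < C ∧
        ‖chartLeft (E := E) c q.1 - chartLeft c (φ c)‖ < κ / 2 :=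
    (Continuous.tendsto (f := fun a : (E × ℝ) × E × ℝ => (a.1.1, a.2)) (by fun_prop)
      ((φ c, 0), p₀)).eventually e
  have eh : ∀ᶠ a : (E × ℝ) × E × ℝ in 𝓝 ((φ c, (0 : ℝ)), p₀), a.1.2 < min δ ε :=
    ContinuousAt.eventually_lt (by fun_prop) continuousAt_const (lt_min hδ hε)
  filter_upwards [e', eh] with a ha hah ha0
  obtain ⟨⟨x, h⟩, p⟩ := a
  set q : E × E × ℝ := (x, p)
  change ∀ᶠ q in 𝓝 q, _ at ha
  change h < min δ ε at hah
  change 0 < h at ha0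
  have hhε : h ∈ Icc 0 ε := ⟨ha0.le, hah.le.trans (min_le_right _ _)⟩
  have hhδ : h ∈ Icc 0 δ := ⟨ha0.le, hah.le.trans (min_le_left _ _)⟩
  have hflow : ∀ᶠ q' in 𝓝 q, legendre L (velSymm c q') ∈ flowDomain (hamiltonian L) h ∧
      (flow (hamiltonian L) h (legendre L (velSymm c q'))).1 ∈ φ.source ∧
      localEnd L h c q' = (Φ (localLegendre L c q') h).1 := by
    filter_upwards [ha] with q' hq'
    obtain ⟨h1, h2, -⟩ := hq'
    have hB := Metric.ball_subset_ball (min_le_right δ r) h2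
    obtain ⟨f1, f2⟩ := hΦ.flow_eq hH hB hhε
    rw [phaseSymm_localLegendre h1] at f1 f2
    have hT : Φ (localLegendre L c q') h ∈ phaseTarget (G := G) c :=
      hΦ.mem _ hB h ⟨by linarith [hhε.1, hhε.2], hhε.2⟩
    refine ⟨f1, ?_, ?_⟩
    · rw [f2]; exact phaseSymm_mem hT
    · rw [localEnd, f2]; exact φ.right_inv hT
  obtain ⟨h1, h2, h3, h4⟩ := ha.self_of_nhds
  have hB := Metric.ball_subset_ball (min_le_right δ r) h2
  have hcl' := contDiffAt_localLegendre hreg h1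
  have heq : localEnd L h c =ᶠ[𝓝 q] fun q' => (Φ (localLegendre L c q') h).1 :=
    hflow.mono fun q' hq' => hq'.2.2
  have hΦC : ContDiffAt ℝ 1 (fun v => Φ v h) (localLegendre L c q) := by
    refine contDiffAt_one_iff.2 ⟨fun v => D v h, Metric.ball (localLegendre L c q₀) r,
      Metric.isOpen_ball.mem_nhds hB, ?_, fun v hv => hΦ.hasFDerivAt v hv h hhε⟩
    exact hΦ.continuousOn_deriv.comp (f := fun v => (v, h)) (by fun_prop)
      fun v hv => ⟨hv, by linarith [hhε.1, hhε.2], hhε.2⟩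
  refine ⟨h1, hflow.mono fun q' hq' => ⟨hq'.1, hq'.2.1⟩, ?_, fun η => ?_⟩
  · refine ContDiffAt.congr_of_eventuallyEq ?_ heq
    exact (hΦC.comp q (hcl'.of_le (by simp))).fst
  · set w := fderiv ℝ (localLegendre L c) q (0, η, 0)
    have hd : HasFDerivAt (localEnd L h c) ((ContinuousLinearMap.fst ℝ E _).comp
        ((D (localLegendre L c q) h).comp (fderiv ℝ (localLegendre L c) q))) q := by
      refine HasFDerivAt.congr_of_eventuallyEq ?_ heq
      exact ((hΦ.hasFDerivAt _ hB h hhε).comp q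
        (hcl'.differentiableAt (by simp)).hasFDerivAt).fst
    rw [hd.fderiv]
    show ‖(D (localLegendre L c q) h w).1 - h • chartLeft (E := E) c (φ c) η‖ ≤ κ * h * ‖η‖
    set f' := fderiv ℝ (localField (hamiltonian L) c) (localLegendre L c q)
    have hw1 : w.1 = 0 := fderiv_localLegendre_fst hreg h1 η
    have hw2 : (f' w).1 = chartLeft c q.1 η := fderiv_localField_localLegendre_fst hL hreg h1 η
    have hη : ‖((0, η, 0) : E × E × ℝ)‖ = ‖η‖ := by simp [Prod.norm_def]
    have hw : ‖w‖ ≤ C * ‖η‖ := by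
      refine (ContinuousLinearMap.le_opNorm _ _).trans ?_
      rw [hη]
      gcongr
    have b1 : ‖((D (localLegendre L c q) h -
        ContinuousLinearMap.id ℝ (LocalPhase E) - h • f') w).1‖ ≤ κ / 2 * h * ‖η‖ := by
      refine (norm_fst_le _).trans ((ContinuousLinearMap.le_opNorm _ _).trans ?_)
      refine (mul_le_mul (hest _ (Metric.ball_subset_ball (min_le_left δ r) h2) h hhδ) hw
        (norm_nonneg _) (by positivity)).trans (le_of_eq ?_)
      field_simp
    have b2 : ‖h • (chartLeft (E := E) c q.1 - chartLeft c (φ c)) η‖ ≤ κ / 2 * h * ‖η‖ := by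
      rw [norm_smul, Real.norm_of_nonneg ha0.le]
      calc h * _ ≤ h * (κ / 2 * ‖η‖) := by
            gcongr
            exact (ContinuousLinearMap.le_opNorm _ _).trans (by gcongr)
        _ = _ := by ring
    have hsum : (D (localLegendre L c q) h w).1 - h • chartLeft (E := E) c (φ c) η =
        ((D (localLegendre L c q) h - ContinuousLinearMap.id ℝ (LocalPhase E) - h • f') w).1 +
          h • (chartLeft (E := E) c q.1 - chartLeft c (φ c)) η := by
      have hexp : ((D (localLegendre L c q) h - ContinuousLinearMap.id ℝ (LocalPhase E) -
          h • f') w).1 = (D (localLegendre L c q) h w).1 - w.1 - h • (f' w).1 := rfl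
      rw [hexp, hw1, hw2, sub_apply, smul_sub]
      abel
    rw [hsum]
    refine (norm_add_le _ _).trans ((add_le_add b1 b2).trans (le_of_eq ?_))
    ring

end Endpoint

/-! ### Regular regions around compact sets -/

/-- A `C¹` map `(x, ξ, z) ↦ (x, w (x, ξ, z), z)` with injective partial derivative of `w` in the
direction of `ξ` has a `C¹` local right inverse. -/
theorem exists_contDiffAt_section {E : Type*} [NormedAddCommGroup E] [NormedSpace ℝ E]
    [FiniteDimensional ℝ E] {w : E × E × ℝ → E} {a : E × E × ℝ} (hw : ContDiffAt ℝ 1 w a)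
    (hinj : ∀ η, fderiv ℝ w a (0, η, 0) = 0 → η = 0) :
    ∃ s : E × E × ℝ → E × E × ℝ, ContDiffAt ℝ 1 s (a.1, w a, a.2.2) ∧
      s (a.1, w a, a.2.2) = a ∧
      ∀ᶠ y in 𝓝 (a.1, w a, a.2.2), (s y).1 = y.1 ∧ w (s y) = y.2.1 ∧ (s y).2.2 = y.2.2 := by
  have : CompleteSpace E := FiniteDimensional.complete ℝ E
  set f : E × E × ℝ → E × E × ℝ := fun q => (q.1, w q, q.2.2) with hf
  have hfc : ContDiffAt ℝ 1 f a :=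
    contDiffAt_fst.prodMk (hw.prodMk (contDiffAt_snd.comp a contDiffAt_snd))
  set T : E × E × ℝ →L[ℝ] E × E × ℝ := (ContinuousLinearMap.fst ℝ E (E × ℝ)).prod
    ((fderiv ℝ w a).prod ((ContinuousLinearMap.snd ℝ E ℝ).comp
      (ContinuousLinearMap.snd ℝ E (E × ℝ)))) with hT
  have hfd : HasFDerivAt f T a :=
    hasFDerivAt_fst.prodMk ((hw.differentiableAt (by simp)).hasFDerivAt.prodMk
      (hasFDerivAt_snd.comp a hasFDerivAt_snd))
  have hTinj : Function.Injective (T : E × E × ℝ →ₗ[ℝ] E × E × ℝ) := by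
    rw [← LinearMap.ker_eq_bot, LinearMap.ker_eq_bot']
    rintro ⟨x, η, z⟩ hv
    have h1 : x = 0 := congrArg Prod.fst hv
    have h3 : z = 0 := congrArg (fun v : E × E × ℝ => v.2.2) hv
    have h2 : fderiv ℝ w a (x, η, z) = 0 := congrArg (fun v : E × E × ℝ => v.2.1) hv
    subst h1 h3
    rw [hinj η h2]
    rfl
  set e : (E × E × ℝ) ≃L[ℝ] E × E × ℝ :=
    (LinearEquiv.ofInjectiveEndo (T : E × E × ℝ →ₗ[ℝ] E × E × ℝ) hTinj).toContinuousLinearEquiv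
  have hfe : HasFDerivAt f (e : E × E × ℝ →L[ℝ] E × E × ℝ) a :=
    hfd.congr_fderiv (ContinuousLinearMap.ext fun v => rfl)
  refine ⟨hfc.localInverse hfe one_ne_zero, hfc.to_localInverse hfe one_ne_zero,
    hfc.localInverse_apply_image hfe one_ne_zero, ?_⟩
  filter_upwards [(hfc.hasStrictFDerivAt' hfe one_ne_zero).eventually_right_inverse] with y hy
  obtain ⟨h1, h2⟩ := Prod.ext_iff.1 hy
  obtain ⟨h2, h3⟩ := Prod.ext_iff.1 h2
  exact ⟨h1, h2, h3⟩

section Region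

variable {E G : Type*} [NormedAddCommGroup E] [NormedSpace ℝ E] [FiniteDimensional ℝ E]
  [TopologicalSpace G] [ChartedSpace E G] [Group G] [LieGroup 𝓘(ℝ, E) ∞ G]
  {L : VelSpace E G → ℝ} {h R : ℝ}

/-- The endpoint map `(ξ, z) ↦ g(h)` of the solutions that start at `g` with `‖(ξ, z)‖ < R` is
close to `ξ ↦ h A ξ`, in some chart, with an error smaller than `A` can compensate. -/
def IsRegularBase (L : VelSpace E G → ℝ) (h R : ℝ) (g : G) : Prop :=
  ∃ (c : G) (A : E →L[ℝ] E) (κ : ℝ), g ∈ (extChartAt 𝓘(ℝ, E) c).source ∧ 0 ≤ κ ∧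
    (∀ η, η ≠ 0 → κ * ‖η‖ < ‖A η‖) ∧
    ∀ p ∈ Metric.ball (0 : E × ℝ) R, HasEndEstimate L h c A κ (extChartAt 𝓘(ℝ, E) c g, p)

theorem velSymm_chart {c : G} {x : VelSpace E G} (hx : x.1 ∈ (extChartAt 𝓘(ℝ, E) c).source) :
    velSymm c (extChartAt 𝓘(ℝ, E) c x.1, x.2) = x :=
  Prod.ext ((extChartAt 𝓘(ℝ, E) c).left_inv hx) rfl

/-- The partial derivative of the endpoint map in the direction of `ξ` is injective. -/
theorem HasEndEstimate.injective (hh : 0 < h) {c : G} {A : E →L[ℝ] E} {κ : ℝ}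
    (hA : ∀ η, η ≠ 0 → κ * ‖η‖ < ‖A η‖) {q : E × E × ℝ} (hq : HasEndEstimate L h c A κ q) (η : E)
    (hη : fderiv ℝ (localEnd L h c) q (0, η, 0) = 0) : η = 0 := by
  by_contra hne
  have h1 := hq.norm_sub_le η
  rw [hη, zero_sub, norm_neg, norm_smul, Real.norm_of_nonneg hh.le] at h1
  nlinarith [hA η hne]

/-- By the mean value inequality, the initial velocity is determined by the endpoint. -/
theorem IsRegularBase.velocity_eq (hh : 0 < h) {g : G} (hg : IsRegularBase L h R g) {ξ ξ' : E}
    {z : ℝ} (hξ : (ξ, z) ∈ Metric.ball (0 : E × ℝ) R) (hξ' : (ξ', z) ∈ Metric.ball (0 : E × ℝ) R)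
    (heq : (flow (hamiltonian L) h (legendre L (g, ξ, z))).1 =
      (flow (hamiltonian L) h (legendre L (g, ξ', z))).1) : ξ = ξ' := by
  obtain ⟨c, A, κ, hgc, hκ, hA, hest⟩ := hg
  set φ := extChartAt 𝓘(ℝ, E) c
  have hz : z ∈ Metric.ball (0 : ℝ) R := by
    have := hξ
    rw [← Prod.mk_zero_zero, ← ball_prod_same] at this
    exact this.2
  have hsub : ∀ ζ : E, ζ ∈ Metric.ball (0 : E) R ↔ (ζ, z) ∈ Metric.ball (0 : E × ℝ) R :=
    fun ζ => by
      rw [← Prod.mk_zero_zero, ← ball_prod_same]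
      exact ⟨fun h => ⟨h, hz⟩, fun h => h.1⟩
  set f : E → E := fun ζ => localEnd L h c (φ g, ζ, z)
  set ι : E →L[ℝ] E × E × ℝ := (ContinuousLinearMap.inr ℝ E (E × ℝ)).comp
    (ContinuousLinearMap.inl ℝ E ℝ)
  have hd : ∀ ζ ∈ Metric.ball (0 : E) R, HasFDerivWithinAt f
      ((fderiv ℝ (localEnd L h c) (φ g, ζ, z)).comp ι) (Metric.ball (0 : E) R) ζ := by
    intro ζ hζ
    have h1 := ((hest _ ((hsub ζ).1 hζ)).contDiffAt.differentiableAt (by simp)).hasFDerivAt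
    have h2 : HasFDerivAt (fun ζ : E => (φ g, ζ, z)) ι ζ :=
      ((hasFDerivAt_const (φ g) ζ).prodMk ((hasFDerivAt_id ζ).prodMk
        (hasFDerivAt_const z ζ))).congr_fderiv (ContinuousLinearMap.ext fun _ => rfl)
    exact (h1.comp ζ h2).hasFDerivWithinAt
  have hb : ∀ ζ ∈ Metric.ball (0 : E) R,
      ‖(fderiv ℝ (localEnd L h c) (φ g, ζ, z)).comp ι - h • A‖ ≤ κ * h := fun ζ hζ =>
    ContinuousLinearMap.opNorm_le_bound _ (by positivity)
      fun η => (hest _ ((hsub ζ).1 hζ)).norm_sub_le η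
  have key := Convex.norm_image_sub_le_of_norm_hasFDerivWithin_le' hd hb (convex_ball _ _)
    ((hsub ξ').2 hξ') ((hsub ξ).2 hξ)
  have e : f ξ = f ξ' := by
    have e1 : ∀ ζ : E, f ζ = φ (flow (hamiltonian L) h (legendre L (g, ζ, z))).1 := fun ζ => by
      show localEnd L h c (φ g, ζ, z) = _
      rw [localEnd, velSymm_chart (x := (g, ζ, z)) hgc]
    rw [e1, e1, heq]
  rw [e, sub_self, zero_sub, norm_neg] at key
  by_contra hne
  have h2 := hA (ξ - ξ') (sub_ne_zero.2 hne)
  have h3 : ‖(h • A) (ξ - ξ')‖ = h * ‖A (ξ - ξ')‖ := by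
    rw [smul_apply, norm_smul, Real.norm_of_nonneg hh.le]
  rw [h3] at key
  nlinarith

theorem IsRegularBase.mem_flowDomain {g : G} (hg : IsRegularBase L h R g) {p : E × ℝ}
    (hp : p ∈ Metric.ball (0 : E × ℝ) R) : legendre L (g, p) ∈ flowDomain (hamiltonian L) h := by
  obtain ⟨c, A, κ, hgc, hκ, hA, hest⟩ := hg
  have := (hest p hp).eventually_mem.self_of_nhds.1
  rwa [velSymm_chart (x := (g, p)) hgc] at this

variable [T2Space G]

/-- Over an open set of regular base points, the states with `‖(ξ, z)‖ < R` form a regular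
region. -/
theorem isBVPRegion_of_isRegularBase (hL : ContMDiff (velModel E) 𝓘(ℝ, ℝ) ∞ L)
    (hreg : IsHyperregular L) (hh : 0 < h) {W : Set G} (hWo : IsOpen W)
    (hW : ∀ g ∈ W, IsRegularBase L h R g) :
    IsBVPRegion L h {x | x.1 ∈ W ∧ x.2 ∈ Metric.ball (0 : E × ℝ) R} := by
  set U : Set (VelSpace E G) := {x | x.1 ∈ W ∧ x.2 ∈ Metric.ball (0 : E × ℝ) R}
  have hH := contMDiff_hamiltonian hL hreg
  have hUo : IsOpen U :=
    (hWo.preimage continuous_fst).inter (Metric.isOpen_ball.preimage continuous_snd)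
  have hex : ∀ x ∈ U, ∃ c, IsEPHSolution L (Icc 0 h) c ∧ c 0 = x ∧
      (c h).1 = (flow (hamiltonian L) h (legendre L x)).1 := by
    intro x hx
    have hfl := isFlowLine_flow hH hh.le ((hW _ hx.1).mem_flowDomain hx.2)
    have h0 : flow (hamiltonian L) 0 (legendre L x) = legendre L x := hfl.1
    refine ⟨_, hfl.isEPHSolution hL hreg, ?_, ?_⟩
    · exact (congrArg (legendreInv L) h0).trans (hreg.legendreInv_legendre x)
    · exact hreg.legendreInv_fst _
  have hend : ∀ c : ℝ → VelSpace E G, IsEPHSolution L (Icc 0 h) c →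
      (c h).1 = (flow (hamiltonian L) h (legendre L (c 0))).1 := fun c hc => by
    rw [ContactLie.flow_eq hH (hc.isFlowLine hL hreg) (right_mem_Icc.2 hh.le)]
    rfl
  have huniq : ∀ x ∈ U, ∀ x' ∈ U, x.1 = x'.1 → x.2.2 = x'.2.2 →
      (flow (hamiltonian L) h (legendre L x)).1 =
        (flow (hamiltonian L) h (legendre L x')).1 → x = x' := by
    rintro ⟨g, ξ, z⟩ hx ⟨g', ξ', z'⟩ hx' hg hz he
    change g = g' at hg
    change z = z' at hz
    subst hg hz
    rw [(hW g hx.1).velocity_eq hh hx.2 hx'.2 he]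
  have hinit : ∀ d c c', IsBVPSolution L h U d c → IsBVPSolution L h U d c' → c 0 = c' 0 := by
    rintro d c c' ⟨h1, h2, h3, h4, h5⟩ ⟨h1', h2', h3', h4', h5'⟩
    refine huniq _ h2 _ h2' (h3.trans h3'.symm) (h4.trans h4'.symm) ?_
    rw [← hend c h1, ← hend c' h1', h5, h5']
  -- near boundary data of a solution, the inverse function theorem yields the initial velocity
  have hlocal : ∀ d ∈ bvpDomain L h U, ∃ σ : G × G × ℝ → E,
      ContMDiffAt ((𝓘(ℝ, E)).prod ((𝓘(ℝ, E)).prod 𝓘(ℝ, ℝ))) 𝓘(ℝ, E) 1 σ d ∧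
      ∀ᶠ d' in 𝓝 d, d' ∈ bvpDomain L h U ∧ (bvpSolution L h U d' 0).2.1 = σ d' := by
    intro d hd
    obtain ⟨h1, h2, h3, h4, h5⟩ := bvpSolution_spec hd
    rw [hend _ h1] at h5
    set x₀ := bvpSolution L h U d 0
    obtain ⟨c, A, κ, hgc, hκ, hA, hest⟩ := hW _ h2.1
    set φ := extChartAt 𝓘(ℝ, E) c
    set a : E × E × ℝ := (φ x₀.1, x₀.2)
    have ha := hest _ h2.2
    have hax : velSymm c a = x₀ := velSymm_chart hgc
    have hd1 : d.1 ∈ φ.source := h3 ▸ hgc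
    have hd2 : d.2.1 ∈ φ.source := by
      have := ha.eventually_mem.self_of_nhds.2
      rwa [hax, h5] at this
    set ψ : G × G × ℝ → E × E × ℝ := fun d => (φ d.1, φ d.2.1, d.2.2)
    have hψd : (a.1, localEnd L h c a, a.2.2) = ψ d := by
      show (φ x₀.1, localEnd L h c a, x₀.2.2) = (φ d.1, φ d.2.1, d.2.2)
      rw [localEnd, hax, h3, h4, h5]
    obtain ⟨s, hs, hsa, hsev⟩ := exists_contDiffAt_section ha.contDiffAt (ha.injective hh hA)
    rw [hψd] at hs hsa hsev
    have hψ : ContMDiffAt ((𝓘(ℝ, E)).prod ((𝓘(ℝ, E)).prod 𝓘(ℝ, ℝ))) 𝓘(ℝ, E × E × ℝ) 1 ψ d := by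
      have c1 : ContMDiffAt ((𝓘(ℝ, E)).prod ((𝓘(ℝ, E)).prod 𝓘(ℝ, ℝ))) 𝓘(ℝ, E) ∞
          (fun d : G × G × ℝ => φ d.1) d :=
        ContMDiffAt.comp (g := φ) (f := Prod.fst) d (contMDiffAt_chart hd1) contMDiffAt_fst
      have c2 : ContMDiffAt ((𝓘(ℝ, E)).prod ((𝓘(ℝ, E)).prod 𝓘(ℝ, ℝ))) 𝓘(ℝ, E) ∞
          (fun d : G × G × ℝ => φ d.2.1) d :=
        ContMDiffAt.comp (g := φ) (f := fun d : G × G × ℝ => d.2.1) d (contMDiffAt_chart hd2)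
          (contMDiffAt_fst.comp d contMDiffAt_snd)
      have c3 : ContMDiffAt ((𝓘(ℝ, E)).prod ((𝓘(ℝ, E)).prod 𝓘(ℝ, ℝ))) 𝓘(ℝ, ℝ) ∞
          (fun d : G × G × ℝ => d.2.2) d := contMDiffAt_snd.comp d contMDiffAt_snd
      exact (c1.prodMk_space (c2.prodMk_space c3)).of_le (by simp)
    have hsψ : ContMDiffAt ((𝓘(ℝ, E)).prod ((𝓘(ℝ, E)).prod 𝓘(ℝ, ℝ))) 𝓘(ℝ, E × E × ℝ) 1
        (fun d => s (ψ d)) d := hs.contMDiffAt.comp d hψ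
    refine ⟨fun d => (s (ψ d)).2.1, ?_, ?_⟩
    · exact ContMDiffAt.comp (g := fun q : E × E × ℝ => q.2.1) (I' := 𝓘(ℝ, E × E × ℝ)) d
        (contDiff_fst.comp contDiff_snd).contMDiff.contMDiffAt hsψ
    · have hlim : Tendsto (fun d => s (ψ d)) (𝓝 d) (𝓝 a) := by
        have := hsψ.continuousAt.tendsto
        rwa [hsa] at this
      have hvel : ContinuousAt (velSymm (G := G) c) a :=
        (((contMDiffAt_extChartAt_symm ha.mem_target).continuousAt).comp
          (f := Prod.fst) (x := a) continuousAt_fst).prodMk continuousAt_snd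
      have hUev : ∀ᶠ d' in 𝓝 d, velSymm c (s (ψ d')) ∈ U :=
        hlim.eventually (hvel.eventually_mem (hUo.mem_nhds (by rw [hax]; exact h2)))
      have ho : ∀ᶠ g in 𝓝 d.1, g ∈ φ.source := extChartAt_source_mem_nhds' hd1
      have ho' : ∀ᶠ g in 𝓝 d.2.1, g ∈ φ.source := extChartAt_source_mem_nhds' hd2
      filter_upwards [hψ.continuousAt.eventually hsev, hlim.eventually ha.eventually_mem, hUev,
        continuousAt_fst.eventually ho,
        (continuousAt_fst.comp (f := Prod.snd) (x := d) continuousAt_snd).eventually ho']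
        with d' f1 f2 f3 f4 f5
      obtain ⟨g1, g2, g3⟩ := f1
      set x' := velSymm c (s (ψ d')) with hx'
      obtain ⟨γ, hγ, hγ0, hγh⟩ := hex x' f3
      have hx1 : x'.1 = d'.1 := by
        show φ.symm (s (ψ d')).1 = d'.1
        rw [g1]; exact φ.left_inv f4
      have hx2 : (flow (hamiltonian L) h (legendre L x')).1 = d'.2.1 :=
        φ.injOn f2.2 f5 g2
      have hsol : IsBVPSolution L h U d' γ :=
        ⟨hγ, hγ0 ▸ f3, by rw [hγ0, hx1], by rw [hγ0]; exact g3, hγh.trans hx2⟩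
      have hdom : d' ∈ bvpDomain L h U := ⟨γ, hsol⟩
      refine ⟨hdom, ?_⟩
      rw [hinit _ _ _ (bvpSolution_spec hdom) hsol, hγ0]
      rfl
  refine ⟨hUo, fun x hx => ?_, fun d c c' hc hc' => hc.1.eqOn hL hreg hc'.1 (hinit d c c' hc hc'),
    ?_, fun d hd => ?_⟩
  · obtain ⟨c, h1, h2, -⟩ := hex x hx
    exact ⟨c, h1, h2⟩
  · refine isOpen_iff_mem_nhds.2 fun d hd => ?_
    obtain ⟨σ, -, hσ⟩ := hlocal d hd
    exact hσ.mono fun _ h => h.1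
  · obtain ⟨σ, hσc, hσ⟩ := hlocal d hd
    exact (hσc.congr_of_eventuallyEq (hσ.mono fun _ h => h.2)).contMDiffWithinAt

/-- The estimates at the points of a compact ball of `(ξ, z)` combine to one that is uniform over
the ball, over short times and over base points near `c`. -/
theorem eventually_isRegularBase (hL : ContMDiff (velModel E) 𝓘(ℝ, ℝ) ∞ L)
    (hreg : IsHyperregular L) (c : G) (R : ℝ) :
    ∀ᶠ a : ℝ × G in 𝓝 (0, c), 0 < a.1 → IsRegularBase L a.1 R a.2 := by
  set φ := extChartAt 𝓘(ℝ, E) c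
  have : ProperSpace (E × ℝ) := FiniteDimensional.proper ℝ (E × ℝ)
  set e : E ≃L[ℝ] E := chartLeftEquiv (mem_extChartAt_target (I := 𝓘(ℝ, E)) c)
  set C := ‖(e.symm : E →L[ℝ] E)‖ + 1
  have hC : 0 < C := by positivity
  -- `κ = 1 / (2 C)` with `C > ‖A⁻¹‖` is an error that `A` can compensate
  have hA : ∀ η : E, η ≠ 0 → (2 * C)⁻¹ * ‖η‖ < ‖chartLeft (E := E) c (φ c) η‖ := by
    intro η hη
    have hpos : 0 < ‖η‖ := norm_pos_iff.2 hη
    have h1 : ‖η‖ ≤ C * ‖chartLeft (E := E) c (φ c) η‖ :=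
      calc ‖η‖ = ‖(e.symm : E →L[ℝ] E) (e η)‖ := by simp
        _ ≤ ‖(e.symm : E →L[ℝ] E)‖ * ‖e η‖ := ContinuousLinearMap.le_opNorm _ _
        _ ≤ C * ‖e η‖ := by gcongr; simp [C]
    rw [inv_mul_lt_iff₀ (by positivity)]
    linarith
  have h1 := (isCompact_closedBall (0 : E × ℝ) R).eventually_forall_of_forall_eventually
    (x₀ := (φ c, (0 : ℝ))) (P := fun b p => 0 < b.2 →
      HasEndEstimate L b.2 c (chartLeft c (φ c)) (2 * C)⁻¹ (b.1, p))
    fun p _ => eventually_hasEndEstimate hL hreg c p (κ := (2 * C)⁻¹) (by positivity)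
  have h2 : ContinuousAt (fun a : ℝ × G => (φ a.2, a.1)) (0, c) :=
    ((continuousAt_extChartAt c).comp (f := Prod.snd) (x := ((0 : ℝ), c))
      continuousAt_snd).prodMk continuousAt_fst
  have h3 : ∀ᶠ g in 𝓝 c, g ∈ φ.source := extChartAt_source_mem_nhds c
  filter_upwards [h2.eventually h1,
    (continuousAt_snd (p := ((0 : ℝ), c))).eventually h3] with a ha1 ha2 ha0
  exact ⟨c, _, (2 * C)⁻¹, ha2, by positivity, hA,
    fun p hp => ha1 p (Metric.ball_subset_closedBall hp) ha0⟩

/-- For small `h`, every compact set of states lies in a regular region. -/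
theorem exists_isBVPRegion (hL : ContMDiff (velModel E) 𝓘(ℝ, ℝ) ∞ L) (hreg : IsHyperregular L)
    {K : Set (VelSpace E G)} (hK : IsCompact K) :
    ∃ h₀ > 0, ∀ h, 0 < h → h < h₀ → ∃ U, K ⊆ U ∧ IsBVPRegion L h U := by
  obtain ⟨R, hR⟩ := (hK.image continuous_snd).isBounded.subset_ball (0 : E × ℝ)
  have h1 : ∀ g : G, ∀ᶠ a : ℝ × G in 𝓝 (0, g),
      ∀ᶠ g' in 𝓝 a.2, 0 < a.1 → IsRegularBase L a.1 R g' := fun g => by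
    filter_upwards [(eventually_isRegularBase hL hreg g R).eventually_nhds] with a ha
    exact ((Continuous.prodMk_right a.1).tendsto a.2).eventually ha
  have h2 := (hK.image continuous_fst).eventually_forall_of_forall_eventually
    (P := fun h g => ∀ᶠ g' in 𝓝 g, 0 < h → IsRegularBase L h R g') (x₀ := 0) fun g _ => h1 g
  obtain ⟨h₀, hpos, hh₀⟩ := Metric.eventually_nhds_iff.1 h2
  refine ⟨h₀, hpos, fun h hh hlt => ?_⟩
  have h3 := hh₀ (y := h) (by rwa [Real.dist_0_eq_abs, abs_of_pos hh])
  refine ⟨{x | x.1 ∈ {g : G | ∀ᶠ g' in 𝓝 g, IsRegularBase L h R g'} ∧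
    x.2 ∈ Metric.ball (0 : E × ℝ) R}, fun x hx => ⟨?_, hR (mem_image_of_mem _ hx)⟩,
    isBVPRegion_of_isRegularBase hL hreg hh isOpen_setOfPred_eventually_nhds
      fun g hg => hg.self_of_nhds⟩
  exact (h3 _ (mem_image_of_mem _ hx)).mono fun g hg => hg hh

end Region

end ContactLie

end

theorem mainTheorem5 {E G : Type*} [NormedAddCommGroup E] [NormedSpace ℝ E] [FiniteDimensional ℝ E]
    [TopologicalSpace G] [T2Space G] [ChartedSpace E G] [Group G] [LieGroup 𝓘(ℝ, E) ∞ G]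
    (L : ContactLie.VelSpace E G → ℝ)
    (hL : ContMDiff (ContactLie.velModel E) 𝓘(ℝ, ℝ) ∞ L)
    (hreg : ContactLie.IsHyperregular L) :
    -- for small `h` the boundary value problem is well posed near any compact set of states
    (∀ K : Set (ContactLie.VelSpace E G), IsCompact K → ∃ h₀ > 0, ∀ h, 0 < h → h < h₀ →
      ∃ U, K ⊆ U ∧ ContactLie.IsBVPRegion L h U) ∧
    -- the discrete Herglotz principle for `L_h^e` reproduces the time-`h` flow of `X_H`
    (∀ (h : ℝ) (U : Set (ContactLie.VelSpace E G)), 0 < h → ContactLie.IsBVPRegion L h U →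
      ∀ N : ℕ, 1 ≤ N →
        (∀ (z₀ : ℝ) (g : ℕ → G), ContactLie.IsAdmissible L h U N z₀ g →
          (∀ k ≤ N, (ContactLie.discreteState L h U N z₀ g k).1 = g k ∧
            (ContactLie.discreteState L h U N z₀ g k).2.2 =
              ContactLie.discreteCost (ContactLie.exactLagrangian L h U) g z₀ k) ∧
          (ContactLie.IsDiscreteHerglotz E (ContactLie.exactLagrangian L h U) N z₀ g ↔
            ∀ k < N,
              ContactLie.legendre L (ContactLie.discreteState L h U N z₀ g k) ∈
                ContactLie.flowDomain (ContactLie.hamiltonian L) h ∧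
              ContactLie.legendre L (ContactLie.discreteState L h U N z₀ g (k + 1)) =
                ContactLie.flow (ContactLie.hamiltonian L) h
                  (ContactLie.legendre L (ContactLie.discreteState L h U N z₀ g k)))) ∧
        (∀ y : ℕ → ContactLie.PhaseSpace E G,
          (∀ k < N, y k ∈ ContactLie.legendre L '' U ∧
            y k ∈ ContactLie.flowDomain (ContactLie.hamiltonian L) h ∧
            y (k + 1) = ContactLie.flow (ContactLie.hamiltonian L) h (y k)) →
          ∃ (z₀ : ℝ) (g : ℕ → G), ContactLie.IsAdmissible L h U N z₀ g ∧
            ContactLie.IsDiscreteHerglotz E (ContactLie.exactLagrangian L h U) N z₀ g ∧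
            ∀ k ≤ N, y k = ContactLie.legendre L (ContactLie.discreteState L h U N z₀ g k))) ∧
    -- `(Φ_H^h)^* θ = exp (-∫₀ʰ (∂H/∂z) ∘ Φ_H^t dt) θ`
    (∀ (h : ℝ) (y : ContactLie.PhaseSpace E G), 0 < h →
      y ∈ ContactLie.flowDomain (ContactLie.hamiltonian L) h →
        ContactLie.flowDomain (ContactLie.hamiltonian L) h ∈ 𝓝 y ∧
        MDifferentiableAt (ContactLie.phaseModel E) (ContactLie.phaseModel E)
          (ContactLie.flow (ContactLie.hamiltonian L) h) y ∧
        ∀ v : TangentSpace (ContactLie.phaseModel E) y,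
          ContactLie.contactForm (ContactLie.flow (ContactLie.hamiltonian L) h y)
            (mfderiv (ContactLie.phaseModel E) (ContactLie.phaseModel E)
              (ContactLie.flow (ContactLie.hamiltonian L) h) y v) =
          Real.exp (-∫ t in (0 : ℝ)..h, ContactLie.hamCost (ContactLie.hamiltonian L)
              (ContactLie.flow (ContactLie.hamiltonian L) t y)) *
            ContactLie.contactForm y v) ∧
    -- `(Φ_H^h)^* θ = (1 - h (∂H/∂z) + O(h²)) θ`
    (∀ y : ContactLie.PhaseSpace E G, ∃ r : ℝ → ℝ,
      r =O[𝓝[>] 0] (fun h => h ^ 2) ∧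
      ∀ᶠ h in 𝓝[>] (0 : ℝ), y ∈ ContactLie.flowDomain (ContactLie.hamiltonian L) h ∧
        ∀ v : TangentSpace (ContactLie.phaseModel E) y,
          ContactLie.contactForm (ContactLie.flow (ContactLie.hamiltonian L) h y)
            (mfderiv (ContactLie.phaseModel E) (ContactLie.phaseModel E)
              (ContactLie.flow (ContactLie.hamiltonian L) h) y v) =
          (1 - h * ContactLie.hamCost (ContactLie.hamiltonian L) y + r h) *
            ContactLie.contactForm y v) := by
  have hH := ContactLie.contMDiff_hamiltonian hL hreg
  refine ⟨fun K hK => ContactLie.exists_isBVPRegion hL hreg hK, fun h U hh hU N hN => ⟨?_, ?_⟩,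
    fun h y hh hy => ?_, ContactLie.exists_conformal_factor_expansion hH⟩
  · intro z₀ g hg
    exact ⟨fun k hk => hg.discreteState_spec hL hreg hh hN hk,
      (hg.isDiscreteHerglotz_iff hL hreg hh hU hN).trans (hg.flow_iff hL hreg hh).symm⟩
  · intro y hy
    obtain ⟨z₀, g, hg, hyk⟩ := ContactLie.exists_isAdmissible_of_flow hL hreg hh hU hN hy
    refine ⟨z₀, g, hg, ?_, hyk⟩
    rw [hg.isDiscreteHerglotz_iff hL hreg hh hU hN, ← hg.flow_iff hL hreg hh]
    intro k hk
    rw [← hyk k hk.le, ← hyk (k + 1) hk]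
    exact (hy k hk).2
  · have hc := ContactLie.isConformalAt_of_mem hH hh.le hy
    exact ⟨hc.mem_nhds, hc.mdifferentiableAt, hc.contactForm_mfderiv⟩
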